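/- **Setting.** Let $p$ be an odd prime, $e_p(x)=e^{2\pi i x/p}$, and $d\ge 0$. On row vectors $\vec n=(\vec n_1,\vec n_2)\in\mathbb F_p^{2d}$ let $\omega(\vec m,\vec n)=\vec m_1\cdot\vec n_2-\vec m_2\cdot\vec n_1$, and let $\mathrm{Sp}(2d,\mathbb F_p)$ act on the right, $\vec n\mapsto \vec nB$. On $L^2(\mathbb F_p^d)$ put $T_p^{(d)}(\vec n)\psi(\vec y)=e_p(\tfrac12\vec n_1\cdot\vec n_2)\,e_p(\vec n_2\cdot\vec y)\,\psi(\vec y+\vec n_1)$. A *quantization* is a unitary representation $U_p^{(d)}$ of $\mathrm{Sp}(2d,\mathbb F_p)$ on $L^2(\mathbb F_p^d)$ with $U_p^{(d)}(B)^{-1}T_p^{(d)}(\vec n)U_p^{(d)}(B)=T_p^{(d)}(\vec nB)$ for all $B,\vec n$. A quantization exists for every $d$; fix one for each $d$. Let $A\in\mathrm{Sp}(2d,\mathbb F_p)$ have $2d$ distinct eigenvalues in $\overline{\mathbb F}_p$, let $C_p(A)$ be its centralizer in $\mathrm{Sp}(2d,\mathbb F_p)$, and for a character $\chi$ of $C_p(A)$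 let $\mathcal H_\chi=\{\psi : U_p^{(d)}(B)\psi=\chi(B)\psi\ \ \forall B\in C_p(A)\}$. For a Galois orbit $\vartheta$ over $\mathbb F_p$ of eigenvalues of $A$ let $\vartheta^*=\{\lambda^{-1}:\lambda\in\vartheta\}$; the set $\bar\vartheta=\vartheta\cup\vartheta^*$ is a *symplectic orbit*, *symmetric* if $\vartheta=\vartheta^*$ and *nonsymmetric* otherwise. A *quadratic character* is a character of order exactly $2$. **(1) One orbit.** Suppose $A$ has exactly one symplectic orbit. Then $C_p(A)$ has a unique quadratic character $\chi_2$. For every character $\chi\ne\chi_2$, $\dim\mathcal H_\chi=1$. If the orbit is symmetric then $\dim\mathcal H_{\chi_2}=0$; if it is nonsymmetric then $\dim\mathcal H_{\chi_2}=2$. **(2) General case.** Let $E_{\bar\vartheta}\subseteq\mathbb F_p^{2d}$ be the $A$-invariant subspace of the vectors which over $\overline{\mathbb F}_p$ lie in the sum of the eigenspaces of $A$ for the eigenvalues in $\bar\vartheta$, and let $2d_{\bar\vartheta}=|\bar\vartheta|$. Then $\mathbb F_p^{2d}=\bigoplus_{\bar\vartheta}E_{\bar\vartheta}$ is an orthogonal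 decomposition into symplectic subspaces with $\dim E_{\bar\vartheta}=2d_{\bar\vartheta}$. Choose any symplectic basis of each $E_{\bar\vartheta}$; write $\vec n_{\bar\vartheta}\in\mathbb F_p^{2d_{\bar\vartheta}}$ for the coordinates of the projection of $\vec n$ to $E_{\bar\vartheta}$ and $B_{\bar\vartheta}\in\mathrm{Sp}(2d_{\bar\vartheta},\mathbb F_p)$ for the matrix of the restriction to $E_{\bar\vartheta}$ of $B\in C_p(A)$. Each $C_p(A_{\bar\vartheta})$ has a unique quadratic character, every character $\chi$ of $C_p(A)$ can be written uniquely as $\chi(B)=\prod_{\bar\vartheta}\chi_{\bar\vartheta}(B_{\bar\vartheta})$ with characters $\chi_{\bar\vartheta}$ of $C_p(A_{\bar\vartheta})$, and there is a unitary map $\mathcal U:L^2(\mathbb F_p^d)\to\bigotimes_{\bar\vartheta}L^2(\mathbb F_p^{d_{\bar\vartheta}})$ with $\mathcal U\,T_p^{(d)}(\vec n)\,\mathcal U^{-1}=\bigotimes_{\bar\vartheta}T_p^{(d_{\bar\vartheta})}(\vec n_{\bar\vartheta})$ for all $\vec n$. Let $\mathcal H^{\bar\vartheta}_{\chi_{\bar\vartheta}}\subseteq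 L^2(\mathbb F_p^{d_{\bar\vartheta}})$ be the joint eigenspace of $U_p^{(d_{\bar\vartheta})}(B)$, $B\in C_p(A_{\bar\vartheta})$, for $\chi_{\bar\vartheta}$. For $\chi=\prod\chi_{\bar\vartheta}$: * if no $\chi_{\bar\vartheta}$ is quadratic, then $\dim\mathcal H_\chi=1$; * if $\chi_{\bar\vartheta}$ is quadratic for some symmetric $\bar\vartheta$, then $\dim\mathcal H_\chi=0$; * otherwise (every $\bar\vartheta$ with $\chi_{\bar\vartheta}$ quadratic is nonsymmetric) $\dim\mathcal H_\chi=2^k$, where $k$ is the number of $\bar\vartheta$ for which $\chi_{\bar\vartheta}$ is quadratic. Moreover, in this case, for every such $\mathcal U$, every choice of nonzero vectors $\psi^{\bar\vartheta}_{\chi_{\bar\vartheta}}\in\mathcal H^{\bar\vartheta}_{\chi_{\bar\vartheta}}$ for the $\bar\vartheta$ with $\chi_{\bar\vartheta}$ not quadratic, and every choice of bases $\{\psi^{\bar\vartheta}_0,\psi^{\bar\vartheta}_1\}$ of $\mathcal H^{\bar\vartheta}_{\chi_{\bar\vartheta}}$ for the $\bar\vartheta$ with $\chi_{\bar\vartheta}$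 quadratic, the vectors $$\psi_\chi^\eta=\mathcal U^{-1}\Big(\bigotimes_{\chi_{\bar\vartheta}\text{ not quadratic}}\psi^{\bar\vartheta}_{\chi_{\bar\vartheta}}\otimes\bigotimes_{\chi_{\bar\vartheta}\text{ quadratic}}\psi^{\bar\vartheta}_{\eta_{\bar\vartheta}}\Big),\qquad \eta\in(\mathbb Z/2\mathbb Z)^k,$$ form a basis of $\mathcal H_\chi$. -/

import Mathlib

open Matrix

noncomputable section

/-- The state space `L²(𝔽_p^d)`. The factor `p^{-d}` in the usual inner product of this space is
left out: it changes neither unitarity nor any eigenspace. -/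
abbrev HilbertP (p d : ℕ) [Fact p.Prime] : Type := EuclideanSpace ℂ (Fin d → ZMod p)

/-- Phase space vectors `n = (n₁, n₂) ∈ 𝔽_p^{2d}`, as row vectors. -/
abbrev PhaseP (p d : ℕ) : Type := Fin d ⊕ Fin d → ZMod p

/-- The symplectic group `Sp(2d, 𝔽_p)`; matrices act on row vectors, `n ↦ n B`. -/
abbrev SpP (p d : ℕ) : Type := Matrix.symplecticGroup (Fin d) (ZMod p)

/-- `ω(m, n) = m₁ · n₂ - m₂ · n₁`. -/
def sympForm {p d : ℕ} (m n : PhaseP p d) : ZMod p :=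
  (m ∘ Sum.inl) ⬝ᵥ (n ∘ Sum.inr) - (m ∘ Sum.inr) ⬝ᵥ (n ∘ Sum.inl)

theorem sympForm_eq {p d : ℕ} (m n : PhaseP p d) :
    sympForm m n = -(m ⬝ᵥ (J (Fin d) (ZMod p) *ᵥ n)) := by
  have h : J (Fin d) (ZMod p) *ᵥ n = Sum.elim (-(n ∘ Sum.inr)) (n ∘ Sum.inl) := by
    rw [J, fromBlocks_mulVec, zero_mulVec, zero_mulVec, zero_add, add_zero, neg_mulVec,
      one_mulVec, one_mulVec]
  rw [h]
  simp only [sympForm, dotProduct, Fintype.sum_sum_type, Function.comp_apply, Sum.elim_inl,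
    Sum.elim_inr, Pi.neg_apply, mul_neg, Finset.sum_neg_distrib]
  ring

theorem sympForm_vecMul {p d : ℕ} (B : Matrix (Fin d ⊕ Fin d) (Fin d ⊕ Fin d) (ZMod p))
    (m n : PhaseP p d) :
    sympForm (m ᵥ* B) (n ᵥ* B) = -(m ⬝ᵥ ((B * J (Fin d) (ZMod p) * Bᵀ) *ᵥ n)) := by
  rw [sympForm_eq, ← mulVec_transpose B n, mulVec_mulVec, ← dotProduct_mulVec, mulVec_mulVec,
    Matrix.mul_assoc]

theorem mem_symplecticGroup_iff {p d : ℕ}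
    (B : Matrix (Fin d ⊕ Fin d) (Fin d ⊕ Fin d) (ZMod p)) :
    B ∈ symplecticGroup (Fin d) (ZMod p) ↔
      ∀ m n : PhaseP p d, sympForm (m ᵥ* B) (n ᵥ* B) = sympForm m n := by
  rw [SymplecticGroup.mem_iff]
  constructor
  · intro h m n
    rw [sympForm_vecMul, h, sympForm_eq]
  · intro h
    ext i j
    have := h (Pi.single i 1) (Pi.single j 1)
    rw [sympForm_vecMul, sympForm_eq, neg_inj] at this
    simpa using this

/-! ### Quantization -/

section Quantization

variable {p : ℕ} [Fact p.Prime]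

/-- The elementary operator
`T_p(n) ψ(y) = e_p(½ n₁·n₂) e_p(n₂·y) ψ(y + n₁)`, where `e_p(x) = exp(2πi x / p)` and `½` is the
inverse of `2` in `𝔽_p` (`p` odd). -/
def elemOp {d : ℕ} (n : PhaseP p d) : HilbertP p d →ₗ[ℂ] HilbertP p d where
  toFun ψ := WithLp.toLp 2 fun y =>
    ZMod.stdAddChar (N := p) (2⁻¹ * ((n ∘ Sum.inl) ⬝ᵥ (n ∘ Sum.inr))) *
      ZMod.stdAddChar (N := p) ((n ∘ Sum.inr) ⬝ᵥ y) * ψ (y + n ∘ Sum.inl)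
  map_add' ψ φ := by
    ext y
    simp [mul_add]
  map_smul' c ψ := by
    ext y
    simp only [PiLp.smul_apply, smul_eq_mul, RingHom.id_apply]
    ring

/-- A quantization of `Sp(2d, 𝔽_p)`: a unitary representation `U` on `L²(𝔽_p^d)` with
`U(B)⁻¹ T_p(n) U(B) = T_p(n B)` for all `B` and `n`. -/
def IsQuantization {d : ℕ} (U : SpP p d →* (HilbertP p d ≃ₗᵢ[ℂ] HilbertP p d)) : Prop :=
  ∀ (B : SpP p d) (n : PhaseP p d) (ψ : HilbertP p d),
    (U B)⁻¹ (elemOp n (U B ψ)) = elemOp (n ᵥ* B.1) ψ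

/-- The Hecke group `C_p(A)`: the centralizer of `A` in `Sp(2d, 𝔽_p)`. -/
abbrev heckeGroup {d : ℕ} (A : SpP p d) : Subgroup (SpP p d) := Subgroup.centralizer {A}

/-- The joint eigenspace `ℋ_χ` of the Hecke operators `U(B)`, `B ∈ C_p(A)`. -/
def heckeEigenspace {d : ℕ} (U : SpP p d →* (HilbertP p d ≃ₗᵢ[ℂ] HilbertP p d)) (A : SpP p d)
    (χ : heckeGroup A →* ℂˣ) : Submodule ℂ (HilbertP p d) where
  carrier := {ψ | ∀ B : heckeGroup A, U B.1 ψ = (χ B : ℂ) • ψ}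
  add_mem' h₁ h₂ B := by rw [map_add, h₁ B, h₂ B, smul_add]
  zero_mem' B := by simp
  smul_mem' c ψ h B := by rw [map_smul, h B, smul_comm]

end Quantization

/-! ### Orbits of eigenvalues and the corresponding subspaces -/

section Orbits

/-- The Galois (Frobenius) orbit of `x` over `𝔽_p`. -/
def galOrbit (p : ℕ) [Fact p.Prime] (x : AlgebraicClosure (ZMod p)) :
    Set (AlgebraicClosure (ZMod p)) :=
  MulAction.orbit (AlgebraicClosure (ZMod p) ≃ₐ[ZMod p] AlgebraicClosure (ZMod p)) x

/-- The symplectic orbit `ϑ ∪ ϑ*` of `x`, where `ϑ` is the orbit of `x` and `ϑ*` that of `x⁻¹`. -/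
def sympOrbit (p : ℕ) [Fact p.Prime] (x : AlgebraicClosure (ZMod p)) :
    Set (AlgebraicClosure (ZMod p)) :=
  galOrbit p x ∪ galOrbit p x⁻¹

variable {p : ℕ} [Fact p.Prime] {d : ℕ}

/-- The eigenvalues of `A` in the algebraic closure of `𝔽_p`, with algebraic multiplicity. -/
def eigenvaluesP (A : SpP p d) : Multiset (AlgebraicClosure (ZMod p)) :=
  A.1.charpoly.aroots (AlgebraicClosure (ZMod p))

open Classical in
/-- The set of symplectic orbits of the eigenvalues of `A`. -/
def sympOrbits (A : SpP p d) : Finset (Set (AlgebraicClosure (ZMod p))) :=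
  (eigenvaluesP A).toFinset.image (sympOrbit p)

/-- A symplectic orbit is symmetric if the orbit of each of its elements `x` is also the orbit
of `x⁻¹`. -/
def IsSymmetricOrbit (ϑ : Set (AlgebraicClosure (ZMod p))) : Prop :=
  ∀ x ∈ ϑ, x⁻¹ ∈ galOrbit p x

/-- Half the size of a symplectic orbit. -/
def halfDim (ϑ : Set (AlgebraicClosure (ZMod p))) : ℕ := ϑ.ncard / 2

/-- The invariant subspace `E_ϑ ⊆ 𝔽_p^{2d}` of the vectors that lie, over the algebraic closure, in
the sum of the eigenspaces of `A` for the eigenvalues in `ϑ`. -/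
def orbitSpace (A : Matrix (Fin d ⊕ Fin d) (Fin d ⊕ Fin d) (ZMod p))
    (ϑ : Set (AlgebraicClosure (ZMod p))) : Submodule (ZMod p) (PhaseP p d) :=
  ((⨆ x ∈ ϑ, Module.End.eigenspace
      (A.map (algebraMap (ZMod p) (AlgebraicClosure (ZMod p)))).vecMulLinear x).restrictScalars
    (ZMod p)).comap
    ((Algebra.linearMap (ZMod p) (AlgebraicClosure (ZMod p))).compLeft (Fin d ⊕ Fin d))

theorem vecMul_mem_orbitSpace {A B : Matrix (Fin d ⊕ Fin d) (Fin d ⊕ Fin d) (ZMod p)}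
    (h : A * B = B * A) {ϑ : Set (AlgebraicClosure (ZMod p))} {n : PhaseP p d}
    (hn : n ∈ orbitSpace A ϑ) : n ᵥ* B ∈ orbitSpace A ϑ := by
  set f := algebraMap (ZMod p) (AlgebraicClosure (ZMod p))
  have hAB : A.map f * B.map f = B.map f * A.map f := by
    rw [← Matrix.map_mul, ← Matrix.map_mul, h]
  have key : (⨆ x ∈ ϑ, Module.End.eigenspace (A.map f).vecMulLinear x) ≤
      (⨆ x ∈ ϑ, Module.End.eigenspace (A.map f).vecMulLinear x).comap
        (B.map f).vecMulLinear := by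
    refine iSup₂_le fun x hx v hv => ?_
    refine Submodule.mem_iSup_of_mem x (Submodule.mem_iSup_of_mem hx ?_)
    rw [Module.End.mem_eigenspace_iff] at hv ⊢
    simp only [vecMulLinear_apply] at hv ⊢
    rw [vecMul_vecMul, ← hAB, ← vecMul_vecMul, hv, smul_vecMul]
  have h2 : (Algebra.linearMap (ZMod p) (AlgebraicClosure (ZMod p))).compLeft
      (Fin d ⊕ Fin d) (n ᵥ* B) =
      (B.map f).vecMulLinear ((Algebra.linearMap (ZMod p) (AlgebraicClosure (ZMod p))).compLeft
      (Fin d ⊕ Fin d) n) := by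
    ext i
    simp [vecMul, dotProduct, f]
  change (Algebra.linearMap (ZMod p) (AlgebraicClosure (ZMod p))).compLeft
      (Fin d ⊕ Fin d) (n ᵥ* B) ∈ ⨆ x ∈ ϑ, Module.End.eigenspace (A.map f).vecMulLinear x
  rw [h2]
  exact key hn

/-- A choice of a symplectic basis in each `E_ϑ`, recorded as the coordinate isomorphism
`n ↦ (n_ϑ)_ϑ`: the vector `n_ϑ ∈ 𝔽_p^{2d_ϑ}` consists of the coordinates of the projection of `n`
to `E_ϑ`. -/
structure SympDecomposition (A : SpP p d) where
  coord : PhaseP p d ≃ₗ[ZMod p] ((ϑ : sympOrbits A) → PhaseP p (halfDim ϑ.1))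
  mem_iff : ∀ (ϑ : sympOrbits A) (n : PhaseP p d),
    n ∈ orbitSpace A.1 ϑ.1 ↔ ∀ ϑ' : sympOrbits A, ϑ' ≠ ϑ → coord n ϑ' = 0
  form_eq : ∀ m n : PhaseP p d, sympForm m n = ∑ ϑ, sympForm (coord m ϑ) (coord n ϑ)

namespace SympDecomposition

variable {A : SpP p d} (S : SympDecomposition A)

open Classical in
/-- The embedding of `𝔽_p^{2d_ϑ}` onto `E_ϑ` given by the symplectic basis. -/
def incl (ϑ : sympOrbits A) : PhaseP p (halfDim ϑ.1) →ₗ[ZMod p] PhaseP p d :=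
  S.coord.symm.toLinearMap ∘ₗ
    LinearMap.single (ZMod p) (fun ϑ : sympOrbits A => PhaseP p (halfDim ϑ.1)) ϑ

theorem coord_incl_self (ϑ : sympOrbits A) (v : PhaseP p (halfDim ϑ.1)) :
    S.coord (S.incl ϑ v) ϑ = v := by
  simp [incl]

theorem coord_incl_ne {ϑ ϑ' : sympOrbits A} (h : ϑ' ≠ ϑ) (v : PhaseP p (halfDim ϑ.1)) :
    S.coord (S.incl ϑ v) ϑ' = 0 := by
  simp [incl, h]

theorem incl_mem (ϑ : sympOrbits A) (v : PhaseP p (halfDim ϑ.1)) :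
    S.incl ϑ v ∈ orbitSpace A.1 ϑ.1 :=
  (S.mem_iff ϑ _).2 fun _ h => S.coord_incl_ne h v

theorem incl_coord {ϑ : sympOrbits A} {n : PhaseP p d} (hn : n ∈ orbitSpace A.1 ϑ.1) :
    S.incl ϑ (S.coord n ϑ) = n := by
  apply S.coord.injective
  funext ϑ'
  by_cases h : ϑ' = ϑ
  · subst h
    exact S.coord_incl_self _ _
  · rw [S.coord_incl_ne h, (S.mem_iff ϑ n).1 hn ϑ' h]

theorem sympForm_eq_of_mem {ϑ : sympOrbits A} {m : PhaseP p d} (hm : m ∈ orbitSpace A.1 ϑ.1)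
    (n : PhaseP p d) : sympForm m n = sympForm (S.coord m ϑ) (S.coord n ϑ) := by
  rw [S.form_eq, Finset.sum_eq_single ϑ]
  · intro ϑ' _ h
    rw [(S.mem_iff ϑ m).1 hm ϑ' h]
    simp [sympForm, dotProduct]
  · simp

/-- The matrix of the restriction of `B` to `E_ϑ` in the symplectic basis (for `B` that leaves
`E_ϑ` invariant). -/
def compMatrix (B : Matrix (Fin d ⊕ Fin d) (Fin d ⊕ Fin d) (ZMod p)) (ϑ : sympOrbits A) :
    Matrix (Fin (halfDim ϑ.1) ⊕ Fin (halfDim ϑ.1)) (Fin (halfDim ϑ.1) ⊕ Fin (halfDim ϑ.1))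
      (ZMod p) :=
  Matrix.of fun i j => S.coord (S.incl ϑ (Pi.single i 1) ᵥ* B) ϑ j

theorem vecMul_compMatrix (B : Matrix (Fin d ⊕ Fin d) (Fin d ⊕ Fin d) (ZMod p))
    (ϑ : sympOrbits A) (v : PhaseP p (halfDim ϑ.1)) :
    v ᵥ* S.compMatrix B ϑ = S.coord (S.incl ϑ v ᵥ* B) ϑ := by
  let L : PhaseP p (halfDim ϑ.1) →ₗ[ZMod p] PhaseP p (halfDim ϑ.1) :=
    LinearMap.proj ϑ ∘ₗ S.coord.toLinearMap ∘ₗ B.vecMulLinear ∘ₗ S.incl ϑ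
  have h : (S.compMatrix B ϑ).vecMulLinear = L := by
    refine LinearMap.pi_ext' fun i => LinearMap.ext_ring ?_
    ext j
    simp [L, compMatrix]
  exact LinearMap.congr_fun h v

/-- For `B` commuting with `A`, the coordinates satisfy `(n B)_ϑ = n_ϑ B_ϑ` on `E_ϑ`. -/
theorem incl_vecMul {B : Matrix (Fin d ⊕ Fin d) (Fin d ⊕ Fin d) (ZMod p)}
    (h : A.1 * B = B * A.1) (ϑ : sympOrbits A) (v : PhaseP p (halfDim ϑ.1)) :
    S.incl ϑ v ᵥ* B = S.incl ϑ (v ᵥ* S.compMatrix B ϑ) := by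
  rw [vecMul_compMatrix, S.incl_coord (vecMul_mem_orbitSpace h (S.incl_mem ϑ v))]

theorem compMatrix_mul {B C : Matrix (Fin d ⊕ Fin d) (Fin d ⊕ Fin d) (ZMod p)}
    (h : A.1 * B = B * A.1) (ϑ : sympOrbits A) :
    S.compMatrix (B * C) ϑ = S.compMatrix B ϑ * S.compMatrix C ϑ := by
  refine Matrix.ext_of_single_vecMul fun i => ?_
  rw [← vecMul_vecMul, vecMul_compMatrix, vecMul_compMatrix S C, ← S.incl_vecMul h,
    vecMul_vecMul]

theorem compMatrix_one (ϑ : sympOrbits A) : S.compMatrix 1 ϑ = 1 := by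
  refine Matrix.ext_of_single_vecMul fun i => ?_
  rw [vecMul_compMatrix, vecMul_one, vecMul_one, coord_incl_self]

theorem compMatrix_mem {B : SpP p d} (h : A.1 * B.1 = B.1 * A.1) (ϑ : sympOrbits A) :
    S.compMatrix B.1 ϑ ∈ symplecticGroup (Fin (halfDim ϑ.1)) (ZMod p) := by
  rw [mem_symplecticGroup_iff]
  intro m n
  rw [vecMul_compMatrix, vecMul_compMatrix,
    ← S.sympForm_eq_of_mem (vecMul_mem_orbitSpace h (S.incl_mem ϑ m)),
    (mem_symplecticGroup_iff B.1).1 B.2, S.sympForm_eq_of_mem (S.incl_mem ϑ m),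
    coord_incl_self, coord_incl_self]

/-- `A_ϑ ∈ Sp(2d_ϑ, 𝔽_p)`: the restriction of `A` to `E_ϑ` in the symplectic basis. -/
def comp (ϑ : sympOrbits A) : SpP p (halfDim ϑ.1) :=
  ⟨S.compMatrix A.1 ϑ, S.compMatrix_mem rfl ϑ⟩

theorem heckeGroup_comm (B : heckeGroup A) : A.1 * B.1.1 = B.1.1 * A.1 :=
  congrArg Subtype.val (Subgroup.mem_centralizer_singleton_iff.1 B.2).symm

/-- The homomorphism `C_p(A) → C_p(A_ϑ)`, `B ↦ B_ϑ`. -/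
def heckeComp (ϑ : sympOrbits A) : heckeGroup A →* heckeGroup (S.comp ϑ) where
  toFun B := ⟨⟨S.compMatrix B.1.1 ϑ, S.compMatrix_mem (heckeGroup_comm B) ϑ⟩, by
    rw [Subgroup.mem_centralizer_singleton_iff]
    apply Subtype.ext
    change S.compMatrix B.1.1 ϑ * S.compMatrix A.1 ϑ = S.compMatrix A.1 ϑ * S.compMatrix B.1.1 ϑ
    rw [← S.compMatrix_mul (heckeGroup_comm B), ← S.compMatrix_mul rfl, heckeGroup_comm B]⟩
  map_one' := Subtype.ext (Subtype.ext (S.compMatrix_one ϑ))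
  map_mul' B C := Subtype.ext (Subtype.ext (S.compMatrix_mul (heckeGroup_comm B) ϑ))

/-- The character `χ = ∏_ϑ χ_ϑ` of `C_p(A)`, that is `χ(B) = ∏_ϑ χ_ϑ(B_ϑ)`. -/
def prodChar (χ : (ϑ : sympOrbits A) → heckeGroup (S.comp ϑ) →* ℂˣ) : heckeGroup A →* ℂˣ :=
  ∏ ϑ, (χ ϑ).comp (S.heckeComp ϑ)

open scoped TensorProduct in
/-- A unitary map `𝒰 : L²(𝔽_p^d) → ⨂_ϑ L²(𝔽_p^{d_ϑ})` with `𝒰 T_p(n) 𝒰⁻¹ = ⨂_ϑ T_p(n_ϑ)` for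
all `n`. Unitarity is expressed on pure tensors, which span, through
`⟨⨂ φ_ϑ, ⨂ φ'_ϑ⟩ = ∏ ⟨φ_ϑ, φ'_ϑ⟩`. -/
structure IsTensorIntertwiner
    (𝒰 : HilbertP p d ≃ₗ[ℂ] (⨂[ℂ] ϑ : sympOrbits A, HilbertP p (halfDim ϑ.1))) : Prop where
  unitary : ∀ φ φ' : (ϑ : sympOrbits A) → HilbertP p (halfDim ϑ.1),
    inner ℂ (𝒰.symm (PiTensorProduct.tprod ℂ φ)) (𝒰.symm (PiTensorProduct.tprod ℂ φ')) =
      ∏ ϑ, inner ℂ (φ ϑ) (φ' ϑ)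
  intertwines : ∀ (n : PhaseP p d) (ψ : HilbertP p d),
    𝒰 (elemOp n ψ) = PiTensorProduct.map (fun ϑ => elemOp (S.coord n ϑ)) (𝒰 ψ)

end SympDecomposition

end Orbits

end

noncomputable section

set_option linter.unusedSectionVars false

/-! ### Weyl operators: commutation relation, traces, completeness -/

section

variable {p : ℕ} [Fact p.Prime] {d : ℕ}

/-! Weyl operators. The sum of `T(n) X T(-n)` over phase space is `p^d · tr X` times the identity
(`elemMat_twirl`). Hence only scalars commute with all `T(n)`, and an intertwiner for a given
symplectic matrix is unique up to a scalar. An averaging construction gives a nonzero one, which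
rescales to a unitary. It commutes with parity, and the even functions have exactly one dimension
more than the odd ones; so the condition that the determinants on both parts agree selects a single
scalar. The condition is multiplicative, hence the selected operators form a representation
(`exists_isQuantization`).

One orbit. The matrices commuting with `A` are polynomials `h(A)`, and `h(A)` is symplectic iff
`h(x) h(x⁻¹) = 1` at every eigenvalue `x`. With a single symplectic orbit, `h(A)` is determined by
its value at one eigenvalue. The Hecke group therefore acts freely on nonzero vectors, has `-1` as
its only involution, and has order `p^d - ε`, with `ε = 1` for a nonsymmetric and `ε = -1` for a
symmetric orbit. Freeness and the twirl give `tr U(B) · tr U(B⁻¹) = 1` for `B ≠ 1`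
(`IsQuantization.trace_mul_trace`). By Parseval the multiplicities satisfy `∑ (m_χ - 1)² = 1`, so
exactly one character is exceptional, with multiplicity `1 + ε`.

The determinant identifies it. Transvections generate the symplectic group and have exponent `p`, so
every linear character of it has exponent dividing `p`; the Hecke group has order prime to `p`;
hence `det U(B) = 1` there (`EigenFrame.det_quantLin`). This says `∏ χ^{m_χ} = 1`. As the product of
all characters is the unique quadratic one, the exceptional character is quadratic
(`exists_quadratic_char_finrank`).

General case. Polynomials in `A` that are indicators of orbits give ω-self-adjoint projections,
hence an orthogonal splitting into symplectic subspaces, whose sizes follow from a dimension count.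
The operators `U(B)` and `⨂ U(B_ϑ)` implement the same conjugation and differ by a character of a
product of symplectic groups; exponent `p` makes it trivial on the Hecke group
(`IsTensorIntertwiner.quantLin_hecke`). The joint eigenspaces are then tensor products of those of
the single orbits (`IsTensorIntertwiner.heckeEigenspace_eq`). -/

theorem two_ne_zero_zmod (hp : p ≠ 2) : (2 : ZMod p) ≠ 0 := by
  intro h
  have h2 : ((2 : ℕ) : ZMod p) = 0 := by exact_mod_cast h
  rw [ZMod.natCast_eq_zero_iff] at h2
  exact hp ((Nat.prime_dvd_prime_iff_eq Fact.out Nat.prime_two).1 h2)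

theorem two_inv_add_two_inv (hp : p ≠ 2) : (2⁻¹ : ZMod p) + 2⁻¹ = 1 := by
  rw [← two_mul, mul_inv_cancel₀ (two_ne_zero_zmod hp)]

theorem sympForm_add_left (a b c : PhaseP p d) :
    sympForm (a + b) c = sympForm a c + sympForm b c := by
  simp only [sympForm_eq, add_dotProduct]; ring

theorem sympForm_add_right (a b c : PhaseP p d) :
    sympForm a (b + c) = sympForm a b + sympForm a c := by
  simp only [sympForm_eq, mulVec_add, dotProduct_add]; ring

theorem sympForm_smul_left (r : ZMod p) (a b : PhaseP p d) :
    sympForm (r • a) b = r * sympForm a b := by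
  simp only [sympForm_eq, smul_dotProduct, smul_eq_mul]; ring

theorem sympForm_smul_right (r : ZMod p) (a b : PhaseP p d) :
    sympForm a (r • b) = r * sympForm a b := by
  simp only [sympForm_eq, mulVec_smul, dotProduct_smul, smul_eq_mul]; ring

theorem sympForm_swap (a b : PhaseP p d) : sympForm a b = -sympForm b a := by
  simp only [sympForm]
  rw [dotProduct_comm (a ∘ Sum.inl), dotProduct_comm (a ∘ Sum.inr)]; ring

theorem sympForm_self (a : PhaseP p d) : sympForm a a = 0 := by
  simp only [sympForm]
  rw [dotProduct_comm (a ∘ Sum.inl)]; ring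

theorem sympForm_neg_left (a b : PhaseP p d) : sympForm (-a) b = -sympForm a b := by
  rw [← neg_one_smul (ZMod p) a, sympForm_smul_left]; ring

theorem sympForm_neg_right (a b : PhaseP p d) : sympForm a (-b) = -sympForm a b := by
  rw [← neg_one_smul (ZMod p) b, sympForm_smul_right]; ring

theorem sympForm_sub_left (a b c : PhaseP p d) :
    sympForm (a - b) c = sympForm a c - sympForm b c := by
  rw [sub_eq_add_neg, sympForm_add_left, sympForm_neg_left]; ring

theorem sympForm_sub_right (a b c : PhaseP p d) :
    sympForm a (b - c) = sympForm a b - sympForm a c := by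
  rw [sub_eq_add_neg, sympForm_add_right, sympForm_neg_right]; ring

theorem sympForm_vecMul_vecMul (B : SpP p d) (m n : PhaseP p d) :
    sympForm (m ᵥ* B.1) (n ᵥ* B.1) = sympForm m n :=
  (mem_symplecticGroup_iff B.1).1 B.2 m n

theorem sum_stdAddChar_dotProduct (u : Fin d → ZMod p) :
    ∑ y : Fin d → ZMod p, ZMod.stdAddChar (N := p) (y ⬝ᵥ u) = if u = 0 then (p : ℂ) ^ d else 0 := by
  classical
  let ψ : AddChar (Fin d → ZMod p) ℂ :=
    (ZMod.stdAddChar (N := p)).compAddMonoidHom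
      { toFun := fun y => y ⬝ᵥ u, map_zero' := zero_dotProduct u,
        map_add' := fun a b => add_dotProduct a b u }
  have h := AddChar.sum_eq_ite ψ
  have hψ : ψ = 0 ↔ u = 0 := by
    constructor
    · intro h0
      funext i
      have h1 : ψ (Pi.single i 1) = 1 := by rw [h0]; rfl
      have h2 : ZMod.stdAddChar (N := p) (u i) = 1 := by
        simpa [ψ, single_one_dotProduct] using h1
      rw [← AddChar.map_zero_eq_one (ZMod.stdAddChar (N := p))] at h2
      exact ZMod.injective_stdAddChar h2
    · intro h0
      ext y
      simp [ψ, h0]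
  simp only [hψ] at h
  refine Eq.trans ?_ (h.trans ?_)
  · rfl
  · simp [ZMod.card]

/-- The matrix of `T_p(n)`. -/
def elemMat (n : PhaseP p d) : Matrix (Fin d → ZMod p) (Fin d → ZMod p) ℂ :=
  Matrix.of fun y z => if z = y + n ∘ Sum.inl then
    ZMod.stdAddChar (N := p) (2⁻¹ * ((n ∘ Sum.inl) ⬝ᵥ (n ∘ Sum.inr)) + (n ∘ Sum.inr) ⬝ᵥ y) else 0

theorem elemMat_apply (n : PhaseP p d) (y z : Fin d → ZMod p) :
    elemMat n y z = if z = y + n ∘ Sum.inl then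
      ZMod.stdAddChar (N := p) (2⁻¹ * ((n ∘ Sum.inl) ⬝ᵥ (n ∘ Sum.inr)) + (n ∘ Sum.inr) ⬝ᵥ y)
      else 0 := rfl

theorem elemOp_eq_toEuclideanLin (n : PhaseP p d) : elemOp n = (elemMat n).toEuclideanLin := by
  ext ψ y
  simp [elemOp, elemMat, Matrix.toLpLin_apply, mulVec, dotProduct, AddChar.map_add_eq_mul]

/-- The Weyl relation. Both sides perform the same shift; `2⁻¹ + 2⁻¹ = 1` turns the leftover cross
term of the phases into half the symplectic form. -/
theorem elemMat_mul (hp : p ≠ 2) (m n : PhaseP p d) :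
    elemMat m * elemMat n =
      ZMod.stdAddChar (N := p) (2⁻¹ * sympForm m n) • elemMat (m + n) := by
  ext y z
  rw [Matrix.mul_apply, Finset.sum_eq_single (y + m ∘ Sum.inl)]
  · simp only [elemMat_apply, if_true, Matrix.smul_apply, smul_eq_mul, add_assoc, 
      show (m + n) ∘ Sum.inl = m ∘ Sum.inl + n ∘ Sum.inl from rfl,
      show (m + n) ∘ Sum.inr = m ∘ Sum.inr + n ∘ Sum.inr from rfl]
    split_ifs
    · rw [← AddChar.map_add_eq_mul, ← AddChar.map_add_eq_mul]
      congr 1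
      simp only [sympForm, dotProduct_add, add_dotProduct]
      rw [dotProduct_comm (n ∘ Sum.inr) (m ∘ Sum.inl), dotProduct_comm (m ∘ Sum.inr) (n ∘ Sum.inl)]
      linear_combination (-((m ∘ Sum.inl) ⬝ᵥ (n ∘ Sum.inr))) * two_inv_add_two_inv hp
    · simp
  · intro b _ hb
    rw [elemMat_apply, if_neg hb, zero_mul]
  · simp

theorem elemMat_zero : elemMat (0 : PhaseP p d) = 1 := by
  ext y z
  have h0 : (0 : PhaseP p d) ∘ Sum.inl = 0 := rfl
  have h1 : (0 : PhaseP p d) ∘ Sum.inr = 0 := rfl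
  simp [elemMat_apply, Matrix.one_apply, eq_comm, h0, h1]

theorem elemMat_mul_neg (hp : p ≠ 2) (n : PhaseP p d) : elemMat n * elemMat (-n) = 1 := by
  rw [elemMat_mul hp, sympForm_neg_right, sympForm_self, add_neg_cancel, elemMat_zero]
  simp

theorem elemMat_neg_apply (n : PhaseP p d) (hp : p ≠ 2) (y z : Fin d → ZMod p) :
    elemMat (-n) y z = if y = z + n ∘ Sum.inl then
      ZMod.stdAddChar (N := p) (-(2⁻¹ * ((n ∘ Sum.inl) ⬝ᵥ (n ∘ Sum.inr)) + (n ∘ Sum.inr) ⬝ᵥ z))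
      else 0 := by
  have e1 : (-n) ∘ Sum.inl = -(n ∘ Sum.inl) := rfl
  have e2 : (-n) ∘ Sum.inr = -(n ∘ Sum.inr) := rfl
  rw [elemMat_apply, e1, e2]
  by_cases h : y = z + n ∘ Sum.inl
  · rw [if_pos h, if_pos (by rw [h]; abel)]
    congr 1
    rw [h]
    simp only [neg_dotProduct, dotProduct_neg, dotProduct_add]
    rw [dotProduct_comm (n ∘ Sum.inr) (n ∘ Sum.inl)]
    linear_combination ((n ∘ Sum.inl) ⬝ᵥ (n ∘ Sum.inr)) * two_inv_add_two_inv hp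
  · rw [if_neg h, if_neg (fun h' => h (by rw [h']; abel))]

theorem elemMat_conjTranspose (hp : p ≠ 2) (n : PhaseP p d) :
    (elemMat n)ᴴ = elemMat (-n) := by
  ext y z
  rw [Matrix.conjTranspose_apply, elemMat_neg_apply n hp, elemMat_apply]
  split_ifs
  · rw [AddChar.map_neg_eq_conj]; rfl
  · simp

theorem phase_ext_iff {m n : PhaseP p d} :
    m = n ↔ m ∘ Sum.inl = n ∘ Sum.inl ∧ m ∘ Sum.inr = n ∘ Sum.inr := by
  constructor
  · rintro rfl; exact ⟨rfl, rfl⟩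
  · rintro ⟨h1, h2⟩
    funext i
    rcases i with i | i
    · exact congrFun h1 i
    · exact congrFun h2 i

/-- A nonzero shift has empty diagonal. Without a shift the diagonal is an additive character, which
sums to zero unless it is trivial. -/
theorem elemMat_trace (n : PhaseP p d) :
    (elemMat n).trace = if n = 0 then (p : ℂ) ^ d else 0 := by
  rw [Matrix.trace]
  have e1 : (0 : PhaseP p d) ∘ Sum.inl = 0 := rfl
  have e2 : (0 : PhaseP p d) ∘ Sum.inr = 0 := rfl
  simp only [Matrix.diag_apply, elemMat_apply, left_eq_add]
  by_cases h : n ∘ Sum.inl = 0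
  · simp only [h, if_true, zero_dotProduct, mul_zero, zero_add]
    simp_rw [dotProduct_comm (n ∘ Sum.inr)]
    rw [sum_stdAddChar_dotProduct]
    simp only [phase_ext_iff (m := n), h, e1, e2, true_and]
  · rw [if_neg (fun h' => h (by rw [h', e1]))]
    simp [h]

theorem sum_phase {M : Type*} [AddCommMonoid M] (f : PhaseP p d → M) :
    ∑ n, f n = ∑ a : Fin d → ZMod p, ∑ b : Fin d → ZMod p, f (Sum.elim a b) := by
  rw [← (Equiv.sumArrowEquivProdArrow (Fin d) (Fin d) (ZMod p)).symm.sum_comp,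
    Fintype.sum_prod_type]
  rfl

/-- Completeness of the elementary operators. -/
theorem elemMat_sum_mul (hp : p ≠ 2) (a b c e : Fin d → ZMod p) :
    ∑ n : PhaseP p d, elemMat n a b * elemMat (-n) c e =
      if b = c ∧ a = e then (p : ℂ) ^ d else 0 := by
  have e1 : ∀ u v y z : Fin d → ZMod p, elemMat (Sum.elim u v) y z = if z = y + u then
      ZMod.stdAddChar (N := p) (2⁻¹ * (u ⬝ᵥ v) + v ⬝ᵥ y) else 0 := fun u v => elemMat_apply _
  have e2 : ∀ u v y z : Fin d → ZMod p, elemMat (-Sum.elim u v) y z = if y = z + u then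
      ZMod.stdAddChar (N := p) (-(2⁻¹ * (u ⬝ᵥ v) + v ⬝ᵥ z)) else 0 :=
    fun u v => elemMat_neg_apply _ hp
  simp only [sum_phase, e1, e2]
  -- Only the shift that carries `a` to `b` contributes; the sum over the other half of phase space
  -- is orthogonality of characters.
  rw [Finset.sum_eq_single (b - a)]
  · have h1 : b = a + (b - a) := by abel
    simp only [← h1, if_true]
    have : ∀ x : Fin d → ZMod p, (2⁻¹ * (b - a) ⬝ᵥ x + x ⬝ᵥ a + -(2⁻¹ * (b - a) ⬝ᵥ x + x ⬝ᵥ e))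
        = x ⬝ᵥ (a - e) := by
      intro x; rw [dotProduct_sub]; ring
    by_cases h : c = e + (b - a)
    · rw [Finset.sum_congr rfl fun x _ => by
        rw [if_pos h, ← AddChar.map_add_eq_mul, this], sum_stdAddChar_dotProduct]
      simp only [sub_eq_zero]
      by_cases h' : a = e
      · rw [if_pos h', if_pos ⟨by rw [h, h']; abel, h'⟩]
      · rw [if_neg h', if_neg fun h2 => h' h2.2]
    · rw [Finset.sum_congr rfl fun x _ => by rw [if_neg h, mul_zero], Finset.sum_const_zero,
        if_neg]
      rintro ⟨rfl, rfl⟩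
      exact h (by abel)
  · intro x _ hx
    have : b ≠ a + x := fun h => hx (by rw [h]; abel)
    simp [this]
  · simp

/-- Completeness expanded in the entries of `X`. It serves twice: for `X` commuting with all Weyl
operators it is Schur's lemma, and its operator form, taken at a quantized matrix, computes traces.
-/
theorem elemMat_twirl (hp : p ≠ 2) (X : Matrix (Fin d → ZMod p) (Fin d → ZMod p) ℂ) :
    ∑ n : PhaseP p d, elemMat n * X * elemMat (-n) =
      ((p : ℂ) ^ d * X.trace) • (1 : Matrix _ _ ℂ) := by
  ext a e
  rw [Matrix.sum_apply]
  simp only [Matrix.mul_apply, Finset.sum_mul]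
  rw [Finset.sum_comm]
  have : ∀ c : Fin d → ZMod p, ∑ n : PhaseP p d, ∑ b, elemMat n a b * X b c * elemMat (-n) c e =
      if a = e then (p : ℂ) ^ d * X c c else 0 := by
    intro c
    rw [Finset.sum_comm]
    have : ∀ b, ∑ n : PhaseP p d, elemMat n a b * X b c * elemMat (-n) c e =
        X b c * if b = c ∧ a = e then (p : ℂ) ^ d else 0 := by
      intro b
      rw [← elemMat_sum_mul hp, Finset.mul_sum]
      exact Finset.sum_congr rfl fun _ _ => by ring
    simp only [this]
    by_cases h : a = e
    · simp [h, mul_comm]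
    · simp [h]
  simp only [this]
  by_cases h : a = e
  · simp [h, Matrix.trace, Finset.mul_sum]
  · simp [h]

theorem card_ne_zero_complex : ((p : ℂ) ^ d) ≠ 0 :=
  pow_ne_zero _ (Nat.cast_ne_zero.2 (Fact.out : p.Prime).ne_zero)

/-- The elementary operators act irreducibly. -/
theorem eq_smul_one_of_commute_elemMat (hp : p ≠ 2)
    {X : Matrix (Fin d → ZMod p) (Fin d → ZMod p) ℂ}
    (h : ∀ n : PhaseP p d, elemMat n * X = X * elemMat n) : ∃ c : ℂ, X = c • 1 := by
  have h1 := elemMat_twirl hp X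
  simp only [h, Matrix.mul_assoc, elemMat_mul_neg hp, Matrix.mul_one, Finset.sum_const,
    Finset.card_univ] at h1
  have h2 : (Fintype.card (PhaseP p d) : ℂ) ≠ 0 := Nat.cast_ne_zero.2 Fintype.card_ne_zero
  refine ⟨(Fintype.card (PhaseP p d) : ℂ)⁻¹ * ((p : ℂ) ^ d * X.trace), ?_⟩
  rw [mul_smul, ← h1, ← Nat.cast_smul_eq_nsmul ℂ, inv_smul_smul₀ h2]

end

/-! ### Intertwiners of the Weyl operators and existence of a quantization -/

section

variable {p : ℕ} [Fact p.Prime] {d : ℕ}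

/-- Trace and determinants attached to an idempotent. -/
theorem exists_det_smul_idempotent {V : Type*} [AddCommGroup V] [Module ℂ V]
    [FiniteDimensional ℂ V] {e : Module.End ℂ V} (he : IsIdempotentElem e) :
    ∃ k : ℕ, LinearMap.trace ℂ V e = k ∧ ∀ c : ℂ, LinearMap.det (c • e + (1 - e)) = c ^ k := by
  have h := (LinearMap.isProj_range_iff_isIdempotentElem e).2 he
  refine ⟨_, h.trace, fun c => ?_⟩
  set E := (LinearMap.range e).prodEquivOfIsCompl (LinearMap.ker e) h.isCompl
  have h1 : c • e + (1 - e) = E.conj (LinearMap.prodMap (c • LinearMap.id) LinearMap.id) := by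
    have h2 : (LinearMap.prodMap (c • LinearMap.id) LinearMap.id :
        Module.End ℂ (LinearMap.range e × LinearMap.ker e)) =
        c • LinearMap.prodMap LinearMap.id 0 +
          (LinearMap.id - LinearMap.prodMap LinearMap.id 0) := by
      ext <;> simp
    rw [h2, map_add, map_sub, map_smul, ← h.eq_conj_prodMap, LinearEquiv.conj_id]
    rfl
  rw [h1, LinearEquiv.conj_apply, LinearMap.comp_assoc, LinearMap.det_conj,
    LinearMap.det_prodMap]
  simp

theorem exists_det_smul_idempotent_matrix {ι : Type*} [Fintype ι] [DecidableEq ι]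
    {e : Matrix ι ι ℂ} (he : IsIdempotentElem e) :
    ∃ k : ℕ, e.trace = k ∧ ∀ c : ℂ, (c • e + (1 - e)).det = c ^ k := by
  have h : IsIdempotentElem (toLin' e) := by
    rw [IsIdempotentElem, Module.End.mul_eq_comp, ← toLin'_mul, he]
  obtain ⟨k, h1, h2⟩ := exists_det_smul_idempotent h
  refine ⟨k, by rw [← h1, trace_toLin'_eq], fun c => ?_⟩
  rw [← h2 c, ← LinearMap.det_toLin']
  congr 1
  simp only [map_add, map_sub, map_smul, toLin'_one]
  rfl

/-- `U⁻¹ T_p(m) U = T_p(m g)`, written without inverse. -/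
def Intertwines (g : SpP p d) (U : Matrix (Fin d → ZMod p) (Fin d → ZMod p) ℂ) : Prop :=
  ∀ m : PhaseP p d, elemMat m * U = U * elemMat (m ᵥ* g.1)

theorem Intertwines.mul {g h : SpP p d} {U V : Matrix (Fin d → ZMod p) (Fin d → ZMod p) ℂ}
    (hU : Intertwines g U) (hV : Intertwines h V) : Intertwines (g * h) (U * V) := by
  intro m
  rw [← Matrix.mul_assoc, hU m, Matrix.mul_assoc, hV, Matrix.mul_assoc, vecMul_vecMul]
  rfl

theorem Intertwines.smul {g : SpP p d} {U : Matrix (Fin d → ZMod p) (Fin d → ZMod p) ℂ}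
    (hU : Intertwines g U) (c : ℂ) : Intertwines g (c • U) := by
  intro m
  rw [Matrix.mul_smul, hU m, Matrix.smul_mul]

/-- Intertwiners are unique up to scalars. -/
theorem Intertwines.eq_smul (hp : p ≠ 2) {g : SpP p d}
    {U V : Matrix (Fin d → ZMod p) (Fin d → ZMod p) ℂ}
    (hU : Intertwines g U) (hV : Intertwines g V) (hu : U ∈ unitaryGroup (Fin d → ZMod p) ℂ) :
    ∃ c : ℂ, V = c • U := by
  have h1 : U * star U = 1 := mem_unitaryGroup_iff.1 hu
  obtain ⟨c, hc⟩ := eq_smul_one_of_commute_elemMat (p := p) (d := d) hp (X := V * star U)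
    (fun n => by
      have h2 : elemMat (n ᵥ* g.1) * star U = star U * elemMat n := by
        have h3 : star U * U = 1 := mem_unitaryGroup_iff'.1 hu
        calc _ = star U * (U * elemMat (n ᵥ* g.1)) * star U := by
              rw [← Matrix.mul_assoc, h3, Matrix.one_mul]
          _ = _ := by rw [← hU n, Matrix.mul_assoc, Matrix.mul_assoc, h1, Matrix.mul_one]
      rw [← Matrix.mul_assoc, hV n, Matrix.mul_assoc, h2, Matrix.mul_assoc])
  refine ⟨c, ?_⟩
  calc V = V * star U * U := by
        rw [Matrix.mul_assoc, mem_unitaryGroup_iff'.1 hu, Matrix.mul_one]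
    _ = _ := by rw [hc, Matrix.smul_mul, Matrix.one_mul]

/-- Averaging any matrix `K` over `n ↦ T(n) K T(-n g)` gives an intertwiner. If all averages
vanished, suitable entries for the matrix units `K` would add up to `∑ tr T(n) · T(-n g) = 0`,
whereas only `n = 0` has nonzero trace, leaving `p^d` times the identity. -/
theorem exists_intertwines_ne_zero (hp : p ≠ 2) (g : SpP p d) :
    ∃ U : Matrix (Fin d → ZMod p) (Fin d → ZMod p) ℂ, U ≠ 0 ∧ Intertwines g U := by
  classical
  let Φ : Matrix (Fin d → ZMod p) (Fin d → ZMod p) ℂ → Matrix (Fin d → ZMod p) (Fin d → ZMod p) ℂ :=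
    fun K => ∑ n : PhaseP p d, elemMat n * K * elemMat (-n ᵥ* g.1)
  have hΦ : ∀ K, Intertwines g (Φ K) := by
    intro K m
    simp only [Φ, Finset.mul_sum, Finset.sum_mul]
    rw [← Equiv.sum_comp (Equiv.addLeft m) (fun n => elemMat n * K * elemMat (-n ᵥ* g.1) *
      elemMat (m ᵥ* g.1))]
    refine Finset.sum_congr rfl fun n _ => ?_
    rw [Equiv.coe_addLeft, ← Matrix.mul_assoc, ← Matrix.mul_assoc, elemMat_mul hp,
      Matrix.mul_assoc _ _ (elemMat (m ᵥ* g.1)), elemMat_mul hp, sympForm_vecMul_vecMul,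
      sympForm_neg_left, sympForm_add_left, sympForm_self, zero_add, ← add_vecMul,
      Matrix.smul_mul, Matrix.smul_mul, Matrix.mul_smul]
    rw [sympForm_swap n m, neg_neg, neg_add_rev, add_assoc, neg_add_cancel, add_zero]
  by_contra hno
  push Not at hno
  have h0 : ∀ K, Φ K = 0 := fun K => by
    by_contra h
    exact hno _ h (hΦ K)
  have h1 : ∑ n : PhaseP p d, (elemMat n).trace • elemMat (-n ᵥ* g.1) = 0 := by
    ext c e
    rw [Matrix.sum_apply]
    simp only [Matrix.smul_apply, Matrix.trace, diag_apply, smul_eq_mul, Finset.sum_mul]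
    rw [Finset.sum_comm]
    refine Finset.sum_eq_zero fun b _ => ?_
    have h2 := congrFun (congrFun (h0 (Matrix.single b c 1)) b) e
    simp only [Φ, Matrix.sum_apply, Matrix.zero_apply] at h2
    refine Eq.trans (Finset.sum_congr rfl fun n _ => ?_) h2
    rw [Matrix.mul_assoc, Matrix.mul_apply, Finset.sum_eq_single b]
    · simp
    · intro x _ hx
      rw [Matrix.single_mul_apply_of_ne _ _ _ _ _ hx, mul_zero]
    · simp
  simp only [elemMat_trace, ite_smul, zero_smul, Finset.sum_ite_eq', Finset.mem_univ, if_true,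
    neg_zero, zero_vecMul, elemMat_zero] at h1
  have h2 := congrFun (congrFun h1 0) 0
  simp only [Matrix.smul_apply, one_apply_eq, smul_eq_mul, mul_one, Matrix.zero_apply] at h2
  exact card_ne_zero_complex h2

theorem Intertwines.star_comm (hp : p ≠ 2) {g : SpP p d}
    {U : Matrix (Fin d → ZMod p) (Fin d → ZMod p) ℂ} (hU : Intertwines g U) (m : PhaseP p d) :
    star U * elemMat m = elemMat (m ᵥ* g.1) * star U := by
  have h := congrArg star (hU (-m))
  rw [star_mul, star_mul, star_eq_conjTranspose, star_eq_conjTranspose, star_eq_conjTranspose,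
    elemMat_conjTranspose hp, elemMat_conjTranspose hp, neg_neg, neg_vecMul, neg_neg] at h
  exact h

/-- The product `U U*` commutes with the Weyl operators, so it is a scalar; this scalar is the
squared norm of any row of `U`, hence positive, and its square root is divided out. -/
theorem exists_unitary_intertwines (hp : p ≠ 2) (g : SpP p d) :
    ∃ U ∈ unitaryGroup (Fin d → ZMod p) ℂ, Intertwines g U := by
  obtain ⟨U, hU0, hU⟩ := exists_intertwines_ne_zero hp g
  obtain ⟨c, hc⟩ := eq_smul_one_of_commute_elemMat (p := p) (d := d) hp (X := U * star U)
    (fun n => by rw [← Matrix.mul_assoc, hU, Matrix.mul_assoc, ← hU.star_comm hp,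
      Matrix.mul_assoc])
  have hdiag : ∀ y, c = ((∑ z, ‖U y z‖ ^ 2 : ℝ) : ℂ) := by
    intro y
    have := congrFun (congrFun hc y) y
    simp only [Matrix.smul_apply, one_apply_eq, smul_eq_mul, mul_one] at this
    rw [← this, Matrix.mul_apply]
    push_cast
    refine Finset.sum_congr rfl fun z _ => ?_
    rw [star_apply, ← Complex.mul_conj']
    rfl
  obtain ⟨r, hr0, hr⟩ : ∃ r : ℝ, 0 ≤ r ∧ c = r := ⟨_, by positivity, hdiag 0⟩
  have hr1 : r ≠ 0 := by
    rintro rfl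
    apply hU0
    ext y z
    have h1 := hdiag y
    rw [hr, Complex.ofReal_inj, eq_comm, Finset.sum_eq_zero_iff_of_nonneg (fun _ _ => by positivity)]
      at h1
    simpa using h1 z (Finset.mem_univ z)
  refine ⟨((Real.sqrt r : ℝ) : ℂ)⁻¹ • U, ?_, hU.smul _⟩
  rw [mem_unitaryGroup_iff, star_smul, Matrix.smul_mul, Matrix.mul_smul, hc, hr, smul_smul,
    smul_smul]
  have h2 : ((Real.sqrt r : ℝ) : ℂ) * (Real.sqrt r : ℝ) = r := by
    rw [← Complex.ofReal_mul, Real.mul_self_sqrt hr0]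
  have h3 : ((Real.sqrt r : ℝ) : ℂ) ≠ 0 := by
    rw [Complex.ofReal_ne_zero]
    intro h; rw [h] at h2
    apply hr1
    simpa [eq_comm] using h2
  have h4 : star ((Real.sqrt r : ℝ) : ℂ)⁻¹ = ((Real.sqrt r : ℝ) : ℂ)⁻¹ := by
    rw [← Complex.ofReal_inv]
    exact Complex.conj_ofReal _
  rw [h4, ← h2]
  field_simp
  simp

/-! ### Normalisation by parity -/

/-- The parity operator `ψ(y) ↦ ψ(-y)`. -/
def parityMat (p d : ℕ) : Matrix (Fin d → ZMod p) (Fin d → ZMod p) ℂ :=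
  Matrix.of fun y z => if z = -y then 1 else 0

theorem parityMat_mul_apply (X : Matrix (Fin d → ZMod p) (Fin d → ZMod p) ℂ) (y z) :
    (parityMat p d * X) y z = X (-y) z := by
  simp [Matrix.mul_apply, parityMat]

theorem mul_parityMat_apply (X : Matrix (Fin d → ZMod p) (Fin d → ZMod p) ℂ) (y z) :
    (X * parityMat p d) y z = X y (-z) := by
  simp only [Matrix.mul_apply, parityMat, of_apply, ← neg_eq_iff_eq_neg (a := z)]
  simp

theorem parityMat_mul_self : parityMat p d * parityMat p d = 1 := by
  ext y z
  rw [parityMat_mul_apply]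
  simp [parityMat, Matrix.one_apply, eq_comm]

theorem parityMat_star : star (parityMat p d) = parityMat p d := by
  ext y z
  rw [star_apply]
  simp [parityMat, eq_neg_iff_add_eq_zero, add_comm, apply_ite]

/-- The origin is the only fixed point of negation because `p` is odd. Trace one is what separates
the dimensions of even and odd functions by one. -/
theorem parityMat_trace (hp : p ≠ 2) : (parityMat p d).trace = 1 := by
  rw [Matrix.trace, Finset.sum_eq_single 0]
  · simp [parityMat]
  · intro y _ hy
    rw [diag_apply, parityMat, of_apply, if_neg]
    intro h
    apply hy
    funext i
    have h1 : y i = -y i := congrFun h i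
    have h2 : (2 : ZMod p) * y i = 0 := by linear_combination h1
    exact (mul_eq_zero.1 h2).resolve_left (two_ne_zero_zmod hp)
  · simp

theorem parityMat_elemMat (n : PhaseP p d) :
    parityMat p d * elemMat n = elemMat (-n) * parityMat p d := by
  ext y z
  rw [parityMat_mul_apply, mul_parityMat_apply, elemMat_apply, elemMat_apply]
  have e1 : (-n) ∘ Sum.inl = -(n ∘ Sum.inl) := rfl
  have e2 : (-n) ∘ Sum.inr = -(n ∘ Sum.inr) := rfl
  have e3 : (-z = y + -(n ∘ Sum.inl)) ↔ z = -y + n ∘ Sum.inl := by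
    rw [neg_eq_iff_eq_neg, neg_add, neg_neg]
  simp only [e1, e2, e3, neg_dotProduct, dotProduct_neg, neg_neg]

/-- Negation of phase space commutes with `g`, so conjugating by parity gives another intertwiner,
equal to `c • U`. Comparing traces of parity and of its conjugate by `U` forces `c = 1`, since that
trace is not zero. -/
theorem Intertwines.parity_comm (hp : p ≠ 2) {g : SpP p d}
    {U : Matrix (Fin d → ZMod p) (Fin d → ZMod p) ℂ} (hU : Intertwines g U)
    (hu : U ∈ unitaryGroup (Fin d → ZMod p) ℂ) : Commute U (parityMat p d) := by
  have h1 : Intertwines g (parityMat p d * U * parityMat p d) := by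
    intro m
    have h2 := parityMat_elemMat (-m)
    rw [neg_neg] at h2
    rw [← Matrix.mul_assoc, ← Matrix.mul_assoc, ← h2, Matrix.mul_assoc (parityMat p d) _ U, hU,
      neg_vecMul, Matrix.mul_assoc, Matrix.mul_assoc, ← neg_neg (m ᵥ* g.1),
      ← parityMat_elemMat, neg_neg]
    simp only [Matrix.mul_assoc]
  obtain ⟨c, hc⟩ := hU.eq_smul hp h1 hu
  have h2 : parityMat p d * U = c • (U * parityMat p d) := by
    rw [← Matrix.smul_mul, ← hc, Matrix.mul_assoc _ (parityMat p d), parityMat_mul_self,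
      Matrix.mul_one]
  have h3 : parityMat p d = c • (U * parityMat p d * star U) := by
    rw [← Matrix.smul_mul, ← h2, Matrix.mul_assoc, mem_unitaryGroup_iff.1 hu, Matrix.mul_one]
  have h4 := congrArg Matrix.trace h3
  rw [Matrix.trace_smul, Matrix.trace_mul_comm, ← Matrix.mul_assoc, mem_unitaryGroup_iff'.1 hu,
    Matrix.one_mul, parityMat_trace hp, smul_eq_mul, mul_one] at h4
  rw [← h4, one_smul] at h2
  exact h2.symm

/-- The projection onto even functions. -/
def evenProj (p d : ℕ) [Fact p.Prime] : Matrix (Fin d → ZMod p) (Fin d → ZMod p) ℂ :=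
  (2⁻¹ : ℂ) • (1 + parityMat p d)

theorem evenProj_idem : IsIdempotentElem (evenProj p d) := by
  have h : (1 + parityMat p d) * (1 + parityMat p d) = (2 : ℂ) • (1 + parityMat p d) := by
    rw [add_mul, mul_add, mul_add, parityMat_mul_self, two_smul]
    simp only [one_mul, mul_one]
    abel
  rw [IsIdempotentElem, evenProj, Matrix.smul_mul, Matrix.mul_smul, h, smul_smul, smul_smul]
  norm_num

theorem evenProj_star : star (evenProj p d) = evenProj p d := by
  rw [evenProj, star_smul, star_add, parityMat_star, star_one]
  congr 1
  simp

/-- The determinant of `U` on the range of the idempotent `e` commuting with it. -/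
def detOn {ι : Type*} [Fintype ι] [DecidableEq ι] (e U : Matrix ι ι ℂ) : ℂ :=
  (U * e + (1 - e)).det

section DetOn

variable {ι : Type*} [Fintype ι] [DecidableEq ι] {e U V : Matrix ι ι ℂ}

theorem detOn_mul (he : IsIdempotentElem e) (hV : Commute V e) :
    detOn e (U * V) = detOn e U * detOn e V := by
  rw [detOn, detOn, detOn, ← Matrix.det_mul]
  congr 1
  have h1 : e * e = e := he
  have h2 : V * e = e * V := hV
  have h3 : e * (1 - e) = 0 := by rw [mul_sub, h1, mul_one, sub_self]
  have h4 : (1 - e) * e = 0 := by rw [sub_mul, h1, one_mul, sub_self]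
  have h5 : (1 - e) * (1 - e) = 1 - e := by rw [mul_sub, h4, mul_one, sub_zero]
  have h6 : (1 - e) * (V * e) = 0 := by rw [h2, ← mul_assoc, h4, zero_mul]
  have h7 : e * (V * e) = V * e := by rw [h2, ← mul_assoc, h1]
  rw [add_mul, mul_add, mul_add, h5, h6, mul_assoc U e (1 - e), h3, mul_assoc U e, h7]
  simp [mul_assoc]

theorem detOn_mem_unitary (he : IsIdempotentElem e) (hs : star e = e) (hU : Commute U e)
    (hu : U ∈ unitaryGroup ι ℂ) : ‖detOn e U‖ = 1 := by
  have h1 : e * e = e := he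
  have h2 : U * e = e * U := hU
  have h3 : e * (1 - e) = 0 := by rw [mul_sub, h1, mul_one, sub_self]
  have h4 : (1 - e) * e = 0 := by rw [sub_mul, h1, one_mul, sub_self]
  have h5 : (1 - e) * (1 - e) = 1 - e := by rw [mul_sub, h4, mul_one, sub_zero]
  have h6 : U * star U = 1 := mem_unitaryGroup_iff.1 hu
  have h : U * e + (1 - e) ∈ unitaryGroup ι ℂ := by
    rw [mem_unitaryGroup_iff, star_add, star_mul, star_sub, hs, star_one, add_mul, mul_add,
      mul_add, h5, mul_assoc U e (1 - e), h3, ← mul_assoc (1 - e), h4, h2, mul_assoc e U,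
      ← mul_assoc U e, h2, mul_assoc e U, h6, mul_one, h1]
    simp
  have := det_of_mem_unitary h
  exact CStarRing.norm_of_mem_unitary this

end DetOn

/-- The odd functions have dimension `l` and the even ones `l + 1`. These consecutive exponents are
what lets a determinant condition fix a scalar completely, without a root of unity left over. -/
theorem exists_detOn_smul (hp : p ≠ 2) : ∃ l : ℕ, ∀ (c : ℂ)
    (U : Matrix (Fin d → ZMod p) (Fin d → ZMod p) ℂ),
    detOn (evenProj p d) (c • U) = c ^ (l + 1) * detOn (evenProj p d) U ∧
    detOn (1 - evenProj p d) (c • U) = c ^ l * detOn (1 - evenProj p d) U := by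
  obtain ⟨k, hk, hk'⟩ := exists_det_smul_idempotent_matrix (evenProj_idem (p := p) (d := d))
  obtain ⟨l, hl, hl'⟩ := exists_det_smul_idempotent_matrix (evenProj_idem (p := p) (d := d)).one_sub
  have hkl : (k : ℂ) = l + 1 := by
    rw [← hk, ← hl, Matrix.trace_sub, evenProj, Matrix.trace_smul, Matrix.trace_add,
      parityMat_trace hp, smul_eq_mul]
    ring
  have hkl' : k = l + 1 := by exact_mod_cast hkl
  subst hkl'
  have h1 : ∀ (c : ℂ) (U : Matrix (Fin d → ZMod p) (Fin d → ZMod p) ℂ), c • U = U * (c • 1) :=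
    fun c U => by rw [Matrix.mul_smul, Matrix.mul_one]
  have h2 : ∀ (c : ℂ) (e : Matrix (Fin d → ZMod p) (Fin d → ZMod p) ℂ), Commute (c • 1) e :=
    fun c e => (Commute.one_left e).smul_left c
  refine ⟨l, fun c U => ⟨?_, ?_⟩⟩
  · rw [h1, detOn_mul evenProj_idem (h2 _ _), ← hk' c, mul_comm]
    simp [detOn]
  · rw [h1, detOn_mul evenProj_idem.one_sub (h2 _ _), ← hl' c, mul_comm]
    simp [detOn]

/-- The normalised intertwiners: their determinants on even and on odd functions agree. -/
structure IsNormalIntertwiner (g : SpP p d)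
    (U : Matrix (Fin d → ZMod p) (Fin d → ZMod p) ℂ) : Prop where
  unitary : U ∈ unitaryGroup (Fin d → ZMod p) ℂ
  intertwines : Intertwines g U
  det_eq : detOn (evenProj p d) U = detOn (1 - evenProj p d) U

theorem Intertwines.evenProj_comm (hp : p ≠ 2) {g : SpP p d}
    {U : Matrix (Fin d → ZMod p) (Fin d → ZMod p) ℂ} (hU : Intertwines g U)
    (hu : U ∈ unitaryGroup (Fin d → ZMod p) ℂ) : Commute U (evenProj p d) :=
  ((Commute.one_right U).add_right (hU.parity_comm hp hu)).smul_right _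

theorem smul_mem_unitaryGroup {ι : Type*} [Fintype ι] [DecidableEq ι] {U : Matrix ι ι ℂ}
    (hu : U ∈ unitaryGroup ι ℂ) {c : ℂ} (hc : ‖c‖ = 1) : c • U ∈ unitaryGroup ι ℂ := by
  rw [mem_unitaryGroup_iff, star_smul, Matrix.smul_mul, Matrix.mul_smul,
    mem_unitaryGroup_iff.1 hu, smul_smul]
  have : c * star c = 1 := by
    rw [RCLike.star_def, Complex.mul_conj', hc]; simp
  rw [this, one_smul]

/-- With determinants `x` on even and `y` on odd functions, the equation `c ^ (l + 1) * x = c ^ l *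
y` is solved by `c = y / x`, which has modulus one. -/
theorem exists_isNormalIntertwiner (hp : p ≠ 2) (g : SpP p d) :
    ∃ U, IsNormalIntertwiner g U := by
  obtain ⟨U, hu, hU⟩ := exists_unitary_intertwines hp g
  have hc := hU.evenProj_comm hp hu
  have h1 := detOn_mem_unitary evenProj_idem evenProj_star hc hu
  have h2 := detOn_mem_unitary (evenProj_idem (p := p) (d := d)).one_sub
    (by rw [star_sub, star_one, evenProj_star]) ((Commute.one_right U).sub_right hc) hu
  obtain ⟨l, hl⟩ := exists_detOn_smul (p := p) (d := d) hp
  set x := detOn (evenProj p d) U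
  set y := detOn (1 - evenProj p d) U
  have hx : x ≠ 0 := fun h => by simp [h] at h1
  refine ⟨(y / x) • U, smul_mem_unitaryGroup hu (by rw [norm_div, h1, h2, div_one]),
    hU.smul _, ?_⟩
  rw [(hl _ U).1, (hl _ U).2, pow_succ, mul_assoc]
  congr 1
  exact div_mul_cancel₀ y hx

theorem IsNormalIntertwiner.unique (hp : p ≠ 2) {g : SpP p d}
    {U V : Matrix (Fin d → ZMod p) (Fin d → ZMod p) ℂ} (hU : IsNormalIntertwiner g U)
    (hV : IsNormalIntertwiner g V) : V = U := by
  obtain ⟨c, rfl⟩ := hU.2.eq_smul hp hV.2 hU.1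
  have hc := hU.2.evenProj_comm hp hU.1
  have h1 := detOn_mem_unitary evenProj_idem evenProj_star hc hU.1
  have h3 := detOn_mem_unitary evenProj_idem evenProj_star (hc.smul_left c) hV.1
  have hx : detOn (evenProj p d) U ≠ 0 := fun h => by simp [h] at h1
  obtain ⟨l, hl⟩ := exists_detOn_smul (p := p) (d := d) hp
  have h2 := hV.3
  have hc0 : c ≠ 0 := by
    rintro rfl
    rw [(hl _ U).1] at h3
    simp at h3
  rw [(hl _ U).1, (hl _ U).2, ← hU.3, pow_succ, mul_assoc] at h2
  have h4 : c = 1 := mul_right_cancel₀ hx (by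
    rw [one_mul]; exact mul_left_cancel₀ (pow_ne_zero l hc0) h2)
  rw [h4, one_smul]

/-- Together with uniqueness this makes the choice of operators a genuine representation and not
merely a projective one. -/
theorem IsNormalIntertwiner.mul (hp : p ≠ 2) {g h : SpP p d}
    {U V : Matrix (Fin d → ZMod p) (Fin d → ZMod p) ℂ} (hU : IsNormalIntertwiner g U)
    (hV : IsNormalIntertwiner h V) : IsNormalIntertwiner (g * h) (U * V) := by
  have hc := hV.2.evenProj_comm hp hV.1
  refine ⟨mul_mem hU.1 hV.1, hU.2.mul hV.2, ?_⟩
  rw [detOn_mul evenProj_idem hc, detOn_mul evenProj_idem.one_sub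
    ((Commute.one_right V).sub_right hc), hU.3, hV.3]

/-- The Weil representation. -/
def weilMat (hp : p ≠ 2) : SpP p d →* unitaryGroup (Fin d → ZMod p) ℂ :=
  MonoidHom.mk' (fun g => ⟨(exists_isNormalIntertwiner hp g).choose,
    (exists_isNormalIntertwiner hp g).choose_spec.1⟩) fun g h => Subtype.ext <|
      ((exists_isNormalIntertwiner hp g).choose_spec.mul hp
        (exists_isNormalIntertwiner hp h).choose_spec).unique hp
        (exists_isNormalIntertwiner hp (g * h)).choose_spec

theorem weilMat_intertwines (hp : p ≠ 2) (g : SpP p d) : Intertwines g (weilMat hp g).1 :=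
  (exists_isNormalIntertwiner hp g).choose_spec.2

theorem exists_isQuantization (hp : p ≠ 2) (d : ℕ) :
    ∃ U : SpP p d →* (HilbertP p d ≃ₗᵢ[ℂ] HilbertP p d), IsQuantization U := by
  let E := (toEuclideanCLM (n := Fin d → ZMod p) (𝕜 := ℂ))
  let F : unitaryGroup (Fin d → ZMod p) ℂ →* unitary (HilbertP p d →L[ℂ] HilbertP p d) :=
    { toFun := fun u => ⟨E u.1, by
        rw [Unitary.mem_iff, ← map_star, ← map_mul, ← map_mul, mem_unitaryGroup_iff.1 u.2,
          mem_unitaryGroup_iff'.1 u.2, map_one]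
        exact ⟨rfl, rfl⟩⟩
      map_one' := Subtype.ext (map_one E)
      map_mul' := fun u v => Subtype.ext (map_mul E u.1 v.1) }
  refine ⟨Unitary.linearIsometryEquiv.toMonoidHom.comp (F.comp (weilMat hp)), ?_⟩
  intro B n ψ
  rw [elemOp_eq_toEuclideanLin, elemOp_eq_toEuclideanLin]
  rw [LinearIsometryEquiv.inv_def, LinearIsometryEquiv.symm_apply_eq]
  change WithLp.toLp 2 (elemMat n *ᵥ ((weilMat hp B).1 *ᵥ WithLp.ofLp ψ)) =
    WithLp.toLp 2 ((weilMat hp B).1 *ᵥ (elemMat (n ᵥ* B.1) *ᵥ WithLp.ofLp ψ))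
  rw [mulVec_mulVec, mulVec_mulVec, weilMat_intertwines hp B n]

end

/-! ### Transvections generate the symplectic group -/

section

variable {p : ℕ} [Fact p.Prime] {d : ℕ}

theorem vecMul_toMatrix'_transpose {K ι : Type*} [CommRing K] [Fintype ι] [DecidableEq ι]
    (f : (ι → K) →ₗ[K] (ι → K)) (v : ι → K) : v ᵥ* (LinearMap.toMatrix' f)ᵀ = f v := by
  rw [vecMul_transpose, LinearMap.toMatrix'_mulVec]

/-- The symplectic matrix of a linear map that preserves the form. -/
def spOfLinearMap (f : PhaseP p d →ₗ[ZMod p] PhaseP p d)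
    (hf : ∀ m n, sympForm (f m) (f n) = sympForm m n) : SpP p d :=
  ⟨(LinearMap.toMatrix' f)ᵀ, (mem_symplecticGroup_iff _).2 fun m n => by
    rw [vecMul_toMatrix'_transpose, vecMul_toMatrix'_transpose, hf]⟩

theorem vecMul_spOfLinearMap (f : PhaseP p d →ₗ[ZMod p] PhaseP p d)
    (hf : ∀ m n, sympForm (f m) (f n) = sympForm m n) (v : PhaseP p d) :
    v ᵥ* (spOfLinearMap f hf).1 = f v :=
  vecMul_toMatrix'_transpose f v

theorem spP_ext {B C : SpP p d} (h : ∀ v : PhaseP p d, v ᵥ* B.1 = v ᵥ* C.1) : B = C :=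
  Subtype.ext (Matrix.ext_of_single_vecMul fun _ => h _)

theorem vecMul_mul_spP (v : PhaseP p d) (B C : SpP p d) :
    v ᵥ* (B * C).1 = (v ᵥ* B.1) ᵥ* C.1 :=
  (vecMul_vecMul v B.1 C.1).symm

theorem vecMul_one_spP (v : PhaseP p d) : v ᵥ* (1 : SpP p d).1 = v := vecMul_one v

/-- The transvection `v ↦ v + a ω(v, u) u`. -/
def sympTransvection (u : PhaseP p d) (a : ZMod p) : SpP p d :=
  spOfLinearMap
    { toFun := fun v => v + (a * sympForm v u) • u
      map_add' := fun v w => by rw [sympForm_add_left, mul_add, add_smul]; abel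
      map_smul' := fun r v => by
        rw [sympForm_smul_left, RingHom.id_apply, smul_add, smul_smul]; congr 2; ring }
    fun m n => by
      simp only [LinearMap.coe_mk, AddHom.coe_mk, sympForm_add_left, sympForm_add_right,
        sympForm_smul_left, sympForm_smul_right, sympForm_self, sympForm_swap u n]
      ring

theorem vecMul_sympTransvection (u : PhaseP p d) (a : ZMod p) (v : PhaseP p d) :
    v ᵥ* (sympTransvection u a).1 = v + (a * sympForm v u) • u :=
  vecMul_spOfLinearMap _ _ v

theorem vecMul_sympTransvection_of_eq_zero {u v : PhaseP p d} (h : sympForm v u = 0)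
    (a : ZMod p) : v ᵥ* (sympTransvection u a).1 = v := by
  rw [vecMul_sympTransvection, h, mul_zero, zero_smul, add_zero]

theorem sympTransvection_pow (u : PhaseP p d) (a : ZMod p) (k : ℕ) :
    sympTransvection u a ^ k = sympTransvection u (k * a) := by
  refine spP_ext fun v => ?_
  rw [vecMul_sympTransvection]
  induction k with
  | zero => simp
  | succ k ih =>
    rw [pow_succ, vecMul_mul_spP, ih, vecMul_sympTransvection, sympForm_add_left,
      sympForm_smul_left, sympForm_self, mul_zero, add_zero, add_assoc, ← add_smul]
    push_cast
    congr 2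
    ring

/-- Powers multiply the parameter, which lives in characteristic `p`. -/
theorem sympTransvection_pow_p (u : PhaseP p d) (a : ZMod p) : sympTransvection u a ^ p = 1 := by
  rw [sympTransvection_pow]
  refine spP_ext fun v => ?_
  rw [vecMul_sympTransvection]
  simp

/-- Vectors whose first `k` coordinates of both kinds vanish. -/
def VanishesBelow (k : ℕ) (v : PhaseP p d) : Prop :=
  ∀ i : Fin d, i.1 < k → v (Sum.inl i) = 0 ∧ v (Sum.inr i) = 0

theorem sympForm_single_inl (v : PhaseP p d) (i : Fin d) :
    sympForm (Pi.single (Sum.inl i) 1) v = v (Sum.inr i) := by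
  rw [sympForm]
  have h1 : (Pi.single (Sum.inl i) 1 : PhaseP p d) ∘ Sum.inl = Pi.single i 1 := by
    funext j; simp [Pi.single_apply]
  have h2 : (Pi.single (Sum.inl i) 1 : PhaseP p d) ∘ Sum.inr = 0 := by
    funext j; simp
  rw [h1, h2]
  simp

theorem sympForm_single_inr (v : PhaseP p d) (i : Fin d) :
    sympForm (Pi.single (Sum.inr i) 1) v = -v (Sum.inl i) := by
  rw [sympForm]
  have h1 : (Pi.single (Sum.inr i) 1 : PhaseP p d) ∘ Sum.inr = Pi.single i 1 := by
    funext j; simp [Pi.single_apply]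
  have h2 : (Pi.single (Sum.inr i) 1 : PhaseP p d) ∘ Sum.inl = 0 := by
    funext j; simp
  rw [h1, h2]
  simp

/-- Orthogonality to the first `k` hyperbolic pairs: in this form the condition is visibly preserved
by symplectic maps fixing those pairs. -/
theorem vanishesBelow_iff {k : ℕ} {v : PhaseP p d} : VanishesBelow k v ↔
    ∀ i : Fin d, i.1 < k → sympForm (Pi.single (Sum.inl i) 1) v = 0 ∧
      sympForm (Pi.single (Sum.inr i) 1) v = 0 := by
  simp only [sympForm_single_inl, sympForm_single_inr, neg_eq_zero, VanishesBelow]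
  exact forall_congr' fun i => imp_congr_right fun _ => and_comm

/-- The symplectic matrices that fix the first `k` hyperbolic pairs of the standard basis. -/
def FixesBelow (k : ℕ) (g : SpP p d) : Prop :=
  ∀ i : Fin d, i.1 < k → Pi.single (Sum.inl i) 1 ᵥ* g.1 = Pi.single (Sum.inl i) 1 ∧
    Pi.single (Sum.inr i) 1 ᵥ* g.1 = Pi.single (Sum.inr i) 1

theorem FixesBelow.mul {k : ℕ} {g h : SpP p d} (hg : FixesBelow k g) (hh : FixesBelow k h) :
    FixesBelow k (g * h) := fun i hi => by
  rw [vecMul_mul_spP, vecMul_mul_spP, (hg i hi).1, (hg i hi).2]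
  exact hh i hi

theorem FixesBelow.vanishesBelow {k : ℕ} {g : SpP p d} (hg : FixesBelow k g) {v : PhaseP p d}
    (hv : VanishesBelow k v) : VanishesBelow k (v ᵥ* g.1) := by
  rw [vanishesBelow_iff] at hv ⊢
  intro i hi
  have h := hv i hi
  rw [← sympForm_vecMul_vecMul g, ← sympForm_vecMul_vecMul g _ v, (hg i hi).1, (hg i hi).2] at h
  exact h

theorem VanishesBelow.add {k : ℕ} {v w : PhaseP p d} (hv : VanishesBelow k v)
    (hw : VanishesBelow k w) : VanishesBelow k (v + w) := fun i hi => by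
  simp [hv i hi, hw i hi]

theorem VanishesBelow.sub {k : ℕ} {v w : PhaseP p d} (hv : VanishesBelow k v)
    (hw : VanishesBelow k w) : VanishesBelow k (v - w) := fun i hi => by
  simp [hv i hi, hw i hi]

theorem VanishesBelow.fixesBelow {k : ℕ} {u : PhaseP p d} (hu : VanishesBelow k u) (a : ZMod p) :
    FixesBelow k (sympTransvection u a) := fun i hi => by
  rw [vanishesBelow_iff] at hu
  rw [vecMul_sympTransvection, vecMul_sympTransvection, (hu i hi).1, (hu i hi).2]
  simp

theorem VanishesBelow.exists_ne_zero {k : ℕ} {v : PhaseP p d} (hv : VanishesBelow k v)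
    (h0 : v ≠ 0) : ∃ w, VanishesBelow k w ∧ sympForm v w ≠ 0 := by
  obtain ⟨i, hi⟩ := Function.ne_iff.1 h0
  rcases i with i | i
  · refine ⟨Pi.single (Sum.inr i) 1, fun j hj => ?_, ?_⟩
    · have : i ≠ j := by rintro rfl; exact hi (hv i hj).1
      simp [this.symm]
    · rw [sympForm_swap, sympForm_single_inr, neg_neg]; exact hi
  · refine ⟨Pi.single (Sum.inl i) 1, fun j hj => ?_, ?_⟩
    · have : i ≠ j := by rintro rfl; exact hi (hv i hj).2
      simp [this.symm]
    · rw [sympForm_swap, sympForm_single_inl]; exact neg_ne_zero.2 hi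

theorem sympTransvection_sub_apply {v w : PhaseP p d} (h : sympForm v w ≠ 0) :
    v ᵥ* (sympTransvection (w - v) (sympForm v w)⁻¹).1 = w := by
  rw [vecMul_sympTransvection, sympForm_sub_right, sympForm_self, sub_zero,
    inv_mul_cancel₀ h, one_smul]
  abel

section Generation

variable (N : Subgroup (SpP p d)) (hN : ∀ u a, sympTransvection u a ∈ N)
include hN

/-- One transvection along the difference joins two vectors that are not orthogonal. In general two
suffice, via a vector `x` orthogonal to neither end; such an `x` is a vector not orthogonal to `v`,
one not orthogonal to `w`, or their sum. -/
theorem exists_transvections_apply_eq {k : ℕ} {v w : PhaseP p d} (hv : VanishesBelow k v)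
    (hw : VanishesBelow k w) (hv0 : v ≠ 0) (hw0 : w ≠ 0) :
    ∃ h ∈ N, FixesBelow k h ∧ v ᵥ* h.1 = w := by
  have step : ∀ {v w : PhaseP p d}, VanishesBelow k v → VanishesBelow k w → sympForm v w ≠ 0 →
      ∃ h ∈ N, FixesBelow k h ∧ v ᵥ* h.1 = w := fun {v w} hv hw h =>
    ⟨_, hN (w - v) (sympForm v w)⁻¹, (hw.sub hv).fixesBelow _, sympTransvection_sub_apply h⟩
  obtain ⟨x, hx, hvx, hxw⟩ : ∃ x, VanishesBelow k x ∧ sympForm v x ≠ 0 ∧ sympForm x w ≠ 0 := by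
    obtain ⟨x, hx, hvx⟩ := hv.exists_ne_zero hv0
    obtain ⟨y, hy, hwy⟩ := hw.exists_ne_zero hw0
    rw [sympForm_swap, neg_ne_zero] at hwy
    by_cases h1 : sympForm x w = 0
    · by_cases h2 : sympForm v y = 0
      · refine ⟨x + y, hx.add hy, ?_, ?_⟩
        · rwa [sympForm_add_right, h2, add_zero]
        · rwa [sympForm_add_left, h1, zero_add]
      · exact ⟨y, hy, h2, hwy⟩
    · exact ⟨x, hx, hvx, h1⟩
  obtain ⟨h1, m1, f1, e1⟩ := step hv hx hvx
  obtain ⟨h2, m2, f2, e2⟩ := step hx hw hxw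
  exact ⟨h1 * h2, mul_mem m1 m2, f1.mul f2, by rw [vecMul_mul_spP, e1, e2]⟩

/-- The symplectic group is generated by transvections. -/
theorem mem_of_sympTransvection_mem : ∀ (j k : ℕ), k + j = d → ∀ g : SpP p d, FixesBelow k g →
    g ∈ N
  | 0, k, hk, g, hg => by
    have : g = 1 := by
      refine Subtype.ext (Matrix.ext_of_single_vecMul fun i => ?_)
      rcases i with i | i
      · rw [(hg i (by have := i.2; omega)).1]; exact (vecMul_one _).symm
      · rw [(hg i (by have := i.2; omega)).2]; exact (vecMul_one _).symm
    rw [this]; exact one_mem N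
  | j + 1, k, hk, g, hg => by
    let κ : Fin d := ⟨k, by omega⟩
    let e : PhaseP p d := Pi.single (Sum.inl κ) 1
    let f : PhaseP p d := Pi.single (Sum.inr κ) 1
    have he : VanishesBelow k e := fun i hi => by
      have : i ≠ κ := by rintro rfl; exact lt_irrefl _ hi
      simp [e, this]
    have hf : VanishesBelow k f := fun i hi => by
      have : i ≠ κ := by rintro rfl; exact lt_irrefl _ hi
      simp [f, this]
    have hef : sympForm e f = 1 := by
      rw [sympForm_single_inl]; simp [f]
    have he0 : e ≠ 0 := by
      intro h; rw [h, sympForm_eq] at hef; simp at hef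
    have heg0 : e ᵥ* g.1 ≠ 0 := by
      intro h
      rw [← sympForm_vecMul_vecMul g, h, sympForm_eq] at hef; simp at hef
    -- Induction on the number of pairs not yet fixed: transvections first bring the image of `e`
    -- back to `e`, then the image `v` of `f` back to `f` without moving `e`.
    obtain ⟨h1, m1, f1, e1⟩ := exists_transvections_apply_eq N hN (hg.vanishesBelow he) he heg0 he0
    have hg1 : FixesBelow k (g * h1) := hg.mul f1
    have eg1 : e ᵥ* (g * h1).1 = e := by rw [vecMul_mul_spP, e1]
    set v := f ᵥ* (g * h1).1 with hv
    have hvk : VanishesBelow k v := hg1.vanishesBelow hf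
    have hev : sympForm e v = 1 := by
      rw [hv]; nth_rw 1 [← eg1]
      rw [sympForm_vecMul_vecMul, hef]
    obtain ⟨h2, m2, f2, e2, ef2⟩ : ∃ h ∈ N, FixesBelow k h ∧ e ᵥ* h.1 = e ∧ v ᵥ* h.1 = f := by
      -- The direction `f - v` is orthogonal to `e`, as `v` and `f` both pair to one with `e`, so
      -- that transvection fixes `e`. When `v` and `f` are orthogonal, the detour through `e + f`
      -- has the same property.
      by_cases h : sympForm v f = 0
      · have h3 : sympForm v (e + f) ≠ 0 := by
          rw [sympForm_add_right, h, add_zero, sympForm_swap, hev]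
          exact neg_ne_zero.2 one_ne_zero
        have h4 : sympForm (e + f) f ≠ 0 := by
          rw [sympForm_add_left, sympForm_self, add_zero, hef]; exact one_ne_zero
        refine ⟨_, mul_mem (hN (e + f - v) (sympForm v (e + f))⁻¹)
          (hN (f - (e + f)) (sympForm (e + f) f)⁻¹),
          (((he.add hf).sub hvk).fixesBelow _).mul ((hf.sub (he.add hf)).fixesBelow _), ?_, ?_⟩
        · rw [vecMul_mul_spP, vecMul_sympTransvection_of_eq_zero (u := e + f - v) (by
              rw [sympForm_sub_right, sympForm_add_right, sympForm_self, hef, hev, zero_add,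
                sub_self]),
            vecMul_sympTransvection_of_eq_zero (by
              rw [sympForm_sub_right, sympForm_add_right, sympForm_self, hef, zero_add,
                sub_self])]
        · rw [vecMul_mul_spP, sympTransvection_sub_apply h3, sympTransvection_sub_apply h4]
      · refine ⟨_, hN (f - v) (sympForm v f)⁻¹, (hf.sub hvk).fixesBelow _, ?_,
          sympTransvection_sub_apply h⟩
        rw [vecMul_sympTransvection, sympForm_sub_right, hef, hev, sub_self, mul_zero,
          zero_smul, add_zero]
    have hg2 : FixesBelow (k + 1) (g * h1 * h2) := by
      intro i hi
      rcases Nat.lt_succ_iff_lt_or_eq.1 hi with hi | hi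
      · exact (hg1.mul f2) i hi
      · have : i = κ := Fin.ext hi
        subst this
        constructor
        · rw [vecMul_mul_spP]
          change (e ᵥ* (g * h1).1) ᵥ* h2.1 = e
          rw [eg1, e2]
        · rw [vecMul_mul_spP]
          exact ef2
    have := mem_of_sympTransvection_mem j (k + 1) (by omega) _ hg2
    rw [mul_assoc] at this
    exact (Subgroup.mul_mem_cancel_right N (mul_mem m1 m2)).1 this

end Generation

/-- Linear characters of the symplectic group have exponent dividing `p`. -/
theorem symp_monoidHom_pow_eq_one {M : Type*} [CommGroup M] (f : SpP p d →* M) (g : SpP p d) :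
    f g ^ p = 1 := by
  have h : g ∈ ((powMonoidHom p).comp f).ker := by
    refine mem_of_sympTransvection_mem _ (fun u a => ?_) d 0 (by simp) g
      (fun i hi => absurd hi (Nat.not_lt_zero _))
    rw [MonoidHom.mem_ker, MonoidHom.comp_apply, powMonoidHom_apply, ← map_pow,
      sympTransvection_pow_p, map_one]
  exact MonoidHom.mem_ker.1 h

end

/-! ### Multiplicities of characters in a representation of a finite abelian group -/

section

section CharacterProjection

variable {G V : Type*} [Group G] [Fintype G] [AddCommGroup V] [Module ℂ V]

variable (ρ : G →* Module.End ℂ V)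

/-- The projection onto the `χ`-isotypic part. -/
def charProj (χ : G →* ℂˣ) : Module.End ℂ V :=
  (Fintype.card G : ℂ)⁻¹ • ∑ g : G, (χ g⁻¹ : ℂ) • ρ g

theorem card_group_ne_zero : (Fintype.card G : ℂ) ≠ 0 := Nat.cast_ne_zero.2 Fintype.card_ne_zero

theorem rep_mul_charProj (χ : G →* ℂˣ) (h : G) :
    ρ h * charProj ρ χ = (χ h : ℂ) • charProj ρ χ := by
  rw [charProj, mul_smul_comm, smul_comm, Finset.mul_sum, Finset.smul_sum (r := (χ h : ℂ)),
    ← Equiv.sum_comp (Equiv.mulLeft h⁻¹) (fun g : G => ρ h * (χ g⁻¹ : ℂ) • ρ g)]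
  congr 1
  refine Finset.sum_congr rfl fun g _ => ?_
  rw [Equiv.coe_mulLeft, mul_smul_comm, ← map_mul, mul_inv_cancel_left, smul_smul,
    _root_.mul_inv_rev, inv_inv, map_mul, Units.val_mul, mul_comm]

theorem charProj_apply_of_mem {χ : G →* ℂˣ} {v : V} (hv : ∀ g, ρ g v = (χ g : ℂ) • v) :
    charProj ρ χ v = v := by
  simp only [charProj, LinearMap.smul_apply, LinearMap.sum_apply, hv, smul_smul, ← Units.val_mul,
    ← map_mul, inv_mul_cancel, map_one, Units.val_one, one_smul, Finset.sum_const,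
    Finset.card_univ, ← Nat.cast_smul_eq_nsmul ℂ]
  rw [inv_mul_cancel₀ card_group_ne_zero, one_smul]

theorem charProj_isProj {χ : G →* ℂˣ} {W : Submodule ℂ V}
    (hW : ∀ v, v ∈ W ↔ ∀ g, ρ g v = (χ g : ℂ) • v) : LinearMap.IsProj W (charProj ρ χ) where
  map_mem v := (hW _).2 fun g => LinearMap.congr_fun (rep_mul_charProj ρ χ g) v
  map_id v hv := charProj_apply_of_mem ρ ((hW v).1 hv)

end CharacterProjection

section CharacterDecomposition

variable {G V : Type*} [CommGroup G] [Fintype G] [AddCommGroup V] [Module ℂ V]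

instance instFintypeMonoidHomUnits : Fintype (G →* ℂˣ) := by
  classical
  have : Finite (G →* ℂˣ) :=
    Finite.of_equiv G (CommGroup.monoidHom_mulEquiv_of_hasEnoughRootsOfUnity G ℂ).some.toEquiv.symm
  exact Fintype.ofFinite _

theorem card_monoidHom_units : Fintype.card (G →* ℂˣ) = Fintype.card G :=
  Fintype.card_congr (CommGroup.monoidHom_mulEquiv_of_hasEnoughRootsOfUnity G ℂ).some.toEquiv

theorem sum_char_apply [DecidableEq G] (g : G) :
    ∑ χ : G →* ℂˣ, (χ g : ℂ) = if g = 1 then (Fintype.card G : ℂ) else 0 := by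
  split_ifs with h
  · subst h
    simp [card_monoidHom_units]
  · obtain ⟨ψ, hψ⟩ := CommGroup.exists_apply_ne_one_of_hasEnoughRootsOfUnity G ℂ h
    have h1 : (ψ g : ℂ) * ∑ χ : G →* ℂˣ, (χ g : ℂ) = ∑ χ : G →* ℂˣ, (χ g : ℂ) := by
      conv_rhs => rw [← Equiv.sum_comp (Equiv.mulLeft ψ)]
      rw [Finset.mul_sum]
      simp
    have h2 : ((ψ g : ℂ) - 1) * ∑ χ : G →* ℂˣ, (χ g : ℂ) = 0 := by rw [sub_mul, h1]; ring
    refine (mul_eq_zero.1 h2).resolve_left fun h3 => hψ (Units.ext ?_)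
    rw [Units.val_one]; linear_combination h3

variable (ρ : G →* Module.End ℂ V)

theorem charProj_mul_ne {χ χ' : G →* ℂˣ} (h : χ ≠ χ') : charProj ρ χ * charProj ρ χ' = 0 := by
  obtain ⟨g, hg⟩ : ∃ g, χ g ≠ χ' g := by
    by_contra! h'
    exact h (MonoidHom.ext h')
  have h1 : charProj ρ χ * ρ g = (χ g : ℂ) • charProj ρ χ := by
    rw [← rep_mul_charProj]
    have : Commute (ρ g) (charProj ρ χ) := by
      refine Commute.smul_right (Commute.sum_right _ _ _ fun k _ => Commute.smul_right ?_ _) _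
      rw [commute_iff_eq, ← map_mul, ← map_mul, mul_comm]
    exact this.symm
  have h2 : (χ g : ℂ) • (charProj ρ χ * charProj ρ χ') =
      (χ' g : ℂ) • (charProj ρ χ * charProj ρ χ') := by
    rw [← smul_mul_assoc, ← h1, mul_assoc, rep_mul_charProj, mul_smul_comm]
  rw [← sub_eq_zero, ← sub_smul, smul_eq_zero, sub_eq_zero] at h2
  exact h2.resolve_left fun h3 => hg (Units.ext h3)

theorem charProj_idem (χ : G →* ℂˣ) : IsIdempotentElem (charProj ρ χ) :=
  LinearMap.ext fun v => charProj_apply_of_mem ρ fun g =>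
    LinearMap.congr_fun (rep_mul_charProj ρ χ g) v

/-- Fourier inversion: by orthogonality of characters only the group element `h` survives the
summation over `χ`. -/
theorem sum_charProj_smul (h : G) : ∑ χ : G →* ℂˣ, (χ h : ℂ) • charProj ρ χ = ρ h := by
  classical
  simp only [charProj, Finset.smul_sum, smul_smul]
  rw [Finset.sum_comm]
  have : ∀ g : G, ∑ χ : G →* ℂˣ, ((χ h : ℂ) * ((Fintype.card G : ℂ)⁻¹ * (χ g⁻¹ : ℂ))) • ρ g =
      if g = h then ρ h else 0 := by
    intro g
    rw [← Finset.sum_smul]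
    have h1 : ∀ χ : G →* ℂˣ, (χ h : ℂ) * ((Fintype.card G : ℂ)⁻¹ * (χ g⁻¹ : ℂ)) =
        (Fintype.card G : ℂ)⁻¹ * (χ (h * g⁻¹) : ℂ) := fun χ => by
      rw [map_mul, Units.val_mul]; ring
    simp only [h1, ← Finset.mul_sum, sum_char_apply, mul_inv_eq_one, eq_comm (a := h)]
    split_ifs with h2
    · rw [inv_mul_cancel₀ card_group_ne_zero, one_smul, h2]
    · simp
  simp only [this]
  simp

theorem sum_charProj : ∑ χ : G →* ℂˣ, charProj ρ χ = 1 := by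
  have := sum_charProj_smul ρ 1
  simpa using this

variable [FiniteDimensional ℂ V]

theorem trace_charProj {χ : G →* ℂˣ} {W : Submodule ℂ V}
    (hW : ∀ v, v ∈ W ↔ ∀ g, ρ g v = (χ g : ℂ) • v) :
    LinearMap.trace ℂ V (charProj ρ χ) = Module.finrank ℂ W :=
  (charProj_isProj ρ hW).trace

theorem sum_finrank_eq (W : (G →* ℂˣ) → Submodule ℂ V)
    (hW : ∀ χ v, v ∈ W χ ↔ ∀ g, ρ g v = (χ g : ℂ) • v) :
    ∑ χ, (Module.finrank ℂ (W χ) : ℂ) = Module.finrank ℂ V := by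
  simp only [← trace_charProj ρ (hW _)]
  rw [← map_sum, sum_charProj, LinearMap.trace_one]

/-- Parseval's identity: the multiplicities are the Fourier coefficients of the trace of the
representation. -/
theorem sum_finrank_sq_eq (W : (G →* ℂˣ) → Submodule ℂ V)
    (hW : ∀ χ v, v ∈ W χ ↔ ∀ g, ρ g v = (χ g : ℂ) • v) :
    (Fintype.card G : ℂ) * ∑ χ, (Module.finrank ℂ (W χ) : ℂ) ^ 2 =
      ∑ g, LinearMap.trace ℂ V (ρ g) * LinearMap.trace ℂ V (ρ g⁻¹) := by
  classical
  have h1 : ∀ χ : G →* ℂˣ, (Module.finrank ℂ (W χ) : ℂ) ^ 2 = (Fintype.card G : ℂ)⁻¹ *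
      ∑ g, (Module.finrank ℂ (W χ) : ℂ) * (χ g : ℂ) * LinearMap.trace ℂ V (ρ g⁻¹) := by
    intro χ
    have h2 : (Module.finrank ℂ (W χ) : ℂ) = (Fintype.card G : ℂ)⁻¹ *
        ∑ g, (χ g : ℂ) * LinearMap.trace ℂ V (ρ g⁻¹) := by
      rw [← trace_charProj ρ (hW χ), charProj, map_smul, map_sum, smul_eq_mul,
        ← Equiv.sum_comp (Equiv.inv G)]
      simp
    rw [sq]
    nth_rw 2 [h2]
    simp only [Finset.mul_sum]
    exact Finset.sum_congr rfl fun _ _ => by ring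
  have h3 : ∀ g, LinearMap.trace ℂ V (ρ g) =
      ∑ χ : G →* ℂˣ, (Module.finrank ℂ (W χ) : ℂ) * (χ g : ℂ) := by
    intro g
    rw [← sum_charProj_smul ρ g, map_sum]
    refine Finset.sum_congr rfl fun χ _ => ?_
    rw [map_smul, trace_charProj ρ (hW χ), smul_eq_mul, mul_comm]
  simp only [h1]
  rw [← Finset.mul_sum, ← mul_assoc, mul_inv_cancel₀ card_group_ne_zero, one_mul,
    Finset.sum_comm]
  refine Finset.sum_congr rfl fun g _ => ?_
  rw [h3 g, Finset.sum_mul]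

/-- The operator `ρ g` factors into the commuting maps `χ(g) e_χ + (1 - e_χ)`, each with determinant
a power of `χ(g)`; the induction adds one orthogonal idempotent at a time. -/
theorem det_rep_eq (W : (G →* ℂˣ) → Submodule ℂ V)
    (hW : ∀ χ v, v ∈ W χ ↔ ∀ g, ρ g v = (χ g : ℂ) • v) (g : G) :
    LinearMap.det (ρ g) = ∏ χ : G →* ℂˣ, (χ g : ℂ) ^ Module.finrank ℂ (W χ) := by
  classical
  have key : ∀ s : Finset (G →* ℂˣ), LinearMap.det
      (∑ χ ∈ s, (χ g : ℂ) • charProj ρ χ + (1 - ∑ χ ∈ s, charProj ρ χ)) =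
      ∏ χ ∈ s, (χ g : ℂ) ^ Module.finrank ℂ (W χ) := by
    intro s
    induction s using Finset.induction_on with
    | empty => simp
    | insert ψ s hs ih =>
      rw [Finset.prod_insert hs, ← ih]
      obtain ⟨k, hk, hk'⟩ := exists_det_smul_idempotent (charProj_idem ρ ψ)
      rw [trace_charProj ρ (hW ψ), Nat.cast_inj] at hk
      rw [hk, ← hk', ← LinearMap.det_comp]
      congr 1
      rw [← Module.End.mul_eq_comp, Finset.sum_insert hs, Finset.sum_insert hs]
      have h1 : charProj ρ ψ * ∑ χ ∈ s, charProj ρ χ = 0 := by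
        rw [Finset.mul_sum]
        exact Finset.sum_eq_zero fun χ hχ => charProj_mul_ne ρ (ne_of_mem_of_not_mem hχ hs).symm
      have h2 : charProj ρ ψ * ∑ χ ∈ s, (χ g : ℂ) • charProj ρ χ = 0 := by
        rw [Finset.mul_sum]
        refine Finset.sum_eq_zero fun χ hχ => ?_
        rw [mul_smul_comm, charProj_mul_ne ρ (ne_of_mem_of_not_mem hχ hs).symm, smul_zero]
      simp only [mul_add, mul_sub, add_mul, sub_mul, one_mul, mul_one, smul_mul_assoc, h1, h2,
        smul_zero]
      abel
  have := key Finset.univ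
  rwa [sum_charProj_smul, sum_charProj, sub_self, add_zero] at this

end CharacterDecomposition

/-- As in Wilson's theorem: elements other than `1` and `z` cancel against their inverses. -/
theorem prod_univ_eq_involution {H : Type*} [CommGroup H] [Fintype H] {z : H}
    (h : ∀ x : H, x * x = 1 ↔ x = 1 ∨ x = z) : ∏ x : H, x = z := by
  classical
  rw [← Finset.mul_prod_erase Finset.univ (fun x => x) (Finset.mem_univ z)]
  have hzz : z * z = 1 := (h z).2 (Or.inr rfl)
  rw [Finset.prod_involution (fun x _ => x⁻¹), mul_one]
  · intro x _; exact mul_inv_cancel x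
  · intro x hx hx1 h2
    have h3 : x * x = 1 := by nth_rw 2 [← h2]; exact mul_inv_cancel x
    rcases (h x).1 h3 with h4 | h4
    · exact hx1 h4
    · exact (Finset.mem_erase.1 hx).1 h4
  · intro x hx
    refine Finset.mem_erase.2 ⟨fun h2 => (Finset.mem_erase.1 hx).1 ?_, Finset.mem_univ _⟩
    rw [← inv_inv x, h2]
    exact inv_eq_of_mul_eq_one_left hzz
  · intro x _; exact inv_inv x

/-- Dropping or doubling the factor `y` changes the full product, which is `z`, by `y⁻¹` or `y`.
Triviality of the result gives `y = z`, as `z` is its own inverse. -/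
theorem eq_involution_of_prod_pow {H : Type*} [CommGroup H] [Fintype H] {z : H}
    (h : ∀ x : H, x * x = 1 ↔ x = 1 ∨ x = z) (n : H → ℕ) {y : H} (hn : ∀ x, x ≠ y → n x = 1)
    (hy : n y = 0 ∨ n y = 2) (hprod : ∏ x, x ^ n x = 1) : y = z := by
  classical
  have hall := prod_univ_eq_involution h
  rw [← Finset.mul_prod_erase _ _ (Finset.mem_univ y)] at hall hprod
  rw [Finset.prod_congr rfl fun x hx => by
    rw [hn x (Finset.ne_of_mem_erase hx), pow_one]] at hprod
  rcases hy with hy | hy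
  · rw [hy, pow_zero, one_mul] at hprod
    rwa [hprod, mul_one] at hall
  · rw [hy, sq, mul_assoc, hall] at hprod
    have h3 : z * z = 1 := (h z).2 (Or.inr rfl)
    rw [← mul_inv_eq_one, inv_eq_of_mul_eq_one_left h3]
    exact hprod

theorem exists_of_sum_sq_eq_one {ι : Type*} [Fintype ι] [DecidableEq ι] {f : ι → ℤ}
    (h : ∑ i, f i ^ 2 = 1) : ∃ i₀, ∀ i, i ≠ i₀ → f i = 0 := by
  by_contra! hno
  have hne : ∃ i, f i ≠ 0 := by
    by_contra! h0
    simp [h0] at h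
  obtain ⟨i, hi⟩ := hne
  obtain ⟨j, hji, hj⟩ := hno i
  have h1 : ∑ k ∈ {i, j}, f k ^ 2 ≤ ∑ k, f k ^ 2 :=
    Finset.sum_le_sum_of_subset_of_nonneg (Finset.subset_univ _) fun _ _ _ => sq_nonneg _
  rw [Finset.sum_pair hji.symm, h] at h1
  have h2 : 0 < f i ^ 2 := by positivity
  have h3 : 0 < f j ^ 2 := by positivity
  omega

theorem orderOf_eq_two_iff_of_unique {H : Type*} [CommGroup H] {z : H} (hz : z ≠ 1)
    (h : ∀ x : H, x * x = 1 ↔ x = 1 ∨ x = z) (x : H) : orderOf x = 2 ↔ x = z := by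
  rw [orderOf_eq_iff (by norm_num)]
  constructor
  · rintro ⟨h1, h2⟩
    rw [sq] at h1
    refine ((h x).1 h1).resolve_left fun h3 => h2 1 (by norm_num) (by norm_num) ?_
    rw [h3, one_pow]
  · rintro rfl
    refine ⟨by rw [sq]; exact (h x).2 (Or.inr rfl), fun m hm hm0 => ?_⟩
    have : m = 1 := by omega
    rw [this, pow_one]
    exact hz

/-- Multiplicities in a representation of an abelian group with almost constant character. -/
theorem exists_quadratic_char_finrank {G V : Type*} [CommGroup G] [Fintype G] [AddCommGroup V]
    [Module ℂ V] [FiniteDimensional ℂ V] (ρ : G →* Module.End ℂ V)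
    (W : (G →* ℂˣ) → Submodule ℂ V) (hW : ∀ χ v, v ∈ W χ ↔ ∀ g, ρ g v = (χ g : ℂ) • v)
    (hdet : ∀ g, LinearMap.det (ρ g) = 1)
    (htr : ∀ g, g ≠ 1 → LinearMap.trace ℂ V (ρ g) * LinearMap.trace ℂ V (ρ g⁻¹) = 1)
    {ε : ℤ} (hε : ε = 1 ∨ ε = -1) (hcard : (Fintype.card G : ℤ) = Module.finrank ℂ V - ε)
    {z : G} (hz : z ≠ 1) (hinv : ∀ x : G, x * x = 1 ↔ x = 1 ∨ x = z) :
    ∃ χ₂ : G →* ℂˣ, (∀ χ : G →* ℂˣ, orderOf χ = 2 ↔ χ = χ₂) ∧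
      (∀ χ, χ ≠ χ₂ → Module.finrank ℂ (W χ) = 1) ∧ (Module.finrank ℂ (W χ₂) : ℤ) = 1 + ε := by
  classical
  -- The dual of a finite abelian group is isomorphic to the group, so it too has a unique
  -- involution.
  let E := (CommGroup.monoidHom_mulEquiv_of_hasEnoughRootsOfUnity G ℂ).some
  have hz' : E.symm z ≠ 1 := fun h => hz (by simpa using h)
  have hinv' : ∀ x : G →* ℂˣ, x * x = 1 ↔ x = 1 ∨ x = E.symm z := by
    intro x
    rw [← E.injective.eq_iff, map_mul, map_one, hinv, MulEquiv.eq_symm_apply,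
      EmbeddingLike.map_eq_one_iff]
  set m : (G →* ℂˣ) → ℤ := fun χ => Module.finrank ℂ (W χ) with hm
  have hs1 : ∑ χ, m χ = Module.finrank ℂ V := by
    have := sum_finrank_eq ρ W hW
    simp only [hm]
    exact_mod_cast this
  have hs2 : (Fintype.card G : ℤ) * ∑ χ, m χ ^ 2 =
      (Module.finrank ℂ V : ℤ) ^ 2 + (Fintype.card G - 1) := by
    have h1 := sum_finrank_sq_eq ρ W hW
    rw [← Finset.add_sum_erase _ _ (Finset.mem_univ (1 : G)),
      Finset.sum_congr rfl fun g hg => htr g (Finset.ne_of_mem_erase hg), Finset.sum_const,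
      Finset.card_erase_of_mem (Finset.mem_univ _), Finset.card_univ, inv_one, map_one,
      LinearMap.trace_one, nsmul_eq_mul, mul_one, Nat.cast_sub Fintype.card_pos, ← sq] at h1
    have h2 : (((Fintype.card G : ℤ) * ∑ χ, m χ ^ 2 : ℤ) : ℂ) =
      (((Module.finrank ℂ V : ℤ) ^ 2 + (Fintype.card G - 1) : ℤ) : ℂ) := by
      push_cast
      simp only [hm, Int.cast_natCast]
      rw [h1]; simp
    exact_mod_cast h2
  have hcc : ∑ _χ : G →* ℂˣ, (1 : ℤ) = Fintype.card G := by
    rw [Finset.sum_const, Finset.card_univ, card_monoidHom_units]; simp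
  -- With `N = |G|`, the first moment is `N + ε` and the second is `N + 2ε + 1`. One multiplicity
  -- differs from `1`, and the first moment makes it `1 + ε`.
  have hs3 : ∑ χ, (m χ - 1) ^ 2 = 1 := by
    have h1 : ∑ χ, (m χ - 1) ^ 2 = ∑ χ, m χ ^ 2 - 2 * ∑ χ, m χ + ∑ _χ : G →* ℂˣ, (1 : ℤ) := by
      rw [Finset.mul_sum, ← Finset.sum_sub_distrib, ← Finset.sum_add_distrib]
      exact Finset.sum_congr rfl fun _ _ => by ring
    rw [hs1, hcc] at h1
    have h2 : (Fintype.card G : ℤ) ≠ 0 := Nat.cast_ne_zero.2 Fintype.card_ne_zero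
    have h3 : ε ^ 2 = 1 := by rcases hε with rfl | rfl <;> norm_num
    have h4 : (Module.finrank ℂ V : ℤ) = Fintype.card G + ε := by rw [hcard]; ring
    apply mul_left_cancel₀ h2
    rw [h1]
    rw [h4] at hs2 ⊢
    linear_combination hs2 + h3
  obtain ⟨χ₀, hχ₀⟩ := exists_of_sum_sq_eq_one hs3
  have hm1 : ∀ χ, χ ≠ χ₀ → m χ = 1 := fun χ h => by have := hχ₀ χ h; omega
  have hm0 : m χ₀ = 1 + ε := by
    have h1 : ∑ χ, (m χ - 1) = ε := by
      rw [Finset.sum_sub_distrib, hs1, hcc, hcard]; ring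
    rw [Finset.sum_eq_single χ₀ (fun χ _ h => hχ₀ χ h) (by simp)] at h1
    omega
  -- The moments say nothing about which character is exceptional; the trivial determinant decides.
  have hprod : ∏ χ : G →* ℂˣ, χ ^ Module.finrank ℂ (W χ) = 1 := by
    ext g
    have := det_rep_eq ρ W hW g
    rw [hdet] at this
    simp only [MonoidHom.finsetProd_apply, MonoidHom.pow_apply, Units.coe_prod,
      Units.val_pow_eq_pow_val, ← this, MonoidHom.one_apply, Units.val_one]
  have hm' : ∀ χ, m χ = (Module.finrank ℂ (W χ) : ℤ) := fun _ => rfl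
  have hχ : χ₀ = E.symm z := by
    refine eq_involution_of_prod_pow hinv' (fun χ => Module.finrank ℂ (W χ)) (fun χ h => ?_) ?_
      hprod
    · have := hm1 χ h
      rw [hm'] at this
      exact_mod_cast this
    · rw [hm'] at hm0
      rcases hε with rfl | rfl <;> omega
  refine ⟨E.symm z, orderOf_eq_two_iff_of_unique hz' hinv', ?_, ?_⟩
  · intro χ h
    rw [← hχ] at h
    have := hm1 χ h
    rw [hm'] at this
    exact_mod_cast this
  · rw [← hχ]; exact hm0

end

/-! ### Matrices commuting with `A` as polynomials, and the form in an eigenbasis -/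

section

/-- Diagonalization of a matrix with distinct eigenvalues. -/
theorem exists_diagonalization {ι L : Type*} [Fintype ι] [DecidableEq ι] [Field L] [IsAlgClosed L]
    (M : Matrix ι ι L) (h : M.charpoly.roots.Nodup) :
    ∃ (P : Matrix ι ι L) (x : ι → L), IsUnit P ∧ Function.Injective x ∧
      P * M = diagonal x * P ∧ ∀ y, y ∈ M.charpoly.roots ↔ ∃ i, x i = y := by
  classical
  have hcard : Fintype.card ι = Fintype.card M.charpoly.roots.toFinset := by
    rw [Fintype.card_coe, Multiset.toFinset_card_of_nodup h,
      ← (IsAlgClosed.splits M.charpoly).natDegree_eq_card_roots, charpoly_natDegree_eq_dim]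
  let e : ι ≃ M.charpoly.roots.toFinset := Fintype.equivOfCardEq hcard
  have hx : ∀ i, (e i : L) ∈ M.charpoly.roots := fun i => Multiset.mem_toFinset.1 (e i).2
  have hv : ∀ i, ∃ v : ι → L, v ≠ 0 ∧ v ᵥ* M = (e i : L) • v := by
    intro i
    have h1 := (Polynomial.mem_roots'.1 (hx i)).2
    rw [Polynomial.IsRoot.def, eval_charpoly, ← exists_vecMul_eq_zero_iff] at h1
    obtain ⟨v, hv0, hv⟩ := h1
    refine ⟨v, hv0, ?_⟩
    rw [vecMul_sub, sub_eq_zero] at hv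
    rw [← hv]
    ext j
    simp [scalar_apply, mul_comm]
  choose v hv0 hv using hv
  have hinj : Function.Injective fun i => (e i : L) := Subtype.val_injective.comp e.injective
  refine ⟨Matrix.of v, fun i => e i, ?_, hinj, ?_, ?_⟩
  · rw [← linearIndependent_rows_iff_isUnit]
    exact Module.End.eigenvectors_linearIndependent' M.vecMulLinear _ hinj v fun i =>
      ⟨Module.End.mem_eigenspace_iff.2 (hv i), hv0 i⟩
  · refine Matrix.ext fun i j => ?_
    rw [diagonal_mul]
    exact congrFun (hv i) j
  · intro y
    constructor
    · intro hy
      exact ⟨e.symm ⟨y, Multiset.mem_toFinset.2 hy⟩, by simp⟩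
    · rintro ⟨i, rfl⟩
      exact hx i

variable {p : ℕ} [Fact p.Prime] {d : ℕ}

/-- The algebraic closure of the prime field. -/
abbrev FpBar (p : ℕ) [Fact p.Prime] : Type := AlgebraicClosure (ZMod p)

/-- The extension of scalars of a matrix. -/
def toBar {m n : Type*} (B : Matrix m n (ZMod p)) : Matrix m n (FpBar p) :=
  B.map (algebraMap (ZMod p) (FpBar p))

section ToBar

variable {l m n : Type*} [Fintype m]

theorem toBar_mul (B : Matrix l m (ZMod p)) (C : Matrix m n (ZMod p)) :
    toBar (B * C) = toBar B * toBar C := Matrix.map_mul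

theorem toBar_transpose (B : Matrix l m (ZMod p)) : toBar Bᵀ = (toBar B)ᵀ := rfl

theorem toBar_injective : Function.Injective (toBar : Matrix l n (ZMod p) → _) :=
  Matrix.map_injective (algebraMap (ZMod p) (FpBar p)).injective

theorem toBar_one [DecidableEq m] : toBar (1 : Matrix m m (ZMod p)) = 1 :=
  Matrix.map_one _ (map_zero _) (map_one _)

theorem toBar_aeval [DecidableEq m] (A : Matrix m m (ZMod p)) (h : Polynomial (ZMod p)) :
    toBar (Polynomial.aeval A h) = Polynomial.aeval (toBar A) h :=
  (Polynomial.aeval_algHom_apply (Algebra.ofId (ZMod p) (FpBar p)).mapMatrix A h).symm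

end ToBar

/-- A matrix of eigenvectors over the algebraic closure, for distinct eigenvalues. -/
structure EigenFrame (A : SpP p d) where
  /-- The rows are eigenvectors. -/
  P : Matrix (Fin d ⊕ Fin d) (Fin d ⊕ Fin d) (FpBar p)
  /-- The eigenvalues. -/
  x : Fin d ⊕ Fin d → FpBar p
  isUnit : IsUnit P
  injective : Function.Injective x
  mul_eq : P * toBar A.1 = diagonal x * P
  mem_iff : ∀ y, y ∈ eigenvaluesP A ↔ ∃ i, x i = y

theorem nonempty_eigenFrame {A : SpP p d} (h : (eigenvaluesP A).Nodup) :
    Nonempty (EigenFrame A) := by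
  have h1 : (toBar A.1).charpoly.roots = eigenvaluesP A := by
    rw [toBar, charpoly_map]; rfl
  obtain ⟨P, x, hP, hx, hm, hi⟩ := exists_diagonalization (toBar A.1) (by rwa [h1])
  exact ⟨⟨P, x, hP, hx, hm, by rwa [h1] at hi⟩⟩

namespace EigenFrame

open Polynomial

variable {A : SpP p d} (D : EigenFrame A)

/-- `B` acts diagonally in the frame, with the eigenvalues `g`. -/
def Acts (B : Matrix (Fin d ⊕ Fin d) (Fin d ⊕ Fin d) (FpBar p)) (g : Fin d ⊕ Fin d → FpBar p) :
    Prop :=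
  D.P * B = diagonal g * D.P

variable {D} in
theorem Acts.mul {B C : Matrix (Fin d ⊕ Fin d) (Fin d ⊕ Fin d) (FpBar p)} {g h}
    (hB : D.Acts B g) (hC : D.Acts C h) : D.Acts (B * C) (fun i => g i * h i) := by
  rw [Acts, ← Matrix.mul_assoc, hB, Matrix.mul_assoc, hC, ← Matrix.mul_assoc, diagonal_mul_diagonal]

theorem acts_one : D.Acts 1 (fun _ => 1) := by
  rw [Acts, diagonal_one, Matrix.mul_one, Matrix.one_mul]

theorem acts_aeval_bar (h : Polynomial (FpBar p)) :
    D.Acts (aeval (toBar A.1) h) fun i => eval (D.x i) h := by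
  induction h using Polynomial.induction_on' with
  | add f g hf hg =>
    rw [Acts] at *
    rw [map_add, Matrix.mul_add, hf, hg, ← Matrix.add_mul, diagonal_add]
    simp
  | monomial n a =>
    induction n with
    | zero =>
      rw [monomial_zero_left, aeval_C, Acts, Algebra.algebraMap_eq_smul_one, Matrix.mul_smul,
        Matrix.mul_one]
      simp only [eval_C]
      rw [← smul_one_eq_diagonal, Matrix.smul_mul, Matrix.one_mul]
    | succ n ih =>
      rw [← monomial_mul_X, map_mul, aeval_X]
      simpa [pow_succ, ← mul_assoc] using ih.mul (C := toBar A.1) D.mul_eq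

theorem acts_aeval (h : Polynomial (ZMod p)) :
    D.Acts (toBar (aeval A.1 h)) fun i => aeval (D.x i) h := by
  have := D.acts_aeval_bar (h.map (algebraMap (ZMod p) (FpBar p)))
  rw [aeval_map_algebraMap] at this
  rw [toBar_aeval]
  simpa [eval_map_algebraMap] using this

variable {D} in
theorem Acts.unique {B C : Matrix (Fin d ⊕ Fin d) (Fin d ⊕ Fin d) (FpBar p)} {g}
    (hB : D.Acts B g) (hC : D.Acts C g) : B = C :=
  D.isUnit.mul_left_cancel (hB.trans hC.symm)

variable {D} in
theorem Acts.unique' {B : Matrix (Fin d ⊕ Fin d) (Fin d ⊕ Fin d) (FpBar p)} {g h}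
    (hB : D.Acts B g) (hC : D.Acts B h) : g = h :=
  diagonal_injective (D.isUnit.mul_right_cancel (hB.symm.trans hC))

/-- Since `A` is diagonalizable over the closure, a polynomial in `A` is known by its values on the
spectrum. Identities in the Hecke group thereby become identities between eigenvalues. -/
theorem aeval_eq_iff (h k : Polynomial (ZMod p)) :
    aeval A.1 h = aeval A.1 k ↔ ∀ i, aeval (D.x i) h = aeval (D.x i) k := by
  constructor
  · intro he i
    exact congrFun ((D.acts_aeval h).unique' (he ▸ D.acts_aeval k)) i
  · intro he
    apply toBar_injective
    refine (D.acts_aeval h).unique ?_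
    rw [funext he]
    exact D.acts_aeval k

/-- The commutant of a matrix with distinct eigenvalues consists of its polynomials. -/
theorem exists_aeval_eq (D : EigenFrame A) {B : Matrix (Fin d ⊕ Fin d) (Fin d ⊕ Fin d) (ZMod p)}
    (hB : A.1 * B = B * A.1) : ∃ h : Polynomial (ZMod p), aeval A.1 h = B := by
  obtain ⟨Q, hQ⟩ := D.isUnit.exists_right_inv
  have hQ' : Q * D.P = 1 := mul_eq_one_comm.1 hQ
  set M := D.P * toBar B * Q with hM
  -- Commuting with a diagonal matrix with distinct entries forces `M` to be diagonal.
  have hcomm : diagonal D.x * M = M * diagonal D.x := by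
    have h1 : toBar A.1 * Q = Q * diagonal D.x := by
      calc _ = Q * (D.P * toBar A.1) * Q := by rw [← Matrix.mul_assoc Q, hQ', Matrix.one_mul]
        _ = _ := by rw [D.mul_eq, Matrix.mul_assoc, Matrix.mul_assoc, hQ, Matrix.mul_one]
    have h2 : toBar A.1 * toBar B = toBar B * toBar A.1 := by rw [← toBar_mul, hB, toBar_mul]
    rw [hM, ← Matrix.mul_assoc, ← Matrix.mul_assoc, ← D.mul_eq, Matrix.mul_assoc D.P, h2,
      Matrix.mul_assoc _ Q, ← h1]
    simp only [Matrix.mul_assoc]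
  have hdiag : M = diagonal fun i => M i i := by
    ext i j
    by_cases hij : i = j
    · subst hij; simp
    · rw [diagonal_apply_ne _ hij]
      have h1 := congrFun (congrFun hcomm i) j
      rw [diagonal_mul, mul_diagonal, mul_comm, ← sub_eq_zero, ← mul_sub] at h1
      exact (mul_eq_zero.1 h1).resolve_right (sub_ne_zero.2 fun h => hij (D.injective h))
  have hact : D.Acts (toBar B) fun i => M i i := by
    rw [Acts, ← hdiag, hM, Matrix.mul_assoc, hQ', Matrix.mul_one]
  let hL := Lagrange.interpolate Finset.univ D.x fun i => M i i
  have hLact := D.acts_aeval_bar hL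
  have hev : (fun i => eval (D.x i) hL) = fun i => M i i :=
    funext fun i => Lagrange.eval_interpolate_at_node _ D.injective.injOn (Finset.mem_univ i)
  rw [hev] at hLact
  have hBL : toBar B = aeval (toBar A.1) hL := hact.unique hLact
  -- The interpolating polynomial has coefficients in the closure. An `𝔽_p`-linear retraction onto
  -- `𝔽_p`, applied to the coefficients, still represents `B`, because `B` and all powers of `A`
  -- have entries in `𝔽_p`.
  obtain ⟨r, hr⟩ := LinearMap.exists_leftInverse_of_injective
    (Algebra.linearMap (ZMod p) (FpBar p))
    (LinearMap.ker_eq_bot.2 (algebraMap (ZMod p) (FpBar p)).injective)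
  refine ⟨∑ k ∈ Finset.range (hL.natDegree + 1), monomial k (r (hL.coeff k)), ?_⟩
  ext i j
  have h1 := congrArg r (congrFun (congrFun hBL i) j)
  have h2 : ∀ (a : FpBar p) (b : ZMod p), r (a * algebraMap (ZMod p) (FpBar p) b) = r a * b := by
    intro a b
    rw [mul_comm, ← Algebra.smul_def, map_smul, smul_eq_mul, mul_comm]
  have h3 : r (toBar B i j) = B i j := LinearMap.congr_fun hr (B i j)
  have h4 : ∀ k, (toBar A.1 ^ k) = toBar (A.1 ^ k) := fun k =>
    (map_pow (algebraMap (ZMod p) (FpBar p)).mapMatrix A.1 k).symm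
  rw [h3, aeval_eq_sum_range, Matrix.sum_apply, map_sum] at h1
  rw [h1, map_sum, Matrix.sum_apply]
  refine Finset.sum_congr rfl fun k _ => ?_
  rw [aeval_monomial, Matrix.smul_apply, smul_eq_mul, h4, toBar, Matrix.map_apply, h2,
    ← Algebra.smul_def, Matrix.smul_apply, smul_eq_mul]

/-! ### The symplectic form in the frame -/

/-- The Gram matrix of the form in the frame. -/
def gram : Matrix (Fin d ⊕ Fin d) (Fin d ⊕ Fin d) (FpBar p) :=
  D.P * toBar (J (Fin d) (ZMod p)) * D.Pᵀ

theorem isUnit_gram : IsUnit D.gram := by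
  have h1 : IsUnit (toBar (J (Fin d) (ZMod p))) := by
    have : J (Fin d) (ZMod p) * (-J (Fin d) (ZMod p)) = 1 := by
      rw [Matrix.mul_neg, J_squared, neg_neg]
    have h2 := congrArg toBar this
    rw [toBar_mul, toBar_one] at h2
    exact IsUnit.of_mul_eq_one _ h2
  exact (D.isUnit.mul h1).mul ((isUnit_transpose _).2 D.isUnit)

theorem gram_diag (i) : D.gram i i = 0 := by
  have h : ∀ v : Fin d ⊕ Fin d → FpBar p, v ⬝ᵥ (toBar (J (Fin d) (ZMod p)) *ᵥ v) = 0 := by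
    intro v
    have h1 : toBar (J (Fin d) (ZMod p)) = J (Fin d) (FpBar p) := by
      ext (i | i) (j | j) <;> simp [toBar, J, Matrix.one_apply, apply_ite]
    rw [h1, J, fromBlocks_mulVec]
    simp only [dotProduct, Fintype.sum_sum_type, zero_mulVec, neg_mulVec, one_mulVec, zero_add,
      add_zero, Sum.elim_inl, Sum.elim_inr, Pi.neg_apply, Function.comp_apply]
    rw [← Finset.sum_add_distrib]
    exact Finset.sum_eq_zero fun _ _ => by ring
  rw [← h (D.P i), gram, Matrix.mul_assoc]
  rfl

variable {D} in
theorem Acts.gram_eq {B C : Matrix (Fin d ⊕ Fin d) (Fin d ⊕ Fin d) (ZMod p)} {g h}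
    (hB : D.Acts (toBar B) g) (hC : D.Acts (toBar C) h) :
    D.P * toBar (B * J (Fin d) (ZMod p) * Cᵀ) * D.Pᵀ = diagonal g * D.gram * diagonal h := by
  have h1 := congrArg transpose hC
  rw [transpose_mul, transpose_mul, diagonal_transpose] at h1
  rw [toBar_mul, toBar_mul, toBar_transpose, gram, ← Matrix.mul_assoc, ← Matrix.mul_assoc, hB,
    Matrix.mul_assoc _ _ D.Pᵀ, h1]
  simp only [Matrix.mul_assoc]

theorem sandwich_injective {B C : Matrix (Fin d ⊕ Fin d) (Fin d ⊕ Fin d) (ZMod p)}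
    (h : D.P * toBar B * D.Pᵀ = D.P * toBar C * D.Pᵀ) : B = C :=
  toBar_injective (D.isUnit.mul_left_cancel (((isUnit_transpose _).2 D.isUnit).mul_right_cancel h))

/-- Invariance of the form under `A` multiplies the entry by `x i * x j`. Since the Gram matrix is
invertible, the spectrum is then closed under inversion. -/
theorem mul_eq_one_of_gram_ne {i j} (h : D.gram i j ≠ 0) : D.x i * D.x j = 1 := by
  have h1 := Acts.gram_eq (D := D) D.mul_eq D.mul_eq
  rw [SymplecticGroup.mem_iff.1 A.2] at h1
  have h2 := congrFun (congrFun h1 i) j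
  rw [mul_diagonal, diagonal_mul] at h2
  change D.gram i j = _ at h2
  apply mul_right_cancel₀ h
  linear_combination -h2

theorem exists_gram_ne (i) : ∃ j, D.gram i j ≠ 0 := by
  by_contra! h
  obtain ⟨R, hR⟩ := D.isUnit_gram.exists_right_inv
  have := congrFun (congrFun hR i) i
  simp [Matrix.mul_apply, h] at this

theorem exists_inv (i) : ∃ j, D.gram i j ≠ 0 ∧ D.x j = (D.x i)⁻¹ := by
  obtain ⟨j, hj⟩ := D.exists_gram_ne i
  exact ⟨j, hj, eq_inv_of_mul_eq_one_right (D.mul_eq_one_of_gram_ne hj)⟩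

/-- The form is alternating, so the partner of an eigenvector is a different one, and the
eigenvalues are distinct. In particular `1` and `-1` do not occur. -/
theorem inv_ne_self (i) : (D.x i)⁻¹ ≠ D.x i := by
  obtain ⟨j, hj, hx⟩ := D.exists_inv i
  intro h
  rw [← hx] at h
  exact hj (D.injective h ▸ D.gram_diag _)

theorem gram_ne_zero_iff {i j} : D.gram i j ≠ 0 ↔ D.x j = (D.x i)⁻¹ := by
  constructor
  · intro h; exact eq_inv_of_mul_eq_one_right (D.mul_eq_one_of_gram_ne h)
  · intro h
    obtain ⟨k, hk, hx⟩ := D.exists_inv i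
    rwa [D.injective (h.trans hx.symm)]

/-- In the frame the form pairs only inverse eigenvalues, so its transforms by simultaneously
diagonal maps are compared on those pairs alone. -/
theorem form_eq_iff {B C B' C' : Matrix (Fin d ⊕ Fin d) (Fin d ⊕ Fin d) (ZMod p)} {g h g' h'}
    (hB : D.Acts (toBar B) g) (hC : D.Acts (toBar C) h) (hB' : D.Acts (toBar B') g')
    (hC' : D.Acts (toBar C') h') :
    B * J (Fin d) (ZMod p) * Cᵀ = B' * J (Fin d) (ZMod p) * C'ᵀ ↔
      ∀ i j, D.x j = (D.x i)⁻¹ → g i * h j = g' i * h' j := by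
  constructor
  · intro he i j hij
    have h1 := (hB.gram_eq hC).symm.trans ((congrArg (fun X => D.P * toBar X * D.Pᵀ) he).trans
      (hB'.gram_eq hC'))
    have h2 := congrFun (congrFun h1 i) j
    rw [mul_diagonal, diagonal_mul, mul_diagonal, diagonal_mul] at h2
    apply mul_right_cancel₀ (D.gram_ne_zero_iff.2 hij)
    linear_combination h2
  · intro he
    apply D.sandwich_injective
    rw [hB.gram_eq hC, hB'.gram_eq hC']
    ext i j
    rw [mul_diagonal, diagonal_mul, mul_diagonal, diagonal_mul]
    by_cases h0 : D.gram i j = 0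
    · simp [h0]
    · linear_combination D.gram i j * he i j (D.gram_ne_zero_iff.1 h0)

theorem aeval_mem_symplecticGroup_iff (h : Polynomial (ZMod p)) :
    aeval A.1 h ∈ symplecticGroup (Fin d) (ZMod p) ↔
      ∀ i, aeval (D.x i) h * aeval (D.x i)⁻¹ h = 1 := by
  have h1 : D.Acts (toBar 1) fun _ => 1 := by rw [toBar_one]; exact D.acts_one
  have h2 := D.form_eq_iff (D.acts_aeval h) (D.acts_aeval h) h1 h1
  rw [SymplecticGroup.mem_iff]
  rw [Matrix.one_mul, transpose_one, Matrix.mul_one] at h2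
  rw [h2]
  constructor
  · intro h3 i
    obtain ⟨j, -, hj⟩ := D.exists_inv i
    rw [← hj, h3 i j hj, one_mul]
  · intro h3 i j hj
    rw [hj, h3, one_mul]

end EigenFrame

end

section

variable {p : ℕ} [Fact p.Prime] {d : ℕ}

/-! ### Orbits -/

theorem mem_galOrbit_self (x : FpBar p) : x ∈ galOrbit p x := MulAction.mem_orbit_self x

theorem mem_galOrbit_iff {x y : FpBar p} :
    y ∈ galOrbit p x ↔ ∃ σ : FpBar p ≃ₐ[ZMod p] FpBar p, σ x = y := Iff.rfl

theorem galOrbit_eq_of_mem {x y : FpBar p} (h : y ∈ galOrbit p x) : galOrbit p y = galOrbit p x :=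
  MulAction.orbit_eq_iff.2 h

theorem apply_mem_galOrbit {x y : FpBar p} (h : y ∈ galOrbit p x)
    (σ : FpBar p ≃ₐ[ZMod p] FpBar p) : σ y ∈ galOrbit p x := by
  rw [← galOrbit_eq_of_mem h]
  exact ⟨σ, rfl⟩

theorem inv_mem_galOrbit_inv {x y : FpBar p} (h : y ∈ galOrbit p x) : y⁻¹ ∈ galOrbit p x⁻¹ := by
  obtain ⟨σ, rfl⟩ := mem_galOrbit_iff.1 h
  exact mem_galOrbit_iff.2 ⟨σ, map_inv₀ σ x⟩

theorem mem_sympOrbit_self (x : FpBar p) : x ∈ sympOrbit p x := Or.inl (mem_galOrbit_self x)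

theorem sympOrbit_inv (x : FpBar p) : sympOrbit p x⁻¹ = sympOrbit p x := by
  rw [sympOrbit, sympOrbit, inv_inv, Set.union_comm]

theorem sympOrbit_eq_of_mem {x y : FpBar p} (h : y ∈ sympOrbit p x) :
    sympOrbit p y = sympOrbit p x := by
  have key : ∀ {x y : FpBar p}, y ∈ galOrbit p x → sympOrbit p y = sympOrbit p x := by
    intro x y h
    rw [sympOrbit, sympOrbit, galOrbit_eq_of_mem h, galOrbit_eq_of_mem (inv_mem_galOrbit_inv h)]
  rcases h with h | h
  · exact key h
  · rw [key h, sympOrbit_inv]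

theorem apply_mem_sympOrbit {x y : FpBar p} (h : y ∈ sympOrbit p x)
    (σ : FpBar p ≃ₐ[ZMod p] FpBar p) : σ y ∈ sympOrbit p x := by
  rw [← sympOrbit_eq_of_mem h]
  exact Or.inl ⟨σ, rfl⟩

/-- Normality of the closure makes conjugates of `x` and roots of its minimal polynomial the same
thing. Finiteness follows, and by separability the size of the orbit is the degree. -/
theorem galOrbit_eq_rootSet (x : FpBar p) :
    galOrbit p x = (minpoly (ZMod p) x).rootSet (FpBar p) := by
  ext y
  rw [galOrbit, ← Normal.minpoly_eq_iff_mem_orbit, Polynomial.mem_rootSet_of_ne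
    (minpoly.ne_zero (Algebra.IsIntegral.isIntegral x))]
  constructor
  · intro h; rw [← h]; exact minpoly.aeval _ _
  · intro h
    exact (minpoly.eq_of_irreducible_of_monic
      (minpoly.irreducible (Algebra.IsIntegral.isIntegral x)) h
      (minpoly.monic (Algebra.IsIntegral.isIntegral x))).symm

theorem ncard_galOrbit (x : FpBar p) :
    (galOrbit p x).ncard = (minpoly (ZMod p) x).natDegree := by
  rw [galOrbit_eq_rootSet, ← Nat.card_coe_set_eq, Nat.card_eq_fintype_card,
    Polynomial.card_rootSet_eq_natDegree (Algebra.IsSeparable.isSeparable (ZMod p) x)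
      (IsAlgClosed.splits _)]

theorem finite_galOrbit (x : FpBar p) : (galOrbit p x).Finite := by
  rw [galOrbit_eq_rootSet]; exact Polynomial.rootSet_finite _ _

theorem ncard_galOrbit_inv (x : FpBar p) : (galOrbit p x⁻¹).ncard = (galOrbit p x).ncard := by
  have : galOrbit p x⁻¹ = (fun y => y⁻¹) '' galOrbit p x := by
    ext y
    constructor
    · intro h
      exact ⟨y⁻¹, by simpa using inv_mem_galOrbit_inv h, inv_inv y⟩
    · rintro ⟨z, hz, rfl⟩
      exact inv_mem_galOrbit_inv hz
  rw [this, Set.ncard_image_of_injective _ inv_injective]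

theorem aeval_apply_algEquiv (σ : FpBar p ≃ₐ[ZMod p] FpBar p) (y : FpBar p) (h : Polynomial (ZMod p)) :
    Polynomial.aeval (σ y) h = σ (Polynomial.aeval y h) :=
  Polynomial.aeval_algHom_apply σ.toAlgHom y h

/-- Interpolation of Galois equivariant functions by polynomials over the prime field. -/
theorem exists_aeval_eq_of_equivariant (S : Finset (FpBar p)) (f : FpBar p → FpBar p)
    (hS : ∀ σ : FpBar p ≃ₐ[ZMod p] FpBar p, ∀ y ∈ S, σ y ∈ S)
    (hf : ∀ σ : FpBar p ≃ₐ[ZMod p] FpBar p, ∀ y ∈ S, f (σ y) = σ (f y)) :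
    ∃ h : Polynomial (ZMod p), ∀ y ∈ S, Polynomial.aeval y h = f y := by
  classical
  set H := Lagrange.interpolate S id f
  have hH : ∀ y ∈ S, Polynomial.eval y H = f y := fun y hy =>
    Lagrange.eval_interpolate_at_node f Function.injective_id.injOn hy
  -- The conjugate polynomial interpolates the same equivariant data, so uniqueness of interpolation
  -- fixes it, and Galois theory puts the coefficients in the prime field.
  have hfix : ∀ σ : FpBar p ≃ₐ[ZMod p] FpBar p, H.map (σ : FpBar p →+* FpBar p) = H := by
    intro σ
    refine Lagrange.eq_interpolate_of_eval_eq f Function.injective_id.injOn ?_ ?_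
    · exact lt_of_le_of_lt Polynomial.degree_map_le
        (Lagrange.degree_interpolate_lt f Function.injective_id.injOn)
    · intro y hy
      have h1 : σ (σ.symm y) = y := σ.apply_symm_apply y
      have h2 : Polynomial.eval ((σ : FpBar p →+* FpBar p) (σ.symm y))
          (H.map (σ : FpBar p →+* FpBar p)) = σ (Polynomial.eval (σ.symm y) H) := by
        rw [Polynomial.eval_map_apply]; rfl
      rw [hH _ (hS σ.symm y hy), ← hf σ _ (hS σ.symm y hy), h1] at h2
      rw [← h2]
      exact congrArg (fun z => Polynomial.eval z _) h1.symm
  have hc : ∀ k, ∃ c : ZMod p, algebraMap (ZMod p) (FpBar p) c = H.coeff k := by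
    intro k
    have : H.coeff k ∈ (⊥ : IntermediateField (ZMod p) (FpBar p)) := by
      rw [InfiniteGalois.mem_bot_iff_fixed]
      intro σ
      have := congrArg (fun q => Polynomial.coeff q k) (hfix σ)
      simpa using this
    exact IntermediateField.mem_bot.1 this
  choose c hc using hc
  refine ⟨∑ k ∈ Finset.range (H.natDegree + 1), Polynomial.monomial k (c k), fun y hy => ?_⟩
  rw [← hH y hy, Polynomial.eval_eq_sum_range, map_sum]
  refine Finset.sum_congr rfl fun k _ => ?_
  rw [Polynomial.aeval_monomial, hc]

namespace EigenFrame

open Polynomial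

variable {A : SpP p d} (D : EigenFrame A)

theorem exists_apply (σ : FpBar p ≃ₐ[ZMod p] FpBar p) (i) : ∃ j, D.x j = σ (D.x i) := by
  rw [← D.mem_iff, eigenvaluesP, mem_aroots, aeval_apply_algEquiv]
  have h := (D.mem_iff (D.x i)).2 ⟨i, rfl⟩
  rw [eigenvaluesP, mem_aroots] at h
  exact ⟨h.1, by rw [h.2, map_zero]⟩

open Classical in
/-- Interpolation on the eigenvalues. -/
theorem exists_aeval_x (f : FpBar p → FpBar p)
    (hf : ∀ σ : FpBar p ≃ₐ[ZMod p] FpBar p, ∀ i, f (σ (D.x i)) = σ (f (D.x i))) :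
    ∃ h : Polynomial (ZMod p), ∀ i, aeval (D.x i) h = f (D.x i) := by
  obtain ⟨h, hh⟩ := exists_aeval_eq_of_equivariant (Finset.univ.image D.x) f
    (by
      intro σ y hy
      obtain ⟨i, -, rfl⟩ := Finset.mem_image.1 hy
      obtain ⟨j, hj⟩ := D.exists_apply σ i
      exact Finset.mem_image.2 ⟨j, Finset.mem_univ _, hj⟩)
    (by
      intro σ y hy
      obtain ⟨i, -, rfl⟩ := Finset.mem_image.1 hy
      exact hf σ i)
  exact ⟨h, fun i => hh _ (Finset.mem_image_of_mem _ (Finset.mem_univ i))⟩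

theorem exists_aeval_of_hecke (D : EigenFrame A) (B : heckeGroup A) :
    ∃ h : Polynomial (ZMod p), aeval A.1 h = B.1.1 :=
  D.exists_aeval_eq (SympDecomposition.heckeGroup_comm B)

theorem hecke_mul_comm (D : EigenFrame A) (B C : heckeGroup A) : B * C = C * B := by
  obtain ⟨h, hh⟩ := D.exists_aeval_of_hecke B
  obtain ⟨k, hk⟩ := D.exists_aeval_of_hecke C
  apply Subtype.ext
  apply Subtype.ext
  change B.1.1 * C.1.1 = C.1.1 * B.1.1
  rw [← hh, ← hk, ← map_mul, mul_comm, map_mul]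

theorem aeval_mul_inv_eq_one {h : Polynomial (ZMod p)} {B : SpP p d} (hh : aeval A.1 h = B.1)
    (i) : aeval (D.x i) h * aeval (D.x i)⁻¹ h = 1 :=
  (D.aeval_mem_symplecticGroup_iff h).1 (hh ▸ B.2) i

/-- In characteristic `p` the Frobenius is injective, so there are no nontrivial `p`-th roots of
unity. -/
theorem aeval_eq_one_of_pow {h : Polynomial (ZMod p)} {y : FpBar p}
    (hy : aeval y h ^ p = 1) : aeval y h = 1 := by
  have : (aeval y h - 1) ^ p = 0 := by rw [sub_pow_char, hy, one_pow, sub_self]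
  exact sub_eq_zero.1 (pow_eq_zero_iff (Fact.out : p.Prime).ne_zero |>.1 this)

/-- The Hecke group has no `p`-torsion. -/
theorem hecke_eq_one_of_pow (D : EigenFrame A) {B : heckeGroup A} (hB : B ^ p = 1) : B = 1 := by
  obtain ⟨h, hh⟩ := D.exists_aeval_of_hecke B
  have h1 : aeval A.1 (h ^ p) = aeval A.1 (1 : Polynomial (ZMod p)) := by
    rw [map_pow, hh, map_one]
    exact congrArg (fun X : heckeGroup A => X.1.1) hB
  rw [D.aeval_eq_iff] at h1
  apply Subtype.ext
  apply Subtype.ext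
  change B.1.1 = 1
  rw [← hh, ← map_one (aeval (R := ZMod p) A.1), D.aeval_eq_iff]
  intro i
  rw [map_one]
  exact aeval_eq_one_of_pow (by rw [← map_pow, h1, map_one])

/-- By Cauchy's theorem. This coprimality disposes of every character of exponent `p` on the Hecke
group. -/
theorem coprime_card_hecke (D : EigenFrame A) : Nat.Coprime p (Nat.card (heckeGroup A)) := by
  rw [Nat.Prime.coprime_iff_not_dvd Fact.out]
  intro h
  obtain ⟨B, hB⟩ := exists_prime_orderOf_dvd_card' p h
  have h1 := D.hecke_eq_one_of_pow (orderOf_dvd_iff_pow_eq_one.1 hB.dvd)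
  rw [h1, orderOf_one] at hB
  exact (Fact.out : p.Prime).one_lt.ne hB

/-- Characters of the Hecke group of exponent `p` are trivial. -/
theorem hecke_char_eq_one (D : EigenFrame A) {M : Type*} [CommGroup M] {f : heckeGroup A →* M}
    (hf : ∀ B, f B ^ p = 1) (B) : f B = 1 := by
  have h1 : f B ^ Nat.card (heckeGroup A) = 1 := by rw [← map_pow, pow_card_eq_one', map_one]
  have h2 := Nat.dvd_gcd (orderOf_dvd_of_pow_eq_one (hf B)) (orderOf_dvd_of_pow_eq_one h1)
  rw [D.coprime_card_hecke] at h2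
  exact orderOf_eq_one_iff.1 (Nat.dvd_one.1 h2)

variable {D} in
-- The value at `x i₀` determines the value at its inverse by the symplectic condition, and those at
-- all conjugates of both by Galois equivariance; this exhausts a single orbit.
theorem hecke_eq_one_of_aeval {i₀} (hS : ∀ i, D.x i ∈ sympOrbit p (D.x i₀)) {B : heckeGroup A}
    {h : Polynomial (ZMod p)} (hh : aeval A.1 h = B.1.1) (h1 : aeval (D.x i₀) h = 1) : B = 1 := by
  apply Subtype.ext
  apply Subtype.ext
  change B.1.1 = 1
  rw [← hh, ← map_one (aeval (R := ZMod p) A.1), D.aeval_eq_iff]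
  intro i
  rw [map_one]
  have h2 : aeval (D.x i₀)⁻¹ h = 1 := by
    have := D.aeval_mul_inv_eq_one hh i₀
    rwa [h1, one_mul] at this
  rcases hS i with hi | hi
  · obtain ⟨σ, hσ⟩ := mem_galOrbit_iff.1 hi
    rw [← hσ, aeval_apply_algEquiv, h1, map_one]
  · obtain ⟨σ, hσ⟩ := mem_galOrbit_iff.1 hi
    rw [← hσ, aeval_apply_algEquiv, h2, map_one]

variable {D} in
/-- For one orbit the Hecke group acts freely on nonzero vectors. -/
theorem hecke_free {i₀} (hS : ∀ i, D.x i ∈ sympOrbit p (D.x i₀)) {B : heckeGroup A} {n : PhaseP p d}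
    (hn : n ᵥ* B.1.1 = n) : n = 0 ∨ B = 1 := by
  by_cases hn0 : n = 0
  · exact Or.inl hn0
  right
  obtain ⟨h, hh⟩ := D.exists_aeval_of_hecke B
  have h1 : (aeval A.1 (h - 1)).det = 0 := by
    rw [← exists_vecMul_eq_zero_iff]
    exact ⟨n, hn0, by rw [map_sub, hh, map_one, vecMul_sub, hn, vecMul_one, sub_self]⟩
  have h2 : (toBar (aeval A.1 (h - 1))).det = 0 := by
    have : (toBar (aeval A.1 (h - 1))).det = algebraMap _ _ (aeval A.1 (h - 1)).det :=
      (RingHom.map_det _ _).symm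
    rw [this, h1, map_zero]
  have h3 := congrArg Matrix.det (D.acts_aeval (h - 1))
  rw [Matrix.det_mul, Matrix.det_mul, h2, mul_zero, det_diagonal, eq_comm] at h3
  have h4 := (mul_eq_zero.1 h3).resolve_right ((isUnit_iff_isUnit_det _).1 D.isUnit).ne_zero
  obtain ⟨i, -, hi⟩ := Finset.prod_eq_zero_iff.1 h4
  -- A fixed vector gives some eigenvalue `h (x i) = 1`; any eigenvalue of the single orbit can
  -- serve as base point.
  refine hecke_eq_one_of_aeval (D := D) (i₀ := i) (fun j => ?_) hh ?_
  · rw [sympOrbit_eq_of_mem (hS i)]; exact hS j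
  · rw [map_sub, map_one, sub_eq_zero] at hi; exact hi

theorem aeval_mem_heckeGroup {h : Polynomial (ZMod p)}
    (hsp : aeval A.1 h ∈ symplecticGroup (Fin d) (ZMod p)) :
    (⟨aeval A.1 h, hsp⟩ : SpP p d) ∈ heckeGroup A := by
  rw [Subgroup.mem_centralizer_singleton_iff]
  apply Subtype.ext
  change aeval A.1 h * A.1 = A.1 * aeval A.1 h
  have h1 : aeval A.1 (h * X) = aeval A.1 (X * h) := by rw [mul_comm]
  rwa [map_mul, map_mul, aeval_X] at h1

/-! ### The order of the Hecke group of one orbit -/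

theorem aeval_mem_adjoin_simple (y : FpBar p) (h : Polynomial (ZMod p)) :
    aeval y h ∈ IntermediateField.adjoin (ZMod p) {y} := by
  have := (aeval (⟨y, IntermediateField.mem_adjoin_simple_self _ y⟩ :
    IntermediateField.adjoin (ZMod p) {y}) h).2
  rwa [← IntermediateField.aeval_coe] at this

open IntermediateField in
/-- The eigenvalue of a Hecke matrix at `x i₀`, as an element of `𝔽_p(x i₀)`. -/
theorem exists_evalHom (D : EigenFrame A) (i₀) :
    ∃ f : heckeGroup A →* ((ZMod p)⟮D.x i₀⟯)ˣ, ∀ (B : heckeGroup A) (h : Polynomial (ZMod p)),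
      aeval A.1 h = B.1.1 → ((f B : (ZMod p)⟮D.x i₀⟯) : FpBar p) = aeval (D.x i₀) h := by
  choose H hH using D.exists_aeval_of_hecke
  have hmem : ∀ h : Polynomial (ZMod p), aeval (D.x i₀) h ∈ (ZMod p)⟮D.x i₀⟯ := fun h =>
    aeval_mem_adjoin_simple _ h
  have hinv : ∀ i, ∃ j, D.x j = (D.x i)⁻¹ := fun i => (D.exists_inv i).imp fun _ h => h.2
  have hone : aeval (D.x i₀) (H 1) = 1 := by
    have h1 : aeval A.1 (H 1) = aeval A.1 (1 : Polynomial (ZMod p)) := by rw [hH, map_one]; rfl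
    rw [(D.aeval_eq_iff _ _).1 h1, map_one]
  have hmul : ∀ B C, aeval (D.x i₀) (H (B * C)) = aeval (D.x i₀) (H B) * aeval (D.x i₀) (H C) := by
    intro B C
    have h1 : aeval A.1 (H (B * C)) = aeval A.1 (H B * H C) := by rw [map_mul, hH, hH, hH]; rfl
    rw [(D.aeval_eq_iff _ _).1 h1, map_mul]
  let f : heckeGroup A →* (ZMod p)⟮D.x i₀⟯ :=
    { toFun := fun B => ⟨aeval (D.x i₀) (H B), hmem _⟩
      map_one' := Subtype.ext hone
      map_mul' := fun B C => Subtype.ext (hmul B C) }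
  refine ⟨f.toHomUnits, fun B h hh => ?_⟩
  exact (D.aeval_eq_iff _ _).1 ((hH B).trans hh.symm) i₀

variable {D} in
theorem ncard_sympOrbit {i₀} (hS : ∀ i, D.x i ∈ sympOrbit p (D.x i₀)) :
    (sympOrbit p (D.x i₀)).ncard = 2 * d := by
  have h1 : sympOrbit p (D.x i₀) = Set.range D.x := by
    ext y
    constructor
    · rintro (h | h)
      · obtain ⟨σ, rfl⟩ := mem_galOrbit_iff.1 h
        exact D.exists_apply σ i₀
      · obtain ⟨σ, rfl⟩ := mem_galOrbit_iff.1 h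
        obtain ⟨j, -, hj⟩ := D.exists_inv i₀
        rw [← hj]
        exact D.exists_apply σ j
    · rintro ⟨i, rfl⟩
      exact hS i
  rw [h1, ← Set.image_univ, Set.ncard_image_of_injective _ D.injective, Set.ncard_univ,
    Nat.card_eq_fintype_card, Fintype.card_sum, Fintype.card_fin]
  ring

open IntermediateField

theorem exists_aeval_of_mem_adjoin {y z : FpBar p} (h : z ∈ (ZMod p)⟮y⟯) :
    ∃ g : Polynomial (ZMod p), aeval y g = z := by
  rw [← mem_toSubalgebra, adjoin_simple_toSubalgebra_of_isAlgebraic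
    (Algebra.IsAlgebraic.isAlgebraic y), Algebra.adjoin_singleton_eq_range_aeval] at h
  exact h

instance instFiniteAdjoinSimple (y : FpBar p) : FiniteDimensional (ZMod p) (ZMod p)⟮y⟯ :=
  adjoin.finiteDimensional (Algebra.IsIntegral.isIntegral y)

instance instFiniteAdjoin (y : FpBar p) : Finite (ZMod p)⟮y⟯ :=
  Module.finite_of_finite (ZMod p)

theorem natCard_adjoin (y : FpBar p) : Nat.card (ZMod p)⟮y⟯ = p ^ (galOrbit p y).ncard := by
  rw [Module.natCard_eq_pow_finrank (K := ZMod p), Nat.card_zmod,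
    adjoin.finrank (Algebra.IsIntegral.isIntegral y), ncard_galOrbit]

theorem natCard_adjoin_units (y : FpBar p) :
    Nat.card ((ZMod p)⟮y⟯)ˣ = p ^ (galOrbit p y).ncard - 1 := by
  rw [Nat.card_units, natCard_adjoin]

variable {D} in
/-- The order of the Hecke group of a nonsymmetric orbit. -/
theorem card_hecke_nonsymmetric {i₀} (hS : ∀ i, D.x i ∈ sympOrbit p (D.x i₀))
    (hns : (D.x i₀)⁻¹ ∉ galOrbit p (D.x i₀)) : Nat.card (heckeGroup A) = p ^ d - 1 := by
  classical
  obtain ⟨f, hf⟩ := D.exists_evalHom i₀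
  have hdisj : Disjoint (galOrbit p (D.x i₀)) (galOrbit p (D.x i₀)⁻¹) := by
    rw [Set.disjoint_left]
    intro y h1 h2
    apply hns
    rw [← galOrbit_eq_of_mem h1, galOrbit_eq_of_mem h2]
    exact mem_galOrbit_self _
  have hd : (galOrbit p (D.x i₀)).ncard = d := by
    have h1 := ncard_sympOrbit hS
    rw [sympOrbit, Set.ncard_union_eq hdisj (finite_galOrbit _) (finite_galOrbit _),
      ncard_galOrbit_inv] at h1
    omega
  have hcard := natCard_adjoin_units (D.x i₀)
  rw [hd] at hcard
  rw [← hcard]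
  refine Nat.card_congr (Equiv.ofBijective f ⟨?_, ?_⟩)
  · rw [injective_iff_map_eq_one]
    intro B hB
    obtain ⟨h, hh⟩ := D.exists_aeval_of_hecke B
    refine hecke_eq_one_of_aeval hS hh ?_
    rw [← hf B h hh, hB]; rfl
  · intro z
    obtain ⟨g, hg⟩ := exists_aeval_of_mem_adjoin (z : (ZMod p)⟮D.x i₀⟯).2
    have hz0 : aeval (D.x i₀) g ≠ 0 := by
      rw [hg]
      exact fun h => z.ne_zero (Subtype.ext h)
    have hor : ∀ i, D.x i ∉ galOrbit p (D.x i₀) → (D.x i)⁻¹ ∈ galOrbit p (D.x i₀) := by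
      intro i hi
      have := inv_mem_galOrbit_inv ((hS i).resolve_left hi)
      rwa [inv_inv] at this
    have hiff : ∀ σ : FpBar p ≃ₐ[ZMod p] FpBar p, ∀ y,
        σ y ∈ galOrbit p (D.x i₀) ↔ y ∈ galOrbit p (D.x i₀) := by
      intro σ y
      refine ⟨fun h => ?_, fun h => apply_mem_galOrbit h σ⟩
      have := apply_mem_galOrbit h σ.symm
      rwa [σ.symm_apply_apply] at this
    -- An arbitrary nonzero value may be prescribed on one Galois orbit. The disjoint inverse orbit
    -- then receives the values that the symplectic condition dictates.
    obtain ⟨h, hh⟩ := D.exists_aeval_x (fun y => if y ∈ galOrbit p (D.x i₀) then aeval y g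
      else (aeval y⁻¹ g)⁻¹) (by
        intro σ i
        simp only [hiff]
        split_ifs
        · rw [aeval_apply_algEquiv]
        · rw [← map_inv₀ σ (D.x i), aeval_apply_algEquiv, map_inv₀])
    have hne : ∀ y ∈ galOrbit p (D.x i₀), aeval y g ≠ 0 := by
      intro y hy
      obtain ⟨σ, rfl⟩ := mem_galOrbit_iff.1 hy
      rw [aeval_apply_algEquiv]
      exact (map_ne_zero σ).2 hz0
    have hsp : aeval A.1 h ∈ symplecticGroup (Fin d) (ZMod p) := by
      rw [D.aeval_mem_symplecticGroup_iff]
      intro i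
      obtain ⟨j, -, hj⟩ := D.exists_inv i
      rw [← hj, hh, hh, hj]
      by_cases hi : D.x i ∈ galOrbit p (D.x i₀)
      · have h1 : (D.x i)⁻¹ ∉ galOrbit p (D.x i₀) := fun h1 =>
          Set.disjoint_left.1 hdisj h1 (inv_mem_galOrbit_inv hi)
        rw [if_pos hi, if_neg h1, inv_inv, mul_inv_cancel₀ (hne _ hi)]
      · rw [if_neg hi, if_pos (hor i hi), inv_mul_cancel₀ (hne _ (hor i hi))]
    refine ⟨⟨_, aeval_mem_heckeGroup hsp⟩, ?_⟩
    apply Units.ext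
    apply Subtype.ext
    rw [hf _ h rfl, hh, if_pos (mem_galOrbit_self _), hg]

/-- An automorphism that inverts a generator acts as the power of Frobenius of half the degree. -/
theorem apply_eq_pow_of_inv {y : FpBar p} (hy : y⁻¹ ≠ y) {σ : FpBar p ≃ₐ[ZMod p] FpBar p}
    (hσ : σ y = y⁻¹) {m : ℕ} (hm : (galOrbit p y).ncard = 2 * m) {z : FpBar p}
    (hz : z ∈ (ZMod p)⟮y⟯) : σ z = z ^ p ^ m := by
  let F := (ZMod p)⟮y⟯
  let τ := σ.restrictNormal F
  have hτ : ∀ w : F, ((τ w : F) : FpBar p) = σ w := fun w => σ.restrictNormal_commutes F w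
  have hmem : y ∈ F := mem_adjoin_simple_self _ y
  have hfin : Module.finrank (ZMod p) F = 2 * m := by
    rw [adjoin.finrank (Algebra.IsIntegral.isIntegral y), ← ncard_galOrbit, hm]
  -- The restriction `τ` of `σ` to the finite field is a power of Frobenius. It has order two, and a
  -- cyclic group of order `2 * m` has only the `m`-th power of its generator of that order.
  obtain ⟨⟨k, hk⟩, hkτ⟩ := (FiniteField.bijective_frobeniusAlgEquivOfAlgebraic_pow (ZMod p) F).2 τ
  simp only at hkτ
  have hpow : ∀ (j : ℕ) (w : F),
      ((FiniteField.frobeniusAlgEquivOfAlgebraic (ZMod p) F ^ j) w) = w ^ p ^ j := by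
    intro j w
    rw [AlgEquiv.coe_pow, FiniteField.coe_frobeniusAlgEquivOfAlgebraic_iterate, ZMod.card]
  have hext : ∀ α β : F ≃ₐ[ZMod p] F, α ⟨y, hmem⟩ = β ⟨y, hmem⟩ → α = β := by
    intro α β h
    ext w
    obtain ⟨g, hg⟩ := exists_aeval_of_mem_adjoin w.2
    have hw : w = aeval (⟨y, hmem⟩ : F) g := by
      apply Subtype.ext
      rw [← hg]
      exact aeval_algHom_apply F.val ⟨y, hmem⟩ g
    have : ∀ α : F ≃ₐ[ZMod p] F, α w = aeval (α ⟨y, hmem⟩) g := fun α => by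
      rw [hw]; exact (aeval_algHom_apply α.toAlgHom _ g).symm
    rw [this, this, h]
  have hτy : τ ⟨y, hmem⟩ = (⟨y, hmem⟩ : F)⁻¹ := Subtype.ext ((hτ _).trans hσ)
  have h2 : τ ^ 2 = 1 := by
    apply hext
    rw [sq, AlgEquiv.mul_apply, hτy, map_inv₀, hτy, inv_inv]
    rfl
  have h1 : τ ≠ 1 := by
    intro h
    rw [h] at hτy
    exact hy (congrArg Subtype.val hτy).symm
  rw [← hkτ, ← pow_mul] at h2
  have h3 := orderOf_dvd_of_pow_eq_one h2
  rw [FiniteField.orderOf_frobeniusAlgEquivOfAlgebraic, hfin, mul_comm k,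
    Nat.mul_dvd_mul_iff_left two_pos] at h3
  have hk0 : k ≠ 0 := by
    rintro rfl
    rw [pow_zero] at hkτ
    exact h1 hkτ.symm
  have hkm : k = m := by
    obtain ⟨c, rfl⟩ := h3
    rw [hfin] at hk
    have : c < 2 := by
      by_contra h; push Not at h
      have := Nat.mul_le_mul_left m h
      omega
    interval_cases c
    · simp at hk0
    · simp
  have h4 := hτ ⟨z, hz⟩
  rw [← hkτ, hpow, hkm] at h4
  exact h4.symm

variable {D} in
/-- The order of the Hecke group of a symmetric orbit. -/
theorem card_hecke_symmetric {i₀} (hS : ∀ i, D.x i ∈ sympOrbit p (D.x i₀))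
    (hs : (D.x i₀)⁻¹ ∈ galOrbit p (D.x i₀)) : Nat.card (heckeGroup A) = p ^ d + 1 := by
  obtain ⟨f, hf⟩ := D.exists_evalHom i₀
  have hd : (galOrbit p (D.x i₀)).ncard = 2 * d := by
    rw [← ncard_sympOrbit hS, sympOrbit, galOrbit_eq_of_mem hs, Set.union_self]
  obtain ⟨σ, hσ⟩ := mem_galOrbit_iff.1 hs
  have hσz : ∀ z ∈ (ZMod p)⟮D.x i₀⟯, σ z = z ^ p ^ d := fun z hz =>
    apply_eq_pow_of_inv (D.inv_ne_self i₀) hσ hd hz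
  have hinj : Function.Injective f := by
    rw [injective_iff_map_eq_one]
    intro B hB
    obtain ⟨h, hh⟩ := D.exists_aeval_of_hecke B
    refine hecke_eq_one_of_aeval hS hh ?_
    rw [← hf B h hh, hB]; rfl
  -- Inversion of `x i₀` is the power `p ^ d` of Frobenius, so the symplectic condition on the value
  -- `z` reads `z ^ (p ^ d + 1) = 1`.
  have hrange : f.range = (powMonoidHom (p ^ d + 1)).ker := by
    ext z
    rw [MonoidHom.mem_range, MonoidHom.mem_ker, powMonoidHom_apply]
    constructor
    · rintro ⟨B, rfl⟩
      obtain ⟨h, hh⟩ := D.exists_aeval_of_hecke B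
      apply Units.ext
      apply Subtype.ext
      have h1 := D.aeval_mul_inv_eq_one hh i₀
      rw [← hσ, aeval_apply_algEquiv, hσz _ (aeval_mem_adjoin_simple _ h), ← pow_succ'] at h1
      rw [← hf B h hh] at h1
      exact h1
    · intro hz
      obtain ⟨g, hg⟩ := exists_aeval_of_mem_adjoin (z : (ZMod p)⟮D.x i₀⟯).2
      have hz1 : ((z : (ZMod p)⟮D.x i₀⟯) : FpBar p) ^ (p ^ d + 1) = 1 :=
        congrArg (fun w : ((ZMod p)⟮D.x i₀⟯)ˣ => ((w : (ZMod p)⟮D.x i₀⟯) : FpBar p)) hz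
      have hg1 : aeval (D.x i₀) g * aeval (D.x i₀)⁻¹ g = 1 := by
        rw [← hσ, aeval_apply_algEquiv, hg, hσz _ (z : (ZMod p)⟮D.x i₀⟯).2, ← pow_succ', hz1]
      have hsp : aeval A.1 g ∈ symplecticGroup (Fin d) (ZMod p) := by
        rw [D.aeval_mem_symplecticGroup_iff]
        intro i
        have hi := hS i
        rw [sympOrbit, galOrbit_eq_of_mem hs, Set.union_self] at hi
        obtain ⟨α, hα⟩ := mem_galOrbit_iff.1 hi
        rw [← hα, ← map_inv₀, aeval_apply_algEquiv, aeval_apply_algEquiv, ← map_mul, hg1, map_one]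
      refine ⟨⟨_, aeval_mem_heckeGroup hsp⟩, ?_⟩
      apply Units.ext
      apply Subtype.ext
      rw [hf _ g rfl, hg]
  rw [← Nat.card_range_of_injective hinj]
  change Nat.card f.range = _
  -- The unit group is cyclic of order `p ^ (2 * d) - 1`, a multiple of `p ^ d + 1`.
  rw [hrange, IsCyclic.card_powMonoidHom_ker, natCard_adjoin_units, hd, Nat.gcd_eq_right]
  have : p ^ (2 * d) - 1 = (p ^ d + 1) * (p ^ d - 1) := by
    rw [mul_comm 2 d, pow_mul, ← Nat.sq_sub_sq, one_pow]
  rw [this]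
  exact Dvd.intro _ rfl

end EigenFrame

end

/-! ### Traces and determinants of quantized Hecke operators; the case of one orbit -/

section

variable {p : ℕ} [Fact p.Prime] {d : ℕ}

theorem trace_toEuclideanLin {ι : Type*} [Fintype ι] [DecidableEq ι] (M : Matrix ι ι ℂ) :
    LinearMap.trace ℂ _ (toEuclideanLin M) = M.trace := by
  rw [toEuclideanLin_eq_toLin_orthonormal, Matrix.trace_toLin_eq]

theorem toEuclideanLin_mul {ι : Type*} [Fintype ι] [DecidableEq ι] (M N : Matrix ι ι ℂ) :
    toEuclideanLin (M * N) = (toEuclideanLin M : Module.End ℂ (EuclideanSpace ℂ ι)) *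
      toEuclideanLin N := by
  ext ψ i
  simp [Matrix.toLpLin_apply]

/-- A quantization as a representation on linear maps. -/
def quantLin (U : SpP p d →* (HilbertP p d ≃ₗᵢ[ℂ] HilbertP p d)) :
    SpP p d →* Module.End ℂ (HilbertP p d) where
  toFun B := (U B).toLinearEquiv.toLinearMap
  map_one' := by rw [map_one]; rfl
  map_mul' B C := by rw [map_mul]; rfl

theorem quantLin_apply (U : SpP p d →* (HilbertP p d ≃ₗᵢ[ℂ] HilbertP p d)) (B : SpP p d)
    (ψ : HilbertP p d) : quantLin U B ψ = U B ψ := rfl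

/-- `T_p(n)` as an element of the algebra of operators. -/
abbrev elemEnd (n : PhaseP p d) : Module.End ℂ (HilbertP p d) := elemOp n

theorem IsQuantization.elemEnd_mul_quantLin {U : SpP p d →* (HilbertP p d ≃ₗᵢ[ℂ] HilbertP p d)}
    (hU : IsQuantization U) (B : SpP p d) (n : PhaseP p d) :
    elemEnd n * quantLin U B = quantLin U B * elemEnd (n ᵥ* B.1) := by
  ext1 ψ
  have h := hU B n ψ
  rw [LinearIsometryEquiv.inv_def, LinearIsometryEquiv.symm_apply_eq] at h
  exact h

theorem elemEnd_eq (n : PhaseP p d) : elemEnd n = toEuclideanLin (elemMat n) :=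
  elemOp_eq_toEuclideanLin n

theorem elemEnd_mul (hp : p ≠ 2) (m n : PhaseP p d) : elemEnd m * elemEnd n =
    ZMod.stdAddChar (N := p) (2⁻¹ * sympForm m n) • elemEnd (m + n) := by
  rw [elemEnd_eq, elemEnd_eq, elemEnd_eq, ← toEuclideanLin_mul, elemMat_mul hp, map_smul]

theorem elemEnd_trace (n : PhaseP p d) :
    LinearMap.trace ℂ _ (elemEnd n) = if n = 0 then (p : ℂ) ^ d else 0 := by
  rw [elemEnd_eq, trace_toEuclideanLin, elemMat_trace]

theorem elemEnd_twirl (hp : p ≠ 2) (X : Module.End ℂ (HilbertP p d)) :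
    ∑ n : PhaseP p d, elemEnd n * X * elemEnd (-n) =
      ((p : ℂ) ^ d * LinearMap.trace ℂ _ X) • 1 := by
  obtain ⟨M, rfl⟩ := (toEuclideanLin (𝕜 := ℂ) (m := Fin d → ZMod p) (n := Fin d → ZMod p)).surjective X
  have h := congrArg toEuclideanLin (elemMat_twirl hp M)
  simp only [map_sum, map_smul, toEuclideanLin_mul] at h
  have h1 : toEuclideanLin (1 : Matrix (Fin d → ZMod p) (Fin d → ZMod p) ℂ) =
      (1 : Module.End ℂ (HilbertP p d)) := by
    ext ψ i
    simp
  rw [trace_toEuclideanLin, ← h1, ← h]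
  simp only [elemEnd_eq]

/-- Operators commuting with all elementary operators are scalars. -/
theorem eq_smul_one_of_commute_elemEnd (hp : p ≠ 2) {X : Module.End ℂ (HilbertP p d)}
    (h : ∀ n : PhaseP p d, elemEnd n * X = X * elemEnd n) : ∃ c : ℂ, X = c • 1 := by
  have h1 := elemEnd_twirl hp X
  have h3 : ∀ n : PhaseP p d, elemEnd n * elemEnd (-n) = 1 := fun n => by
    rw [elemEnd_mul hp, sympForm_neg_right, sympForm_self, add_neg_cancel, elemEnd_eq, elemMat_zero]
    ext ψ i
    simp
  simp only [h, mul_assoc, h3, mul_one, Finset.sum_const, Finset.card_univ] at h1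
  have h2 : (Fintype.card (PhaseP p d) : ℂ) ≠ 0 := Nat.cast_ne_zero.2 Fintype.card_ne_zero
  refine ⟨(Fintype.card (PhaseP p d) : ℂ)⁻¹ * ((p : ℂ) ^ d * LinearMap.trace ℂ _ X), ?_⟩
  rw [mul_smul, ← h1, ← Nat.cast_smul_eq_nsmul ℂ, inv_smul_smul₀ h2]

/-- Twirling `U(B)` and moving it to the left yields `p^d · tr U(B) · U(B)⁻¹ = ∑ T(n B) T(-n)`. In
the trace of the right side only the fixed vectors of `B` count, that is, only `n = 0`. -/
theorem IsQuantization.trace_mul_trace (hp : p ≠ 2)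
    {U : SpP p d →* (HilbertP p d ≃ₗᵢ[ℂ] HilbertP p d)} (hU : IsQuantization U) {B : SpP p d}
    (hB : ∀ n : PhaseP p d, n ᵥ* B.1 = n → n = 0) :
    LinearMap.trace ℂ _ (quantLin U B) * LinearMap.trace ℂ _ (quantLin U B⁻¹) = 1 := by
  have h1 := elemEnd_twirl hp (quantLin U B)
  have hinv : quantLin U B⁻¹ * quantLin U B = 1 := by rw [← map_mul, inv_mul_cancel, map_one]
  have h2 : ((p : ℂ) ^ d * LinearMap.trace ℂ _ (quantLin U B)) • quantLin U B⁻¹ =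
      ∑ n : PhaseP p d, elemEnd (n ᵥ* B.1) * elemEnd (-n) := by
    have := congrArg (fun X => quantLin U B⁻¹ * X) h1
    simp only [mul_smul_comm, mul_one] at this
    rw [← this, Finset.mul_sum]
    refine Finset.sum_congr rfl fun n _ => ?_
    rw [hU.elemEnd_mul_quantLin, mul_assoc, ← mul_assoc, hinv, one_mul]
  have h3 := congrArg (LinearMap.trace ℂ _) h2
  rw [map_smul, map_sum, Finset.sum_eq_single 0] at h3
  · rw [zero_vecMul, neg_zero, elemEnd_mul hp, sympForm_self, mul_zero, AddChar.map_zero_eq_one,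
      one_smul, add_zero, elemEnd_trace, if_pos rfl, smul_eq_mul, mul_assoc] at h3
    exact mul_left_cancel₀ card_ne_zero_complex (h3.trans (mul_one _).symm)
  · intro n _ hn
    rw [elemEnd_mul hp, map_smul, elemEnd_trace, if_neg, smul_zero]
    rw [← sub_eq_add_neg, sub_eq_zero]
    exact fun h => hn (hB n h)
  · simp

/-- The determinant is a linear character of the whole symplectic group, so of exponent dividing
`p`, and such a character dies on a group of order prime to `p`. Triviality on the full group is not
needed. -/
theorem EigenFrame.det_quantLin {A : SpP p d} (D : EigenFrame A)
    (U : SpP p d →* (HilbertP p d ≃ₗᵢ[ℂ] HilbertP p d)) (B : heckeGroup A) :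
    LinearMap.det (quantLin U B.1) = 1 := by
  let f : SpP p d →* ℂˣ := (LinearMap.det.comp (quantLin U)).toHomUnits
  have h := D.hecke_char_eq_one (f := f.comp (heckeGroup A).subtype)
    (fun B => symp_monoidHom_pow_eq_one f B.1) B
  exact congrArg Units.val h

theorem mem_sympOrbits_iff {A : SpP p d} {ϑ : Set (FpBar p)} :
    ϑ ∈ sympOrbits A ↔ ∃ y ∈ eigenvaluesP A, sympOrbit p y = ϑ := by
  simp [sympOrbits]

namespace EigenFrame

open Polynomial

variable {A : SpP p d} (D : EigenFrame A)

theorem eigenvalue_mem_iff {ϑ : Set (FpBar p)} (hϑ : ϑ ∈ sympOrbits A) {y : FpBar p}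
    (hy : y ∈ ϑ) : (∃ i, D.x i = y) ∧ sympOrbit p y = ϑ := by
  obtain ⟨z, hz, rfl⟩ := mem_sympOrbits_iff.1 hϑ
  refine ⟨?_, sympOrbit_eq_of_mem hy⟩
  obtain ⟨i, rfl⟩ := (D.mem_iff z).1 hz
  rcases hy with h | h
  · obtain ⟨σ, rfl⟩ := mem_galOrbit_iff.1 h
    exact D.exists_apply σ i
  · obtain ⟨σ, rfl⟩ := mem_galOrbit_iff.1 h
    obtain ⟨j, -, hj⟩ := D.exists_inv i
    rw [← hj]
    exact D.exists_apply σ j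

theorem sympOrbit_x_mem (i) : sympOrbit p (D.x i) ∈ sympOrbits A :=
  mem_sympOrbits_iff.2 ⟨_, (D.mem_iff _).2 ⟨i, rfl⟩, rfl⟩

/-- For one orbit, `-1` is the unique involution of the Hecke group. -/
theorem exists_unique_involution (hp : p ≠ 2) {i₀} (hS : ∀ i, D.x i ∈ sympOrbit p (D.x i₀)) :
    ∃ z : heckeGroup A, z ≠ 1 ∧ ∀ B : heckeGroup A, B * B = 1 ↔ B = 1 ∨ B = z := by
  have hsp : aeval A.1 (-1 : Polynomial (ZMod p)) ∈ symplecticGroup (Fin d) (ZMod p) := by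
    rw [D.aeval_mem_symplecticGroup_iff]
    intro i
    simp
  let z : heckeGroup A := ⟨⟨_, hsp⟩, aeval_mem_heckeGroup hsp⟩
  have hzz : z * z = 1 := by
    apply Subtype.ext
    apply Subtype.ext
    change aeval A.1 (-1 : Polynomial (ZMod p)) * aeval A.1 (-1 : Polynomial (ZMod p)) = 1
    simp
  refine ⟨z, fun h => ?_, fun B => ⟨fun h => ?_, ?_⟩⟩
  · have h1 : aeval A.1 (-1 : Polynomial (ZMod p)) = aeval A.1 (1 : Polynomial (ZMod p)) := by
      rw [map_one]
      exact congrArg (fun X : heckeGroup A => X.1.1) h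
    rw [D.aeval_eq_iff] at h1
    have h2 := h1 i₀
    rw [map_neg, map_one] at h2
    have h3 : algebraMap (ZMod p) (FpBar p) 2 = 0 := by
      rw [map_ofNat]; linear_combination -h2
    exact two_ne_zero_zmod hp ((map_eq_zero _).1 h3)
  · obtain ⟨k, hk⟩ := D.exists_aeval_of_hecke B
    have h1 : aeval A.1 (k * k) = aeval A.1 (1 : Polynomial (ZMod p)) := by
      rw [map_one, map_mul, hk]
      exact congrArg (fun X : heckeGroup A => X.1.1) h
    rw [D.aeval_eq_iff] at h1
    have h2 := h1 i₀
    rw [map_mul, map_one] at h2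
    rcases mul_self_eq_one_iff.1 h2 with h3 | h3
    · exact Or.inl (hecke_eq_one_of_aeval hS hk h3)
    · right
      -- If the eigenvalue of `B` at the base point is `-1`, that of `B * z` is `1`, which
      -- determines the element.
      have h4 : B * z = 1 := by
        refine hecke_eq_one_of_aeval hS (h := k * (-1)) ?_ (by rw [map_mul, h3]; simp)
        rw [map_mul, hk]; rfl
      exact (eq_inv_of_mul_eq_one_left h4).trans (inv_eq_of_mul_eq_one_left hzz)
  · rintro (rfl | rfl)
    · exact one_mul 1
    · exact hzz

/-- The Hecke eigenspaces for one orbit. -/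
theorem one_orbit_aux (hp : p ≠ 2) {U : SpP p d →* (HilbertP p d ≃ₗᵢ[ℂ] HilbertP p d)}
    (hU : IsQuantization U) {i₀} (hS : ∀ i, D.x i ∈ sympOrbit p (D.x i₀)) {ε : ℤ}
    (hε : ε = 1 ∨ ε = -1) (hcard : (Nat.card (heckeGroup A) : ℤ) = (p : ℤ) ^ d - ε) :
    ∃ χ₂ : heckeGroup A →* ℂˣ, (∀ χ : heckeGroup A →* ℂˣ, orderOf χ = 2 ↔ χ = χ₂) ∧
      (∀ χ : heckeGroup A →* ℂˣ, χ ≠ χ₂ → Module.finrank ℂ (heckeEigenspace U A χ) = 1) ∧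
      (Module.finrank ℂ (heckeEigenspace U A χ₂) : ℤ) = 1 + ε := by
  let _ : CommGroup (heckeGroup A) :=
    { (inferInstance : Group (heckeGroup A)) with mul_comm := D.hecke_mul_comm }
  let _ : Fintype (heckeGroup A) := Fintype.ofFinite _
  obtain ⟨z, hz, hinv⟩ := D.exists_unique_involution hp hS
  refine exists_quadratic_char_finrank ((quantLin U).comp (heckeGroup A).subtype)
    (heckeEigenspace U A) (fun χ v => Iff.rfl) (fun B => D.det_quantLin U B) (fun B hB => ?_) hε ?_
    hz hinv
  · exact hU.trace_mul_trace hp fun n hn => (hecke_free hS hn).resolve_right hB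
  · rw [← Nat.card_eq_fintype_card, hcard, finrank_euclideanSpace, Fintype.card_fun, ZMod.card,
      Fintype.card_fin]
    push_cast
    rfl

end EigenFrame

theorem one_orbit (hp : p ≠ 2) {U : SpP p d →* (HilbertP p d ≃ₗᵢ[ℂ] HilbertP p d)}
    (hU : IsQuantization U) {A : SpP p d} (hA : (eigenvaluesP A).Nodup)
    {ϑ : Set (AlgebraicClosure (ZMod p))} (hϑ : sympOrbits A = {ϑ}) :
    ∃ χ₂ : heckeGroup A →* ℂˣ,
      (∀ χ : heckeGroup A →* ℂˣ, orderOf χ = 2 ↔ χ = χ₂) ∧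
      (∀ χ : heckeGroup A →* ℂˣ, χ ≠ χ₂ →
        Module.finrank ℂ (heckeEigenspace U A χ) = 1) ∧
      (IsSymmetricOrbit ϑ → Module.finrank ℂ (heckeEigenspace U A χ₂) = 0) ∧
      (¬ IsSymmetricOrbit ϑ → Module.finrank ℂ (heckeEigenspace U A χ₂) = 2) := by
  obtain ⟨D⟩ := nonempty_eigenFrame hA
  have hmem : ϑ ∈ sympOrbits A := by rw [hϑ]; exact Finset.mem_singleton_self ϑ
  have hx : ∀ i, sympOrbit p (D.x i) = ϑ := fun i => by
    have := D.sympOrbit_x_mem i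
    rwa [hϑ, Finset.mem_singleton] at this
  have hS : ∀ i₀ i, D.x i ∈ sympOrbit p (D.x i₀) := fun i₀ i => by
    rw [hx i₀, ← hx i]; exact mem_sympOrbit_self _
  by_cases hs : IsSymmetricOrbit ϑ
  · obtain ⟨y, hy, hyϑ⟩ := mem_sympOrbits_iff.1 hmem
    obtain ⟨i₀, rfl⟩ := (D.mem_iff y).1 hy
    have hc := EigenFrame.card_hecke_symmetric (hS i₀) (hs _ (by
      rw [← hyϑ]; exact mem_sympOrbit_self _))
    obtain ⟨χ₂, h1, h2, h3⟩ := D.one_orbit_aux hp hU (hS i₀) (ε := -1) (Or.inr rfl) (by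
      rw [hc]; push_cast; ring)
    refine ⟨χ₂, h1, h2, fun _ => ?_, fun h => absurd hs h⟩
    omega
  · have hs' := hs
    simp only [IsSymmetricOrbit, not_forall] at hs'
    obtain ⟨y, hy, hyn⟩ := hs'
    obtain ⟨⟨i₀, rfl⟩, -⟩ := D.eigenvalue_mem_iff hmem hy
    -- Any eigenvalue violating symmetry may be the base point, because the whole spectrum is its
    -- symplectic orbit.
    have hc := EigenFrame.card_hecke_nonsymmetric (hS i₀) hyn
    obtain ⟨χ₂, h1, h2, h3⟩ := D.one_orbit_aux hp hU (hS i₀) (ε := 1) (Or.inl rfl) (by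
      rw [hc, Nat.cast_sub (Nat.one_le_pow _ _ (Fact.out : p.Prime).pos)]; push_cast; ring)
    refine ⟨χ₂, h1, h2, fun h => absurd h hs, fun _ => ?_⟩
    exact_mod_cast h3

end

section

variable {p : ℕ} [Fact p.Prime] {d : ℕ}

/-! ### Symplectic bases -/

theorem exists_sympForm_eq {m : ℕ} (f : PhaseP p m →ₗ[ZMod p] ZMod p) :
    ∃ r : PhaseP p m, ∀ c, sympForm r c = f c := by
  refine ⟨Sum.elim (fun i => f (Pi.single (Sum.inr i) 1)) (fun i => -f (Pi.single (Sum.inl i) 1)),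
    fun c => ?_⟩
  have h : f c = ∑ i, c i * f (Pi.single i 1) := by
    conv_lhs => rw [pi_eq_sum_univ' c, map_sum]
    refine Finset.sum_congr rfl fun i _ => ?_
    rw [map_smul, smul_eq_mul]
  rw [h, Fintype.sum_sum_type, sympForm]
  simp only [dotProduct, Function.comp_apply, Sum.elim_inl, Sum.elim_inr, neg_mul,
    Finset.sum_neg_distrib, sub_neg_eq_add]
  rw [add_comm]
  simp only [mul_comm]

theorem eq_zero_of_sympForm {m : ℕ} {v : PhaseP p m} (h : ∀ w, sympForm v w = 0) : v = 0 := by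
  funext i
  rcases i with i | i
  · have := h (Pi.single (Sum.inr i) 1)
    rwa [sympForm_swap, sympForm_single_inr, neg_neg] at this
  · have := h (Pi.single (Sum.inl i) 1)
    rwa [sympForm_swap, sympForm_single_inl, neg_eq_zero] at this

theorem injective_of_sympForm {m : ℕ} {φ : PhaseP p m →ₗ[ZMod p] PhaseP p d}
    (h : ∀ x y, sympForm (φ x) (φ y) = sympForm x y) : Function.Injective φ := by
  rw [injective_iff_map_eq_zero]
  intro x hx
  refine eq_zero_of_sympForm fun w => ?_
  rw [← h, hx]
  simp [sympForm, dotProduct]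

theorem sympForm_succ {m : ℕ} (c c' : PhaseP p (m + 1)) :
    sympForm c c' = c (Sum.inl 0) * c' (Sum.inr 0) - c (Sum.inr 0) * c' (Sum.inl 0) +
      sympForm (c ∘ Sum.map Fin.succ Fin.succ) (c' ∘ Sum.map Fin.succ Fin.succ) := by
  simp only [sympForm, dotProduct, Function.comp_apply, Fin.sum_univ_succ, Sum.map_inl, Sum.map_inr]
  ring

/-- Gram–Schmidt for an alternating form: `x` is made orthogonal to the range of `φ`, a partner
pairing to one with it is found by nondegeneracy on `V` and orthogonalized likewise, and the new
hyperbolic pair is adjoined. -/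
theorem exists_symplectic_extension {V : Submodule (ZMod p) (PhaseP p d)}
    (hV : ∀ m ∈ V, (∀ n ∈ V, sympForm m n = 0) → m = 0) {m : ℕ}
    {φ : PhaseP p m →ₗ[ZMod p] PhaseP p d} (h : ∀ x y, sympForm (φ x) (φ y) = sympForm x y)
    (hφ : LinearMap.range φ ≤ V) {x : PhaseP p d} (hx : x ∈ V) (hx' : x ∉ LinearMap.range φ) :
    ∃ ψ : PhaseP p (m + 1) →ₗ[ZMod p] PhaseP p d,
      (∀ x y, sympForm (ψ x) (ψ y) = sympForm x y) ∧ LinearMap.range ψ ≤ V := by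
  have hmem : ∀ c, φ c ∈ V := fun c => hφ ⟨c, rfl⟩
  have hproj : ∀ z : PhaseP p d, ∃ r : PhaseP p m, ∀ c, sympForm (z - φ r) (φ c) = 0 := by
    intro z
    obtain ⟨r, hr⟩ := exists_sympForm_eq
      ({ toFun := fun c => sympForm z (φ c)
         map_add' := fun a b => by rw [map_add, sympForm_add_right]
         map_smul' := fun a b => by rw [map_smul, sympForm_smul_right]; rfl } :
        PhaseP p m →ₗ[ZMod p] ZMod p)
    refine ⟨r, fun c => ?_⟩
    rw [sympForm_sub_left, h, hr]
    exact sub_self _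
  obtain ⟨r, hr⟩ := hproj x
  set x' := x - φ r with hxdef
  have hx'V : x' ∈ V := V.sub_mem hx (hmem r)
  have hx'0 : x' ≠ 0 := fun h0 => hx' ⟨r, (sub_eq_zero.1 h0).symm⟩
  obtain ⟨y₀, hy₀, hne⟩ : ∃ y ∈ V, sympForm x' y ≠ 0 := by
    by_contra! hcon
    exact hx'0 (hV x' hx'V hcon)
  set y₁ := (sympForm x' y₀)⁻¹ • y₀ with hy₁
  obtain ⟨s, hs⟩ := hproj y₁
  set y' := y₁ - φ s with hydef
  have hy'V : y' ∈ V := V.sub_mem (V.smul_mem _ hy₀) (hmem s)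
  have hxy : sympForm x' y' = 1 := by
    rw [hydef, sympForm_sub_right, hr, sub_zero, hy₁, sympForm_smul_right, inv_mul_cancel₀ hne]
  have hyx : sympForm y' x' = -1 := by rw [sympForm_swap, hxy]
  have hr' : ∀ c, sympForm (φ c) x' = 0 := fun c => by rw [sympForm_swap, hr, neg_zero]
  have hs' : ∀ c, sympForm (φ c) y' = 0 := fun c => by rw [sympForm_swap, hs, neg_zero]
  let ψ : PhaseP p (m + 1) →ₗ[ZMod p] PhaseP p d :=
    (LinearMap.proj (Sum.inl 0)).smulRight x' + (LinearMap.proj (Sum.inr 0)).smulRight y' +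
      φ ∘ₗ LinearMap.funLeft (ZMod p) (ZMod p) (Sum.map Fin.succ Fin.succ)
  have hψ : ∀ c, ψ c = c (Sum.inl 0) • x' + c (Sum.inr 0) • y' +
      φ (c ∘ Sum.map Fin.succ Fin.succ) := fun c => rfl
  refine ⟨ψ, fun a b => ?_, ?_⟩
  · rw [hψ, hψ, sympForm_succ]
    simp only [sympForm_add_left, sympForm_add_right, sympForm_smul_left, sympForm_smul_right,
      sympForm_self, hxy, hyx, hr, hs, hr', hs', h]
    ring
  · rintro _ ⟨c, rfl⟩
    rw [hψ]
    exact V.add_mem (V.add_mem (V.smul_mem _ hx'V) (V.smul_mem _ hy'V)) (hmem _)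

/-- A symplectic subspace has a symplectic basis. -/
theorem exists_symplectic_basis {V : Submodule (ZMod p) (PhaseP p d)}
    (hV : ∀ m ∈ V, (∀ n ∈ V, sympForm m n = 0) → m = 0) :
    ∃ (m : ℕ) (φ : PhaseP p m →ₗ[ZMod p] PhaseP p d),
      (∀ x y, sympForm (φ x) (φ y) = sympForm x y) ∧ LinearMap.range φ = V := by
  by_contra! hcon
  -- If no isometric embedding filled `V`, they could be extended forever; at `m = d + 1` the
  -- dimension of the ambient space is exceeded.
  have key : ∀ m : ℕ, ∃ φ : PhaseP p m →ₗ[ZMod p] PhaseP p d,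
      (∀ x y, sympForm (φ x) (φ y) = sympForm x y) ∧ LinearMap.range φ ≤ V := by
    intro m
    induction m with
    | zero => exact ⟨0, fun x y => by simp [sympForm, dotProduct], by simp⟩
    | succ m ih =>
      obtain ⟨φ, h, hφ⟩ := ih
      obtain ⟨x, hx, hx'⟩ := SetLike.exists_of_lt (lt_of_le_of_ne hφ (hcon m φ h))
      exact exists_symplectic_extension hV h hφ hx hx'
  obtain ⟨φ, h, -⟩ := key (d + 1)
  have := LinearMap.finrank_le_finrank_of_injective (injective_of_sympForm h)
  simp only [Module.finrank_fintype_fun_eq_card, Fintype.card_sum, Fintype.card_fin] at this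
  omega

end

section

variable {p : ℕ} [Fact p.Prime] {d : ℕ}

/-! ### The projections onto the subspaces of the orbits -/

/-- The extension of scalars of a vector. -/
def toBarVec (n : PhaseP p d) : Fin d ⊕ Fin d → FpBar p :=
  (Algebra.linearMap (ZMod p) (FpBar p)).compLeft (Fin d ⊕ Fin d) n

theorem toBarVec_vecMul (n : PhaseP p d) (B : Matrix (Fin d ⊕ Fin d) (Fin d ⊕ Fin d) (ZMod p)) :
    toBarVec (n ᵥ* B) = toBarVec n ᵥ* toBar B := by
  ext i
  simp [vecMul, dotProduct, toBarVec, toBar]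

theorem toBarVec_injective : Function.Injective (toBarVec : PhaseP p d → _) := by
  intro m n h
  funext i
  exact (algebraMap (ZMod p) (FpBar p)).injective (congrFun h i)

theorem linearIndependent_toBarVec {κ : Type*} {v : κ → PhaseP p d}
    (h : LinearIndependent (ZMod p) v) : LinearIndependent (FpBar p) fun k => toBarVec (v k) := by
  have h2 := (linearIndependent_algebraMap_comp_iff (S := FpBar p)).2 h
  have h3 : (fun k => toBarVec (v k)) = fun k => algebraMap (ZMod p) (FpBar p) ∘ v k := by
    funext k
    rfl
  rw [h3]
  exact h2

theorem mem_orbitSpace_iff {A : SpP p d} {ϑ : Set (FpBar p)} {n : PhaseP p d} :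
    n ∈ orbitSpace A.1 ϑ ↔
      toBarVec n ∈ ⨆ x ∈ ϑ, Module.End.eigenspace (toBar A.1).vecMulLinear x := Iff.rfl

namespace EigenFrame

open Polynomial

variable {A : SpP p d} (D : EigenFrame A)

theorem mem_orbit_iff (ϑ : sympOrbits A) (i) : D.x i ∈ ϑ.1 ↔ sympOrbit p (D.x i) = ϑ.1 := by
  refine ⟨fun h => (D.eigenvalue_mem_iff ϑ.2 h).2, fun h => ?_⟩
  rw [← h]; exact mem_sympOrbit_self _

/-- The orbit of an eigenvalue. -/
def orb (i : Fin d ⊕ Fin d) : sympOrbits A := ⟨sympOrbit p (D.x i), D.sympOrbit_x_mem i⟩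

theorem mem_orbit_iff_orb (ϑ : sympOrbits A) (i) : D.x i ∈ ϑ.1 ↔ D.orb i = ϑ := by
  rw [mem_orbit_iff, Subtype.ext_iff]; rfl

open Classical in
-- Symplectic orbits are Galois stable, so their indicator functions are equivariant and
-- interpolated over the prime field. The projection onto `E_ϑ` is therefore defined without
-- extending scalars.
theorem exists_indicator (ϑ : sympOrbits A) :
    ∃ h : Polynomial (ZMod p), ∀ i, aeval (D.x i) h = if D.orb i = ϑ then 1 else 0 := by
  obtain ⟨y, -, hy⟩ := mem_sympOrbits_iff.1 ϑ.2
  obtain ⟨h, hh⟩ := D.exists_aeval_x (fun z => if z ∈ sympOrbit p y then 1 else 0) fun σ i => by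
    have h : σ (D.x i) ∈ sympOrbit p y ↔ D.x i ∈ sympOrbit p y := by
      refine ⟨fun h => ?_, fun h => apply_mem_sympOrbit h σ⟩
      have := apply_mem_sympOrbit h σ.symm
      rwa [AlgEquiv.symm_apply_apply] at this
    simp only [h]
    split_ifs <;> simp
  refine ⟨h, fun i => ?_⟩
  rw [hh]
  simp only [← mem_orbit_iff_orb, hy]

/-- A polynomial that is one on the orbit `ϑ` and zero on the other orbits. -/
def ind (ϑ : sympOrbits A) : Polynomial (ZMod p) := (D.exists_indicator ϑ).choose

open Classical in
theorem aeval_ind (ϑ : sympOrbits A) (i) :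
    aeval (D.x i) (D.ind ϑ) = if D.orb i = ϑ then 1 else 0 :=
  (D.exists_indicator ϑ).choose_spec i

/-- The projection onto `E_ϑ`. -/
def proj (ϑ : sympOrbits A) : Matrix (Fin d ⊕ Fin d) (Fin d ⊕ Fin d) (ZMod p) :=
  aeval A.1 (D.ind ϑ)

theorem proj_mul_self (ϑ : sympOrbits A) : D.proj ϑ * D.proj ϑ = D.proj ϑ := by
  classical
  rw [proj, ← map_mul, D.aeval_eq_iff]
  intro i
  rw [map_mul, aeval_ind]
  simp

theorem proj_mul_ne {ϑ ϑ' : sympOrbits A} (h : ϑ ≠ ϑ') : D.proj ϑ * D.proj ϑ' = 0 := by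
  classical
  rw [proj, proj, ← map_mul, ← map_zero (aeval (R := ZMod p) A.1), D.aeval_eq_iff]
  intro i
  rw [map_mul, aeval_ind, aeval_ind, map_zero]
  by_cases h1 : D.orb i = ϑ
  · rw [if_neg (h1 ▸ h : D.orb i ≠ ϑ'), mul_zero]
  · rw [if_neg h1, zero_mul]

theorem sum_proj : ∑ ϑ, D.proj ϑ = 1 := by
  classical
  simp only [proj]
  rw [← map_sum, ← map_one (aeval (R := ZMod p) A.1), D.aeval_eq_iff]
  intro i
  simp only [map_sum, aeval_ind, map_one]
  simp

theorem sum_vecMul_proj (n : PhaseP p d) : ∑ ϑ, n ᵥ* D.proj ϑ = n := by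
  rw [← vecMul_sum, sum_proj, vecMul_one]

theorem orb_eq_of_inv {i j} (h : D.x j = (D.x i)⁻¹) : D.orb j = D.orb i := by
  apply Subtype.ext
  change sympOrbit p (D.x j) = sympOrbit p (D.x i)
  rw [h, sympOrbit_inv]

/-- The form pairs only inverse eigenvalues, and these lie in the same symplectic orbit, so the
projection is self-adjoint. Orthogonality and nondegeneracy of the summands both follow. -/
theorem sympForm_proj (ϑ : sympOrbits A) (m n : PhaseP p d) :
    sympForm (m ᵥ* D.proj ϑ) n = sympForm m (n ᵥ* D.proj ϑ) := by
  classical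
  have h1 : D.Acts (toBar 1) fun _ => 1 := by rw [toBar_one]; exact D.acts_one
  have h2 := D.acts_aeval (D.ind ϑ)
  have h3 := (D.form_eq_iff h2 h1 h1 h2).2 fun i j hij => by
    rw [one_mul, mul_one, aeval_ind, aeval_ind, D.orb_eq_of_inv hij]
  rw [transpose_one, Matrix.mul_one, Matrix.one_mul] at h3
  change D.proj ϑ * J (Fin d) (ZMod p) = J (Fin d) (ZMod p) * (D.proj ϑ)ᵀ at h3
  rw [sympForm_eq, sympForm_eq, ← dotProduct_mulVec, mulVec_mulVec, h3, ← mulVec_mulVec,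
    mulVec_transpose]

theorem vecMul_of_mem_eigenspace {x : FpBar p} {v : Fin d ⊕ Fin d → FpBar p}
    (hv : v ᵥ* toBar A.1 = x • v) (h : Polynomial (ZMod p)) :
    v ᵥ* toBar (aeval A.1 h) = aeval x h • v := by
  rw [toBar_aeval]
  induction h using Polynomial.induction_on with
  | C a =>
    rw [aeval_C, aeval_C, algebraMap_smul, Algebra.algebraMap_eq_smul_one, vecMul_smul, vecMul_one]
  | add f g hf hg => rw [map_add, vecMul_add, hf, hg, map_add, add_smul]
  | monomial n a hn =>
    rw [pow_succ, ← mul_assoc, map_mul, ← vecMul_vecMul, hn, smul_vecMul, aeval_X, hv, smul_smul,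
      map_mul _ _ X, aeval_X]

theorem row_vecMul (i) : D.P i ᵥ* toBar A.1 = D.x i • D.P i := by
  have := congrFun D.mul_eq i
  rw [mul_apply_eq_vecMul] at this
  rw [this]
  ext j
  simp [diagonal_mul]

theorem exists_coeff (v : Fin d ⊕ Fin d → FpBar p) : ∃ c : Fin d ⊕ Fin d → FpBar p,
    v = ∑ i, c i • D.P i := by
  obtain ⟨Q, hQ⟩ := D.isUnit.exists_left_inv
  refine ⟨v ᵥ* Q, ?_⟩
  rw [← vecMul_eq_sum, vecMul_vecMul, hQ, vecMul_one]

theorem toBarVec_mem_span (ϑ : sympOrbits A) {n : PhaseP p d} (h : n ᵥ* D.proj ϑ = n) :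
    toBarVec n ∈ Submodule.span (FpBar p) (Set.range fun i : {i // D.x i ∈ ϑ.1} => D.P i.1) := by
  classical
  obtain ⟨c, hc⟩ := D.exists_coeff (toBarVec n)
  have h1 : toBarVec n = ∑ i, c i • (aeval (D.x i) (D.ind ϑ) • D.P i) := by
    rw [← h, toBarVec_vecMul, hc, sum_vecMul]
    refine Finset.sum_congr rfl fun i _ => ?_
    rw [smul_vecMul, proj, vecMul_of_mem_eigenspace (D.row_vecMul i)]
  rw [h1]
  refine Submodule.sum_mem _ fun i _ => Submodule.smul_mem _ _ ?_
  rw [aeval_ind]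
  split_ifs with hi
  · rw [one_smul]
    exact Submodule.subset_span ⟨⟨i, (D.mem_orbit_iff_orb ϑ i).2 hi⟩, rfl⟩
  · rw [zero_smul]
    exact Submodule.zero_mem _

theorem mem_orbitSpace_iff_proj (ϑ : sympOrbits A) {n : PhaseP p d} :
    n ∈ orbitSpace A.1 ϑ.1 ↔ n ᵥ* D.proj ϑ = n := by
  classical
  rw [mem_orbitSpace_iff]
  constructor
  · intro h
    apply toBarVec_injective
    rw [toBarVec_vecMul]
    have key : (⨆ x ∈ ϑ.1, Module.End.eigenspace (toBar A.1).vecMulLinear x) ≤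
        LinearMap.eqLocus (toBar (D.proj ϑ)).vecMulLinear LinearMap.id := by
      refine iSup₂_le fun x hx v hv => ?_
      rw [Module.End.mem_eigenspace_iff, vecMulLinear_apply] at hv
      rw [LinearMap.mem_eqLocus, vecMulLinear_apply, LinearMap.id_apply, proj,
        vecMul_of_mem_eigenspace hv]
      obtain ⟨i, rfl⟩ := (D.eigenvalue_mem_iff ϑ.2 hx).1
      rw [aeval_ind, if_pos ((D.mem_orbit_iff_orb ϑ i).1 hx), one_smul]
    exact key h
  · intro h
    refine Submodule.span_le.2 ?_ (D.toBarVec_mem_span ϑ h)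
    rintro _ ⟨⟨i, hi⟩, rfl⟩
    refine Submodule.mem_iSup_of_mem (D.x i) (Submodule.mem_iSup_of_mem hi ?_)
    rw [Module.End.mem_eigenspace_iff, vecMulLinear_apply, D.row_vecMul]

theorem ncard_orbit (ϑ : sympOrbits A) : ϑ.1.ncard = Nat.card {i // D.x i ∈ ϑ.1} := by
  have : ϑ.1 = D.x '' {i | D.x i ∈ ϑ.1} := by
    ext y
    constructor
    · intro hy
      obtain ⟨i, rfl⟩ := (D.eigenvalue_mem_iff ϑ.2 hy).1
      exact ⟨i, hy, rfl⟩
    · rintro ⟨i, hi, rfl⟩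
      exact hi
  conv_lhs => rw [this]
  rw [Set.ncard_image_of_injective _ D.injective]
  rfl

/-- Independence survives extension of scalars, and there the subspace lies in the span of the
eigenvectors of the orbit. Equality comes later from the total dimension. -/
theorem finrank_orbitSpace_le (D : EigenFrame A) (ϑ : sympOrbits A) :
    Module.finrank (ZMod p) (orbitSpace A.1 ϑ.1) ≤ ϑ.1.ncard := by
  classical
  let b := Module.finBasis (ZMod p) (orbitSpace A.1 ϑ.1)
  have h1 : LinearIndependent (ZMod p) fun k => (b k : PhaseP p d) :=
    b.linearIndependent.map' (orbitSpace A.1 ϑ.1).subtype (Submodule.ker_subtype _)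
  have h2 := linearIndependent_toBarVec h1
  have h3 : Submodule.span (FpBar p) (Set.range fun k => toBarVec (b k : PhaseP p d)) ≤
      Submodule.span (FpBar p) (Set.range fun i : {i // D.x i ∈ ϑ.1} => D.P i.1) := by
    rw [Submodule.span_le]
    rintro _ ⟨k, rfl⟩
    exact D.toBarVec_mem_span ϑ ((D.mem_orbitSpace_iff_proj ϑ).1 (b k).2)
  have h4 := Submodule.finrank_mono h3
  rw [finrank_span_eq_card h2, Fintype.card_fin] at h4
  refine h4.trans ((finrank_range_le_card _).trans ?_)
  rw [D.ncard_orbit, Nat.card_eq_fintype_card]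

end EigenFrame

end

/-! ### The symplectic decomposition along orbits -/

section

variable {p : ℕ} [Fact p.Prime] {d : ℕ}

theorem finrank_phaseP (d : ℕ) : Module.finrank (ZMod p) (PhaseP p d) = 2 * d := by
  rw [Module.finrank_fintype_fun_eq_card, Fintype.card_sum, Fintype.card_fin, two_mul]

theorem sympForm_sum_right {ι : Type*} (s : Finset ι) (m : PhaseP p d) (n : ι → PhaseP p d) :
    sympForm m (∑ i ∈ s, n i) = ∑ i ∈ s, sympForm m (n i) := by
  classical
  induction s using Finset.induction_on with
  | empty => simp [sympForm, dotProduct]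
  | insert a s ha ih => rw [Finset.sum_insert ha, Finset.sum_insert ha, sympForm_add_right, ih]

namespace EigenFrame

open Polynomial

variable {A : SpP p d} (D : EigenFrame A)

theorem eq_zero_of_mem_orbitSpace (D : EigenFrame A) (ϑ : sympOrbits A) {m : PhaseP p d}
    (hm : m ∈ orbitSpace A.1 ϑ.1) (h : ∀ n ∈ orbitSpace A.1 ϑ.1, sympForm m n = 0) : m = 0 := by
  refine eq_zero_of_sympForm fun n => ?_
  rw [← (D.mem_orbitSpace_iff_proj ϑ).1 hm, D.sympForm_proj]
  refine h _ ((D.mem_orbitSpace_iff_proj ϑ).2 ?_)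
  rw [vecMul_vecMul, D.proj_mul_self]

theorem vecMul_proj_mem (ϑ : sympOrbits A) (n : PhaseP p d) :
    n ᵥ* D.proj ϑ ∈ orbitSpace A.1 ϑ.1 := by
  rw [D.mem_orbitSpace_iff_proj, vecMul_vecMul, D.proj_mul_self]

theorem sum_ncard_orbit (D : EigenFrame A) : ∑ ϑ : sympOrbits A, ϑ.1.ncard = 2 * d := by
  classical
  have h1 : ∀ ϑ : sympOrbits A, ϑ.1.ncard = (Finset.univ.filter fun i => D.orb i = ϑ).card := by
    intro ϑ
    rw [D.ncard_orbit, Nat.card_eq_fintype_card, Fintype.card_subtype]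
    simp only [D.mem_orbit_iff_orb]
  simp only [h1]
  rw [← Finset.card_eq_sum_card_fiberwise (fun _ _ => Finset.mem_coe.2 (Finset.mem_univ _)),
    Finset.card_univ, Fintype.card_sum, Fintype.card_fin, two_mul]

/-- The sizes `m ϑ` are left arbitrary because this isomorphism is itself used to determine them. -/
theorem exists_coord (D : EigenFrame A) (m : sympOrbits A → ℕ)
    (φ : (ϑ : sympOrbits A) → PhaseP p (m ϑ) →ₗ[ZMod p] PhaseP p d)
    (hinj : ∀ ϑ, Function.Injective (φ ϑ))
    (hφ : ∀ ϑ, LinearMap.range (φ ϑ) = orbitSpace A.1 ϑ.1) :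
    ∃ c : PhaseP p d ≃ₗ[ZMod p] ((ϑ : sympOrbits A) → PhaseP p (m ϑ)),
      ∀ n ϑ, φ ϑ (c n ϑ) = n ᵥ* D.proj ϑ := by
  classical
  have hmem : ∀ ϑ c, φ ϑ c ᵥ* D.proj ϑ = φ ϑ c := fun ϑ c =>
    (D.mem_orbitSpace_iff_proj ϑ).1 (hφ ϑ ▸ LinearMap.mem_range_self (φ ϑ) c)
  let Φ : ((ϑ : sympOrbits A) → PhaseP p (m ϑ)) →ₗ[ZMod p] PhaseP p d :=
    ∑ ϑ, φ ϑ ∘ₗ LinearMap.proj ϑ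
  have hΦ : ∀ c, Φ c = ∑ ϑ, φ ϑ (c ϑ) := fun c => by simp [Φ]
  have hΦE : ∀ c ϑ, Φ c ᵥ* D.proj ϑ = φ ϑ (c ϑ) := by
    intro c ϑ
    rw [hΦ, sum_vecMul, Finset.sum_eq_single ϑ, hmem]
    · intro ϑ' _ h
      rw [← hmem, vecMul_vecMul, D.proj_mul_ne h, vecMul_zero]
    · simp
  have hbij : Function.Bijective Φ := by
    constructor
    · intro c c' h
      funext ϑ
      apply hinj ϑ
      rw [← hΦE, h, hΦE]
    · intro n
      have : ∀ ϑ, ∃ c, φ ϑ c = n ᵥ* D.proj ϑ := fun ϑ =>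
        LinearMap.mem_range.1 (hφ ϑ ▸ D.vecMul_proj_mem ϑ n)
      choose c hc using this
      exact ⟨c, by rw [hΦ]; simp only [hc]; exact D.sum_vecMul_proj n⟩
  refine ⟨(LinearEquiv.ofBijective Φ hbij).symm, fun n ϑ => ?_⟩
  rw [← hΦE]
  congr 1
  exact (LinearEquiv.ofBijective Φ hbij).apply_symm_apply n

theorem exists_isometry (D : EigenFrame A) :
    ∃ φ : (ϑ : sympOrbits A) → PhaseP p (halfDim ϑ.1) →ₗ[ZMod p] PhaseP p d,
      (∀ ϑ x y, sympForm (φ ϑ x) (φ ϑ y) = sympForm x y) ∧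
      (∀ ϑ, LinearMap.range (φ ϑ) = orbitSpace A.1 ϑ.1) ∧
      ∀ ϑ : sympOrbits A, 2 * halfDim ϑ.1 = ϑ.1.ncard := by
  choose m φ hφ hr using fun ϑ : sympOrbits A =>
    exists_symplectic_basis fun m hm h => D.eq_zero_of_mem_orbitSpace ϑ hm h
  obtain ⟨c, -⟩ := D.exists_coord m φ (fun ϑ => injective_of_sympForm (hφ ϑ)) hr
  have h1 := c.finrank_eq
  rw [finrank_phaseP, Module.finrank_pi_fintype] at h1
  replace h1 := h1.trans (Finset.sum_congr rfl fun ϑ _ => finrank_phaseP (m ϑ))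
  have h2 : ∀ ϑ : sympOrbits A, 2 * m ϑ ≤ ϑ.1.ncard := by
    intro ϑ
    refine le_trans ?_ (D.finrank_orbitSpace_le ϑ)
    rw [← hr ϑ, LinearMap.finrank_range_of_inj (injective_of_sympForm (hφ ϑ)), finrank_phaseP]
  -- Termwise `2 * m ϑ ≤ |ϑ|`, while both sides add up to `2 * d`; so equality holds for each orbit,
  -- and orbits have even size.
  have h3 := (Finset.sum_eq_sum_iff_of_le fun ϑ _ => h2 ϑ).1 (h1.symm.trans D.sum_ncard_orbit.symm)
  obtain rfl : m = fun ϑ => halfDim ϑ.1 := by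
    funext ϑ
    rw [halfDim, ← h3 ϑ (Finset.mem_univ ϑ), Nat.mul_div_cancel_left _ two_pos]
  exact ⟨φ, hφ, hr, fun ϑ => h3 ϑ (Finset.mem_univ ϑ)⟩

theorem two_mul_halfDim (D : EigenFrame A) (ϑ : sympOrbits A) : 2 * halfDim ϑ.1 = ϑ.1.ncard :=
  D.exists_isometry.choose_spec.2.2 ϑ

theorem nonempty_sympDecomposition (D : EigenFrame A) : Nonempty (SympDecomposition A) := by
  obtain ⟨φ, hφ, hr, -⟩ := D.exists_isometry
  have hinj := fun ϑ => injective_of_sympForm (hφ ϑ)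
  obtain ⟨c, hc⟩ := D.exists_coord _ φ hinj hr
  refine ⟨⟨c, fun ϑ n => ?_, fun m n => ?_⟩⟩
  · have h0 : ∀ ϑ', c n ϑ' = 0 ↔ n ᵥ* D.proj ϑ' = 0 := fun ϑ' => by
      rw [← hc, map_eq_zero_iff _ (hinj ϑ')]
    rw [D.mem_orbitSpace_iff_proj]
    simp only [h0]
    constructor
    · intro h ϑ' hne
      rw [← h, vecMul_vecMul, D.proj_mul_ne hne.symm, vecMul_zero]
    · intro h
      conv_rhs => rw [← D.sum_vecMul_proj n]
      rw [Finset.sum_eq_single ϑ (fun ϑ' _ hne => h ϑ' hne) (by simp)]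
  · conv_lhs => rw [← D.sum_vecMul_proj n, sympForm_sum_right]
    refine Finset.sum_congr rfl fun ϑ _ => ?_
    rw [← hφ, hc, hc, D.sympForm_proj, vecMul_vecMul, D.proj_mul_self]

end EigenFrame

/-! ### Components of `A`, gluing, and characters of the Hecke group -/

namespace SympDecomposition

open Polynomial

variable {A : SpP p d} (S : SympDecomposition A)

theorem incl_aeval (ϑ : sympOrbits A) (v : PhaseP p (halfDim ϑ.1)) (h : Polynomial (ZMod p)) :
    S.incl ϑ v ᵥ* aeval A.1 h = S.incl ϑ (v ᵥ* aeval (S.comp ϑ).1 h) := by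
  induction h using Polynomial.induction_on with
  | C a =>
    rw [aeval_C, aeval_C, Algebra.algebraMap_eq_smul_one, Algebra.algebraMap_eq_smul_one,
      vecMul_smul, vecMul_smul, vecMul_one, vecMul_one, map_smul]
  | add f g hf hg => rw [map_add, vecMul_add, hf, hg, map_add, vecMul_add, map_add]
  | monomial n a hn =>
    rw [pow_succ, ← mul_assoc, map_mul, ← vecMul_vecMul, hn, aeval_X, S.incl_vecMul rfl,
      map_mul _ _ X, aeval_X, ← vecMul_vecMul]
    rfl

/-- By Cayley–Hamilton the characteristic polynomial of `A_ϑ` kills `A` on `E_ϑ`, so every element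
of `ϑ` is a root. Its degree is the size of `ϑ`, which leaves no room for other or repeated roots.
-/
theorem eigenvaluesP_comp (D : EigenFrame A) (ϑ : sympOrbits A) :
    (eigenvaluesP (S.comp ϑ)).Nodup ∧ ∀ y, y ∈ eigenvaluesP (S.comp ϑ) ↔ y ∈ ϑ.1 := by
  classical
  set f := (S.comp ϑ).1.charpoly with hf
  have hf0 : f.Monic := charpoly_monic _
  have hdeg : f.natDegree = 2 * halfDim ϑ.1 := by
    rw [hf, charpoly_natDegree_eq_dim, Fintype.card_sum, Fintype.card_fin, two_mul]
  have h1 : aeval A.1 (D.ind ϑ * f) = aeval A.1 (0 : Polynomial (ZMod p)) := by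
    refine Matrix.ext_of_single_vecMul fun i => ?_
    rw [map_mul, ← vecMul_vecMul]
    change (_ ᵥ* D.proj ϑ) ᵥ* _ = _
    rw [← S.incl_coord (D.vecMul_proj_mem ϑ (Pi.single i 1)), incl_aeval, hf,
      Matrix.aeval_self_charpoly, vecMul_zero, map_zero, map_zero, vecMul_zero]
  rw [D.aeval_eq_iff] at h1
  let T := (Finset.univ.filter fun i => D.x i ∈ ϑ.1).image D.x
  have hT : ∀ y, y ∈ T ↔ y ∈ ϑ.1 := by
    intro y
    simp only [T, Finset.mem_image, Finset.mem_filter, Finset.mem_univ, true_and]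
    constructor
    · rintro ⟨i, hi, rfl⟩; exact hi
    · intro hy
      obtain ⟨i, rfl⟩ := (D.eigenvalue_mem_iff ϑ.2 hy).1
      exact ⟨i, hy, rfl⟩
  have hcard : T.card = 2 * halfDim ϑ.1 := by
    rw [D.two_mul_halfDim, D.ncard_orbit, Finset.card_image_of_injective _ D.injective,
      Nat.card_eq_fintype_card, Fintype.card_subtype]
  have hle : T.val ≤ eigenvaluesP (S.comp ϑ) := by
    rw [Multiset.le_iff_subset T.nodup]
    intro y hy
    obtain ⟨i, rfl⟩ := (D.eigenvalue_mem_iff ϑ.2 ((hT y).1 hy)).1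
    rw [eigenvaluesP, mem_aroots]
    have h2 := h1 i
    rw [map_mul, D.aeval_ind, if_pos ((D.mem_orbit_iff_orb ϑ i).1 ((hT _).1 hy)), one_mul,
      map_zero] at h2
    exact ⟨hf0.ne_zero, h2⟩
  have heq : T.val = eigenvaluesP (S.comp ϑ) := by
    refine Multiset.eq_of_le_of_card_le hle ?_
    refine (card_roots' _).trans ?_
    rw [natDegree_map, hdeg, ← hcard]
    rfl
  rw [← heq]
  exact ⟨T.nodup, hT⟩

theorem sympOrbits_comp (D : EigenFrame A) (ϑ : sympOrbits A) :
    sympOrbits (S.comp ϑ) = {ϑ.1} := by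
  ext ϑ'
  rw [mem_sympOrbits_iff, Finset.mem_singleton]
  simp only [(S.eigenvaluesP_comp D ϑ).2]
  constructor
  · rintro ⟨y, hy, rfl⟩
    exact (D.eigenvalue_mem_iff ϑ.2 hy).2
  · rintro rfl
    obtain ⟨y, -, hy⟩ := mem_sympOrbits_iff.1 ϑ.2
    exact ⟨y, hy ▸ mem_sympOrbit_self y, hy⟩

theorem sum_incl_coord (n : PhaseP p d) : ∑ ϑ, S.incl ϑ (S.coord n ϑ) = n := by
  apply S.coord.injective
  rw [map_sum]
  funext ϑ
  rw [Finset.sum_apply, Finset.sum_eq_single ϑ, coord_incl_self]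
  · intro ϑ' _ h
    rw [S.coord_incl_ne h.symm]
  · simp

theorem coord_vecMul {B : Matrix (Fin d ⊕ Fin d) (Fin d ⊕ Fin d) (ZMod p)}
    (h : A.1 * B = B * A.1) (n : PhaseP p d) (ϑ : sympOrbits A) :
    S.coord (n ᵥ* B) ϑ = S.coord n ϑ ᵥ* S.compMatrix B ϑ := by
  conv_lhs => rw [← S.sum_incl_coord n, sum_vecMul, map_sum]
  rw [Finset.sum_apply, Finset.sum_eq_single ϑ, S.incl_vecMul h, coord_incl_self]
  · intro ϑ' _ hne
    rw [S.incl_vecMul h, S.coord_incl_ne hne.symm]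
  · simp

/-- The linear map with given components. -/
def glueMap (g : (ϑ : sympOrbits A) → SpP p (halfDim ϑ.1)) : PhaseP p d →ₗ[ZMod p] PhaseP p d :=
  S.coord.symm.toLinearMap ∘ₗ LinearMap.pi (fun ϑ =>
    (g ϑ).1.vecMulLinear ∘ₗ LinearMap.proj ϑ) ∘ₗ S.coord.toLinearMap

theorem glue_aux (g : (ϑ : sympOrbits A) → SpP p (halfDim ϑ.1)) (m n : PhaseP p d) :
    sympForm (S.glueMap g m) (S.glueMap g n) = sympForm m n := by
  rw [S.form_eq, S.form_eq]
  simp [glueMap, sympForm_vecMul_vecMul]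

/-- The symplectic matrix with given components. -/
def glue : ((ϑ : sympOrbits A) → SpP p (halfDim ϑ.1)) →* SpP p d where
  toFun g := spOfLinearMap (S.glueMap g) (S.glue_aux g)
  map_one' := spP_ext fun v => by
    rw [vecMul_spOfLinearMap, vecMul_one_spP]
    apply S.coord.injective
    funext ϑ
    simp [glueMap]
  map_mul' g h := spP_ext fun v => by
    rw [vecMul_mul_spP]
    simp only [vecMul_spOfLinearMap]
    apply S.coord.injective
    funext ϑ
    simp [glueMap]

theorem coord_glue (g : (ϑ : sympOrbits A) → SpP p (halfDim ϑ.1)) (n : PhaseP p d)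
    (ϑ : sympOrbits A) : S.coord (n ᵥ* (S.glue g).1) ϑ = S.coord n ϑ ᵥ* (g ϑ).1 := by
  have h := vecMul_spOfLinearMap _ (S.glue_aux g) n
  change S.coord (n ᵥ* (spOfLinearMap _ (S.glue_aux g)).1) ϑ = _
  rw [h]
  simp [glueMap]

theorem glue_heckeComp (B : heckeGroup A) : S.glue (fun ϑ => (S.heckeComp ϑ B).1) = B.1 := by
  refine spP_ext fun v => S.coord.injective ?_
  funext ϑ
  rw [coord_glue, S.coord_vecMul (heckeGroup_comm B)]
  rfl

theorem glue_comp : S.glue S.comp = A := by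
  refine spP_ext fun v => S.coord.injective ?_
  funext ϑ
  rw [coord_glue, S.coord_vecMul rfl]
  rfl

/-- The element of the Hecke group with given components. -/
def heckeGlue : ((ϑ : sympOrbits A) → heckeGroup (S.comp ϑ)) →* heckeGroup A where
  toFun g := ⟨S.glue fun ϑ => (g ϑ).1, by
    rw [Subgroup.mem_centralizer_singleton_iff]
    have h : S.glue (fun ϑ => (g ϑ).1) * S.glue S.comp = S.glue S.comp * S.glue fun ϑ => (g ϑ).1 := by
      rw [← map_mul, ← map_mul]
      congr 1
      funext ϑ
      exact Subgroup.mem_centralizer_singleton_iff.1 (g ϑ).2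
    rwa [S.glue_comp] at h⟩
  map_one' := Subtype.ext (map_one S.glue)
  map_mul' g h := Subtype.ext (map_mul S.glue (fun ϑ => (g ϑ).1) fun ϑ => (h ϑ).1)

theorem heckeComp_heckeGlue (g : (ϑ : sympOrbits A) → heckeGroup (S.comp ϑ)) (ϑ) :
    S.heckeComp ϑ (S.heckeGlue g) = g ϑ := by
  apply Subtype.ext
  refine spP_ext fun v => ?_
  change v ᵥ* S.compMatrix (S.glue fun ϑ => (g ϑ).1).1 ϑ = _
  rw [vecMul_compMatrix, coord_glue, coord_incl_self]

theorem heckeGlue_heckeComp (B : heckeGroup A) : S.heckeGlue (fun ϑ => S.heckeComp ϑ B) = B :=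
  Subtype.ext (S.glue_heckeComp B)

theorem prodChar_apply (χ : (ϑ : sympOrbits A) → heckeGroup (S.comp ϑ) →* ℂˣ) (B) :
    S.prodChar χ B = ∏ ϑ, χ ϑ (S.heckeComp ϑ B) := by
  simp [prodChar, MonoidHom.finsetProd_apply]

open Classical in
theorem prodChar_heckeGlue_mulSingle (χ : (ϑ : sympOrbits A) → heckeGroup (S.comp ϑ) →* ℂˣ) (ϑ)
    (b : heckeGroup (S.comp ϑ)) :
    S.prodChar χ (S.heckeGlue (MonoidHom.mulSingle _ ϑ b)) = χ ϑ b := by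
  rw [prodChar_apply, Finset.prod_eq_single ϑ, heckeComp_heckeGlue]
  · simp
  · intro ϑ' _ h
    rw [heckeComp_heckeGlue, MonoidHom.mulSingle_apply, Pi.mulSingle_eq_of_ne h, map_one]
  · simp

/-- Gluing inverts the passage to components, so the Hecke group is the product of those of the
orbits; a character of a finite product is determined by its restrictions to the factors, which may
be chosen freely. -/
theorem prodChar_bijective : Function.Bijective S.prodChar := by
  classical
  constructor
  · intro χ χ' h
    funext ϑ
    ext b
    rw [← S.prodChar_heckeGlue_mulSingle, h, S.prodChar_heckeGlue_mulSingle]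
  · intro ξ
    refine ⟨fun ϑ => ξ.comp (S.heckeGlue.comp (MonoidHom.mulSingle (fun ϑ => heckeGroup (S.comp ϑ)) ϑ)), ?_⟩
    set χ : (ϑ : sympOrbits A) → heckeGroup (S.comp ϑ) →* ℂˣ :=
      fun ϑ => ξ.comp (S.heckeGlue.comp (MonoidHom.mulSingle (fun ϑ => heckeGroup (S.comp ϑ)) ϑ)) with hχ
    have h : (S.prodChar χ).comp S.heckeGlue = ξ.comp S.heckeGlue := by
      refine MonoidHom.pi_ext fun ϑ b => ?_
      exact S.prodChar_heckeGlue_mulSingle χ ϑ b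
    ext B
    have := DFunLike.congr_fun h fun ϑ => S.heckeComp ϑ B
    rw [MonoidHom.comp_apply, MonoidHom.comp_apply, heckeGlue_heckeComp] at this
    rw [this]

end SympDecomposition

end

section

/-! ### Tensor products -/

section Tensor

variable {ι K : Type*} [Fintype ι] [Field K] {M κ : ι → Type*} [∀ i, AddCommGroup (M i)]
  [∀ i, Module K (M i)]

theorem linearIndependent_tprod {v : ∀ i, κ i → M i} (h : ∀ i, LinearIndependent K (v i)) :
    LinearIndependent K fun f : ∀ i, κ i => PiTensorProduct.tprod K fun i => v i (f i) := by
  let b := fun i => Module.Basis.extend (h i).linearIndepOn_id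
  let e : (∀ i, κ i) → ∀ i, (h i).linearIndepOn_id.extend (Set.subset_univ _) := fun f i =>
    ⟨v i (f i), (h i).linearIndepOn_id.subset_extend _ ⟨f i, rfl⟩⟩
  have he : Function.Injective e := by
    intro f g hfg
    funext i
    exact (h i).injective (congrArg Subtype.val (congrFun hfg i))
  have := (Basis.piTensorProduct b).linearIndependent.comp e he
  convert! this using 2 with f
  simp [b, e]

theorem tprod_mem_span [∀ i, Fintype (κ i)] {v : ∀ i, κ i → M i} {x : ∀ i, M i}
    (hx : ∀ i, x i ∈ Submodule.span K (Set.range (v i))) :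
    PiTensorProduct.tprod K x ∈ Submodule.span K
      (Set.range fun f : ∀ i, κ i => PiTensorProduct.tprod K fun i => v i (f i)) := by
  classical
  choose c hc using fun i => Submodule.mem_span_range_iff_exists_fun K |>.1 (hx i)
  have h : x = fun i => ∑ j, c i j • v i j := funext fun i => (hc i).symm
  rw [h, MultilinearMap.map_sum]
  refine Submodule.sum_mem _ fun f _ => ?_
  rw [MultilinearMap.map_smul_univ]
  exact Submodule.smul_mem _ _ (Submodule.subset_span ⟨f, rfl⟩)

/-- Expanding multilinearly, the tensor product of the projections is the character projection of
the product group. -/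
theorem map_charProj {G : ι → Type*} {V : ι → Type*} [∀ i, Group (G i)] [∀ i, Fintype (G i)]
    [DecidableEq ι] [∀ i, AddCommGroup (V i)] [∀ i, Module ℂ (V i)]
    (ρ : ∀ i, G i →* Module.End ℂ (V i)) (χ : ∀ i, G i →* ℂˣ) :
    PiTensorProduct.map (fun i => charProj (ρ i) (χ i)) =
      (∏ i, (Fintype.card (G i) : ℂ)⁻¹) • ∑ g : ∀ i, G i,
        (∏ i, (χ i (g i)⁻¹ : ℂ)) • PiTensorProduct.map fun i => ρ i (g i) := by
  change PiTensorProduct.mapMultilinear ℂ V V (fun i => charProj (ρ i) (χ i)) = _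
  simp only [charProj]
  rw [MultilinearMap.map_smul_univ, MultilinearMap.map_sum]
  simp only [MultilinearMap.map_smul_univ]
  rfl

end Tensor

/-- Two representations that differ by scalars differ by a character. -/
theorem exists_character_of_scalars {Γ V : Type*} [Group Γ] [AddCommGroup V] [Module ℂ V]
    [Nontrivial V] (F G : Γ →* Module.End ℂ V) (h : ∀ g, ∃ c : ℂ, F g = c • G g) :
    ∃ c : Γ →* ℂˣ, ∀ g, F g = (c g : ℂ) • G g := by
  choose c hc using h
  have hinj : ∀ (g : Γ) (a b : ℂ), a • G g = b • G g → a = b := by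
    intro g a b hab
    have h1 := congrArg (· * G g⁻¹) hab
    simp only [smul_mul_assoc, ← map_mul, mul_inv_cancel, map_one] at h1
    obtain ⟨v, hv⟩ := exists_ne (0 : V)
    exact smul_left_injective ℂ hv (LinearMap.congr_fun h1 v)
  let c' : Γ →* ℂ :=
    { toFun := c
      map_one' := hinj 1 _ _ (by rw [← hc, one_smul, map_one, map_one])
      map_mul' := fun g k => hinj (g * k) _ _ (by
        rw [← hc, map_mul, map_mul, hc, hc k, smul_mul_smul_comm]) }
  exact ⟨c'.toHomUnits, hc⟩

variable {p : ℕ} [Fact p.Prime] {d : ℕ}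

/-! ### Comparison of a quantization with the tensor product of quantizations -/

namespace SympDecomposition

variable {A : SpP p d} {S : SympDecomposition A}
  {𝒰 : HilbertP p d ≃ₗ[ℂ] PiTensorProduct ℂ fun ϑ : sympOrbits A => HilbertP p (halfDim ϑ.1)}

/-- The representation `⨂ U_ϑ(B_ϑ)` carried over to the state space. -/
def tensorQuant (𝒰 : HilbertP p d ≃ₗ[ℂ] PiTensorProduct ℂ
      fun ϑ : sympOrbits A => HilbertP p (halfDim ϑ.1))
    (U : (d : ℕ) → SpP p d →* (HilbertP p d ≃ₗᵢ[ℂ] HilbertP p d)) :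
    ((ϑ : sympOrbits A) → SpP p (halfDim ϑ.1)) →* Module.End ℂ (HilbertP p d) where
  toFun g := 𝒰.symm.conj (PiTensorProduct.map fun ϑ => quantLin (U (halfDim ϑ.1)) (g ϑ))
  map_one' := by
    have : (fun ϑ : sympOrbits A => quantLin (U (halfDim ϑ.1)) ((1 : (ϑ : sympOrbits A) →
        SpP p (halfDim ϑ.1)) ϑ)) = fun ϑ => 1 := by
      funext ϑ
      exact map_one _
    rw [this, PiTensorProduct.map_one]
    exact LinearEquiv.conj_id _
  map_mul' g h := by
    have : (fun ϑ : sympOrbits A => quantLin (U (halfDim ϑ.1)) ((g * h) ϑ)) =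
        fun ϑ => quantLin (U (halfDim ϑ.1)) (g ϑ) * quantLin (U (halfDim ϑ.1)) (h ϑ) := by
      funext ϑ
      exact map_mul _ _ _
    rw [this, PiTensorProduct.map_mul]
    exact LinearEquiv.conj_comp _ _ _

theorem tensorQuant_apply (U : (d : ℕ) → SpP p d →* (HilbertP p d ≃ₗᵢ[ℂ] HilbertP p d))
    (g : (ϑ : sympOrbits A) → SpP p (halfDim ϑ.1)) (ψ : HilbertP p d) :
    tensorQuant 𝒰 U g ψ =
      𝒰.symm (PiTensorProduct.map (fun ϑ => quantLin (U (halfDim ϑ.1)) (g ϑ)) (𝒰 ψ)) := rfl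

theorem IsTensorIntertwiner.elemEnd_mul (h : S.IsTensorIntertwiner 𝒰)
    {U : (d : ℕ) → SpP p d →* (HilbertP p d ≃ₗᵢ[ℂ] HilbertP p d)} (hU : ∀ d, IsQuantization (U d))
    (g : (ϑ : sympOrbits A) → SpP p (halfDim ϑ.1)) (n : PhaseP p d) :
    elemEnd n * tensorQuant 𝒰 U g = tensorQuant 𝒰 U g * elemEnd (n ᵥ* (S.glue g).1) := by
  ext1 ψ
  apply 𝒰.injective
  change 𝒰 (elemOp n (tensorQuant 𝒰 U g ψ)) = 𝒰 (tensorQuant 𝒰 U g (elemOp _ ψ))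
  rw [tensorQuant_apply, tensorQuant_apply, h.intertwines, LinearEquiv.apply_symm_apply,
    LinearEquiv.apply_symm_apply, h.intertwines, ← LinearMap.comp_apply, ← LinearMap.comp_apply,
    ← PiTensorProduct.map_comp, ← PiTensorProduct.map_comp]
  congr 2
  funext ϑ
  rw [S.coord_glue]
  exact (hU _).elemEnd_mul_quantLin (g ϑ) (S.coord n ϑ)

/-- The Hecke operators factor under a tensor intertwiner. -/
theorem IsTensorIntertwiner.quantLin_hecke (hp : p ≠ 2) (D : EigenFrame A)
    (h : S.IsTensorIntertwiner 𝒰)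
    {U : (d : ℕ) → SpP p d →* (HilbertP p d ≃ₗᵢ[ℂ] HilbertP p d)} (hU : ∀ d, IsQuantization (U d))
    (B : heckeGroup A) :
    quantLin (U d) B.1 = tensorQuant 𝒰 U fun ϑ => (S.heckeComp ϑ B).1 := by
  classical
  -- Both representations conjugate the Weyl operators in the same way, so by Schur's lemma they
  -- differ by scalars, and these form a character of the product of symplectic groups.
  obtain ⟨c, hc⟩ := exists_character_of_scalars ((quantLin (U d)).comp S.glue)
    (tensorQuant 𝒰 U) fun g => by
      have hinv : tensorQuant 𝒰 U g * tensorQuant 𝒰 U g⁻¹ = 1 := by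
        rw [← map_mul, mul_inv_cancel, map_one]
      have hinv' : tensorQuant 𝒰 U g⁻¹ * tensorQuant 𝒰 U g = 1 := by
        rw [← map_mul, inv_mul_cancel, map_one]
      obtain ⟨a, ha⟩ := eq_smul_one_of_commute_elemEnd hp
        (X := quantLin (U d) (S.glue g) * tensorQuant 𝒰 U g⁻¹) fun n => by
          have h1 := h.elemEnd_mul hU g⁻¹ (n ᵥ* (S.glue g).1)
          rw [← vecMul_mul_spP, ← map_mul, mul_inv_cancel, map_one, vecMul_one_spP] at h1
          rw [← mul_assoc, (hU d).elemEnd_mul_quantLin, mul_assoc, h1, mul_assoc]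
      refine ⟨a, ?_⟩
      rw [MonoidHom.comp_apply]
      have h2 := congrArg (· * tensorQuant 𝒰 U g) ha
      simpa only [mul_assoc, hinv', mul_one, smul_mul_assoc, one_mul] using h2
  -- Checked on each factor. The discrepancy `c` then disappears on the Hecke group, whose order is
  -- prime to `p`.
  have hcp : ∀ g, c g ^ p = 1 := by
    have : (powMonoidHom p).comp c = 1 := by
      refine MonoidHom.pi_ext fun ϑ g => ?_
      exact symp_monoidHom_pow_eq_one
        (c.comp (MonoidHom.mulSingle (fun ϑ : sympOrbits A => SpP p (halfDim ϑ.1)) ϑ)) g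
    exact fun g => DFunLike.congr_fun this g
  let f : heckeGroup A →* ℂˣ := c.comp (MonoidHom.pi fun ϑ =>
    (heckeGroup (S.comp ϑ)).subtype.comp (S.heckeComp ϑ))
  have hf : f B = 1 := D.hecke_char_eq_one (fun B => hcp _) B
  have h3 := hc fun ϑ => (S.heckeComp ϑ B).1
  rw [MonoidHom.comp_apply, S.glue_heckeComp] at h3
  change c (fun ϑ => (S.heckeComp ϑ B).1) = 1 at hf
  rw [h3, hf, Units.val_one, one_smul]

end SympDecomposition

end

section

/-! ### The standard tensor decomposition of the state space -/

theorem addChar_map_sum {R M ι : Type*} [AddCommMonoid R] [CommMonoid M] (ψ : AddChar R M)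
    (s : Finset ι) (f : ι → R) : ψ (∑ i ∈ s, f i) = ∏ i ∈ s, ψ (f i) := by
  classical
  induction s using Finset.induction_on with
  | empty => simp
  | insert a s ha ih =>
    rw [Finset.sum_insert ha, Finset.prod_insert ha, AddChar.map_add_eq_mul, ih]

section Split

variable {p : ℕ} [Fact p.Prime] {d : ℕ} {ι : Type*} [Fintype ι] {k : ι → ℕ}
  (e : (Σ i, Fin (k i)) ≃ Fin d)

/-- Splitting of a vector into blocks. -/
def splitVec : (Fin d → ZMod p) ≃ ((i : ι) → Fin (k i) → ZMod p) where
  toFun y i j := y (e ⟨i, j⟩)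
  invFun c a := c (e.symm a).1 (e.symm a).2
  left_inv y := funext fun a => congrArg y (e.apply_symm_apply a)
  right_inv c := funext fun i => funext fun j => by
    change c (e.symm (e ⟨i, j⟩)).1 (e.symm (e ⟨i, j⟩)).2 = c i j
    rw [e.symm_apply_apply]

theorem dotProduct_splitVec (y z : Fin d → ZMod p) :
    y ⬝ᵥ z = ∑ i, splitVec e y i ⬝ᵥ splitVec e z i := by
  simp only [dotProduct]
  rw [← e.sum_comp, Fintype.sum_sigma]
  rfl

/-- Splitting of a phase space vector into blocks. -/
def splitPhase : PhaseP p d ≃ₗ[ZMod p] ((i : ι) → PhaseP p (k i)) where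
  toFun n i := Sum.elim (splitVec e (n ∘ Sum.inl) i) (splitVec e (n ∘ Sum.inr) i)
  map_add' m n := by
    funext i j
    rcases j with j | j <;> rfl
  map_smul' a n := by
    funext i j
    rcases j with j | j <;> rfl
  invFun c := Sum.elim ((splitVec e).symm fun i => c i ∘ Sum.inl)
    ((splitVec e).symm fun i => c i ∘ Sum.inr)
  left_inv n := by
    funext a
    rcases a with a | a
    · exact congrFun ((splitVec e).symm_apply_apply (n ∘ Sum.inl)) a
    · exact congrFun ((splitVec e).symm_apply_apply (n ∘ Sum.inr)) a
  right_inv c := by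
    funext i j
    rcases j with j | j
    · exact congrFun (congrFun ((splitVec e).apply_symm_apply fun i => c i ∘ Sum.inl) i) j
    · exact congrFun (congrFun ((splitVec e).apply_symm_apply fun i => c i ∘ Sum.inr) i) j

theorem splitPhase_inl (n : PhaseP p d) (i : ι) :
    splitPhase e n i ∘ Sum.inl = splitVec e (n ∘ Sum.inl) i := rfl

theorem splitPhase_inr (n : PhaseP p d) (i : ι) :
    splitPhase e n i ∘ Sum.inr = splitVec e (n ∘ Sum.inr) i := rfl

theorem sympForm_splitPhase (m n : PhaseP p d) :
    sympForm m n = ∑ i, sympForm (splitPhase e m i) (splitPhase e n i) := by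
  simp only [sympForm, splitPhase_inl, splitPhase_inr, Finset.sum_sub_distrib,
    ← dotProduct_splitVec]

/-- The tensor product of the state spaces of the blocks. -/
def blockTensor : PiTensorProduct ℂ (fun i => HilbertP p (k i)) ≃ₗ[ℂ] HilbertP p d :=
  (Basis.piTensorProduct fun i =>
      (EuclideanSpace.basisFun (Fin (k i) → ZMod p) ℂ).toBasis).equivFun ≪≫ₗ
    LinearEquiv.funCongrLeft ℂ ℂ (splitVec e) ≪≫ₗ (WithLp.linearEquiv 2 ℂ _).symm

theorem blockTensor_tprod (φ : (i : ι) → HilbertP p (k i)) (y : Fin d → ZMod p) :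
    blockTensor e (PiTensorProduct.tprod ℂ φ) y = ∏ i, φ i (splitVec e y i) := by
  simp [blockTensor]

theorem inner_blockTensor (φ φ' : (i : ι) → HilbertP p (k i)) :
    inner ℂ (blockTensor e (PiTensorProduct.tprod ℂ φ))
      (blockTensor e (PiTensorProduct.tprod ℂ φ')) = ∏ i, inner ℂ (φ i) (φ' i) := by
  classical
  simp only [PiLp.inner_apply, blockTensor_tprod]
  rw [Fintype.prod_sum, ← (splitVec e).sum_comp]
  simp [Finset.prod_mul_distrib]

theorem elemOp_blockTensor (n : PhaseP p d) (x : PiTensorProduct ℂ fun i => HilbertP p (k i)) :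
    elemOp n (blockTensor e x) =
      blockTensor e (PiTensorProduct.map (fun i => elemOp (splitPhase e n i)) x) := by
  have h : elemOp n ∘ₗ (blockTensor e).toLinearMap =
      (blockTensor e).toLinearMap ∘ₗ PiTensorProduct.map fun i => elemOp (splitPhase e n i) := by
    refine PiTensorProduct.ext (MultilinearMap.ext fun φ => ?_)
    ext y
    simp only [LinearMap.compMultilinearMap_apply, LinearMap.comp_apply, LinearEquiv.coe_coe,
      PiTensorProduct.map_tprod, blockTensor_tprod]
    simp only [elemOp, LinearMap.coe_mk, AddHom.coe_mk, blockTensor_tprod, splitPhase_inl,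
      splitPhase_inr]
    rw [Finset.prod_mul_distrib, Finset.prod_mul_distrib, ← addChar_map_sum,
      ← addChar_map_sum, ← Finset.mul_sum, ← dotProduct_splitVec, ← dotProduct_splitVec]
    rfl
  exact LinearMap.congr_fun h x

end Split

variable {p : ℕ} [Fact p.Prime] {d : ℕ}

/-! ### Hecke eigenspaces in the tensor decomposition -/

namespace SympDecomposition

variable {A : SpP p d} {S : SympDecomposition A}
  {𝒰 : HilbertP p d ≃ₗ[ℂ] PiTensorProduct ℂ fun ϑ : sympOrbits A => HilbertP p (halfDim ϑ.1)}

/-- For standard coordinate blocks, functions on a product set are tensor products of functions. The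
given symplectic bases differ from the standard blocks by a symplectic matrix `g`, and its
quantization carries one decomposition to the other. -/
theorem exists_isTensorIntertwiner (S : SympDecomposition A) (D : EigenFrame A)
    {U : SpP p d →* (HilbertP p d ≃ₗᵢ[ℂ] HilbertP p d)} (hU : IsQuantization U) :
    ∃ 𝒰 : HilbertP p d ≃ₗ[ℂ] PiTensorProduct ℂ fun ϑ : sympOrbits A => HilbertP p (halfDim ϑ.1),
      S.IsTensorIntertwiner 𝒰 := by
  have hcard : Fintype.card (Σ ϑ : sympOrbits A, Fin (halfDim ϑ.1)) = Fintype.card (Fin d) := by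
    rw [Fintype.card_sigma]
    simp only [Fintype.card_fin]
    have h := D.sum_ncard_orbit
    simp only [← D.two_mul_halfDim] at h
    rw [← Finset.mul_sum] at h
    omega
  let e := Fintype.equivOfCardEq hcard
  let f : PhaseP p d →ₗ[ZMod p] PhaseP p d := (splitPhase e).symm.toLinearMap ∘ₗ
    S.coord.toLinearMap
  have hf : ∀ n, splitPhase e (f n) = S.coord n := fun n => (splitPhase e).apply_symm_apply _
  let g := spOfLinearMap f fun m n => by
    rw [sympForm_splitPhase e, hf, hf, ← S.form_eq]
  have hg : ∀ n, splitPhase e (n ᵥ* g.1) = S.coord n := fun n => by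
    rw [vecMul_spOfLinearMap, hf]
  refine ⟨(U g).symm.toLinearEquiv ≪≫ₗ (blockTensor e).symm, fun φ φ' => ?_, fun n ψ => ?_⟩
  · change inner ℂ (U g (blockTensor e _)) (U g (blockTensor e _)) = _
    rw [LinearIsometryEquiv.inner_map_map, inner_blockTensor]
  · change (blockTensor e).symm ((U g).symm (elemOp n ψ)) =
      PiTensorProduct.map (fun ϑ => elemOp (S.coord n ϑ)) ((blockTensor e).symm ((U g).symm ψ))
    rw [LinearEquiv.symm_apply_eq, ← hg, ← elemOp_blockTensor, LinearEquiv.apply_symm_apply]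
    have h := hU g n ((U g).symm ψ)
    rw [LinearIsometryEquiv.apply_symm_apply] at h
    exact h

/-- Pure tensors of eigenvectors are eigenvectors since the Hecke operators factor. Conversely an
eigenvector is fixed by the tensor product of the character projections, whose range is spanned by
pure tensors of eigenvectors. -/
theorem IsTensorIntertwiner.heckeEigenspace_eq (hp : p ≠ 2) (D : EigenFrame A)
    (h : S.IsTensorIntertwiner 𝒰)
    {U : (d : ℕ) → SpP p d →* (HilbertP p d ≃ₗᵢ[ℂ] HilbertP p d)} (hU : ∀ d, IsQuantization (U d))
    (χ : (ϑ : sympOrbits A) → heckeGroup (S.comp ϑ) →* ℂˣ)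
    {κ : sympOrbits A → Type*} [∀ ϑ, Fintype (κ ϑ)]
    {v : (ϑ : sympOrbits A) → κ ϑ → HilbertP p (halfDim ϑ.1)}
    (hv : ∀ ϑ, LinearIndependent ℂ (v ϑ) ∧ Submodule.span ℂ (Set.range (v ϑ)) =
      heckeEigenspace (U (halfDim ϑ.1)) (S.comp ϑ) (χ ϑ)) :
    LinearIndependent ℂ (fun f : (ϑ : sympOrbits A) → κ ϑ =>
        𝒰.symm (PiTensorProduct.tprod ℂ fun ϑ => v ϑ (f ϑ))) ∧
      Submodule.span ℂ (Set.range fun f : (ϑ : sympOrbits A) → κ ϑ =>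
        𝒰.symm (PiTensorProduct.tprod ℂ fun ϑ => v ϑ (f ϑ))) =
        heckeEigenspace (U d) A (S.prodChar χ) := by
  classical
  refine ⟨(linearIndependent_tprod fun ϑ => (hv ϑ).1).map' 𝒰.symm.toLinearMap 𝒰.symm.ker,
    le_antisymm ?_ fun ψ hψ => ?_⟩
  · rw [Submodule.span_le]
    rintro _ ⟨f, rfl⟩ B
    have h1 := LinearMap.congr_fun (h.quantLin_hecke hp D hU B)
      (𝒰.symm (PiTensorProduct.tprod ℂ fun ϑ => v ϑ (f ϑ)))
    rw [tensorQuant_apply, LinearEquiv.apply_symm_apply, PiTensorProduct.map_tprod] at h1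
    have h2 : ∀ ϑ, quantLin (U (halfDim ϑ.1)) (S.heckeComp ϑ B).1 (v ϑ (f ϑ)) =
        (χ ϑ (S.heckeComp ϑ B) : ℂ) • v ϑ (f ϑ) := fun ϑ => by
      have h3 : v ϑ (f ϑ) ∈ heckeEigenspace (U (halfDim ϑ.1)) (S.comp ϑ) (χ ϑ) := by
        rw [← (hv ϑ).2]; exact Submodule.subset_span ⟨f ϑ, rfl⟩
      exact h3 _
    simp only [h2] at h1
    rw [MultilinearMap.map_smul_univ, map_smul] at h1
    refine h1.trans ?_
    rw [prodChar_apply, Units.coe_prod]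
  · let _ : ∀ ϑ, Fintype (heckeGroup (S.comp ϑ)) := fun ϑ => Fintype.ofFinite _
    let ρ : (ϑ : sympOrbits A) → heckeGroup (S.comp ϑ) →* Module.End ℂ (HilbertP p (halfDim ϑ.1)) :=
      fun ϑ => (quantLin (U (halfDim ϑ.1))).comp (heckeGroup (S.comp ϑ)).subtype
    have hfix : PiTensorProduct.map (fun ϑ => charProj (ρ ϑ) (χ ϑ)) (𝒰 ψ) = 𝒰 ψ := by
      -- The components `g` are independent of each other, and every choice glues to a Hecke
      -- element; so each term of the averaged sum fixes `𝒰 ψ`.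
      have h1 : ∀ g : (ϑ : sympOrbits A) → heckeGroup (S.comp ϑ),
          (∏ ϑ, (χ ϑ (g ϑ)⁻¹ : ℂ)) • PiTensorProduct.map (fun ϑ => ρ ϑ (g ϑ)) (𝒰 ψ) = 𝒰 ψ := by
        intro g
        have h2 := LinearMap.congr_fun (h.quantLin_hecke hp D hU (S.heckeGlue g)) ψ
        simp only [S.heckeComp_heckeGlue] at h2
        rw [tensorQuant_apply, LinearEquiv.eq_symm_apply] at h2
        change _ • PiTensorProduct.map
          (fun ϑ => quantLin (U (halfDim ϑ.1)) (g ϑ).1) (𝒰 ψ) = 𝒰 ψ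
        rw [← h2, quantLin_apply, hψ, map_smul, smul_smul, prodChar_apply, Units.coe_prod,
          ← Finset.prod_mul_distrib]
        simp [S.heckeComp_heckeGlue]
      rw [map_charProj, LinearMap.smul_apply, LinearMap.sum_apply]
      simp only [LinearMap.smul_apply, h1]
      rw [Finset.sum_const, Finset.card_univ, Fintype.card_pi, ← Nat.cast_smul_eq_nsmul ℂ, smul_smul,
        Nat.cast_prod, ← Finset.prod_mul_distrib, Finset.prod_eq_one, one_smul]
      intro ϑ _
      exact inv_mul_cancel₀ card_group_ne_zero
    have hrange : 𝒰 ψ ∈ LinearMap.range (PiTensorProduct.map fun ϑ => charProj (ρ ϑ) (χ ϑ)) :=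
      ⟨_, hfix⟩
    rw [PiTensorProduct.map_range_eq_span_tprod] at hrange
    have hspan : 𝒰 ψ ∈ Submodule.span ℂ (Set.range fun f : (ϑ : sympOrbits A) → κ ϑ =>
        PiTensorProduct.tprod ℂ fun ϑ => v ϑ (f ϑ)) := by
      refine Submodule.span_le.2 ?_ hrange
      rintro _ ⟨m, rfl⟩
      refine tprod_mem_span fun ϑ => ?_
      rw [(hv ϑ).2]
      exact (charProj_isProj (ρ ϑ) (χ := χ ϑ) (fun v => Iff.rfl)).map_mem (m ϑ)
    have := Submodule.mem_map_of_mem (f := 𝒰.symm.toLinearMap) hspan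
    rw [Submodule.map_span, ← Set.range_comp] at this
    simpa [Function.comp_def] using this

theorem IsTensorIntertwiner.finrank_heckeEigenspace (hp : p ≠ 2) (D : EigenFrame A)
    (h : S.IsTensorIntertwiner 𝒰)
    {U : (d : ℕ) → SpP p d →* (HilbertP p d ≃ₗᵢ[ℂ] HilbertP p d)} (hU : ∀ d, IsQuantization (U d))
    (χ : (ϑ : sympOrbits A) → heckeGroup (S.comp ϑ) →* ℂˣ) :
    Module.finrank ℂ (heckeEigenspace (U d) A (S.prodChar χ)) =
      ∏ ϑ, Module.finrank ℂ (heckeEigenspace (U (halfDim ϑ.1)) (S.comp ϑ) (χ ϑ)) := by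
  let b := fun ϑ : sympOrbits A => Module.finBasis ℂ (heckeEigenspace (U (halfDim ϑ.1)) (S.comp ϑ) (χ ϑ))
  have h1 := h.heckeEigenspace_eq hp D hU χ
    (v := fun ϑ j => (b ϑ j : HilbertP p (halfDim ϑ.1))) fun ϑ =>
      ⟨(b ϑ).linearIndependent.map' (Submodule.subtype _) (Submodule.ker_subtype _), by
        rw [Set.range_comp', ← Submodule.coe_subtype, ← Submodule.map_span, (b ϑ).span_eq,
          Submodule.map_top, Submodule.range_subtype]⟩
  rw [← h1.2, finrank_span_eq_card h1.1, Fintype.card_pi]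
  simp only [Fintype.card_fin]

end SympDecomposition

end

end

/-! ### Assembly of the one-orbit and the general statement -/

open scoped TensorProduct in
open Classical in
theorem mainTheorem8 (p : ℕ) [Fact p.Prime] (hp : p ≠ 2) :
    (∀ d : ℕ, ∃ U : SpP p d →* (HilbertP p d ≃ₗᵢ[ℂ] HilbertP p d), IsQuantization U) ∧
    ∀ U : (d : ℕ) → SpP p d →* (HilbertP p d ≃ₗᵢ[ℂ] HilbertP p d),
      (∀ d, IsQuantization (U d)) →
    ∀ (d : ℕ) (A : SpP p d), (eigenvaluesP A).Nodup →
      -- one irreducible symplectic orbit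
      (∀ ϑ : Set (AlgebraicClosure (ZMod p)), sympOrbits A = {ϑ} →
        ∃ χ₂ : heckeGroup A →* ℂˣ,
          (∀ χ : heckeGroup A →* ℂˣ, orderOf χ = 2 ↔ χ = χ₂) ∧
          (∀ χ : heckeGroup A →* ℂˣ, χ ≠ χ₂ →
            Module.finrank ℂ (heckeEigenspace (U d) A χ) = 1) ∧
          (IsSymmetricOrbit ϑ → Module.finrank ℂ (heckeEigenspace (U d) A χ₂) = 0) ∧
          (¬ IsSymmetricOrbit ϑ → Module.finrank ℂ (heckeEigenspace (U d) A χ₂) = 2)) ∧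
      -- the general case
      Nonempty (SympDecomposition A) ∧
      ∀ S : SympDecomposition A,
        (∀ ϑ, ∃! χ₂ : heckeGroup (S.comp ϑ) →* ℂˣ, orderOf χ₂ = 2) ∧
        Function.Bijective S.prodChar ∧
        (∃ 𝒰 : HilbertP p d ≃ₗ[ℂ] (⨂[ℂ] ϑ : sympOrbits A, HilbertP p (halfDim ϑ.1)),
          S.IsTensorIntertwiner 𝒰) ∧
        ∀ χ : (ϑ : sympOrbits A) → heckeGroup (S.comp ϑ) →* ℂˣ,
          ((∀ ϑ, orderOf (χ ϑ) ≠ 2) →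
            Module.finrank ℂ (heckeEigenspace (U d) A (S.prodChar χ)) = 1) ∧
          ((∃ ϑ, orderOf (χ ϑ) = 2 ∧ IsSymmetricOrbit ϑ.1) →
            Module.finrank ℂ (heckeEigenspace (U d) A (S.prodChar χ)) = 0) ∧
          ((∀ ϑ, orderOf (χ ϑ) = 2 → ¬ IsSymmetricOrbit ϑ.1) →
            Module.finrank ℂ (heckeEigenspace (U d) A (S.prodChar χ)) =
              2 ^ Fintype.card {ϑ : sympOrbits A // orderOf (χ ϑ) = 2} ∧
            ∀ 𝒰 : HilbertP p d ≃ₗ[ℂ] (⨂[ℂ] ϑ : sympOrbits A, HilbertP p (halfDim ϑ.1)),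
              S.IsTensorIntertwiner 𝒰 →
            -- `φ ϑ` spans the eigenspace of `χ ϑ` where `χ ϑ` is not quadratic,
            -- `ψ ϑ 0, ψ ϑ 1` is a basis of it where `χ ϑ` is quadratic
            ∀ (φ : (ϑ : sympOrbits A) → HilbertP p (halfDim ϑ.1))
              (ψ : (ϑ : sympOrbits A) → ZMod 2 → HilbertP p (halfDim ϑ.1)),
              (∀ ϑ, orderOf (χ ϑ) ≠ 2 →
                φ ϑ ≠ 0 ∧ φ ϑ ∈ heckeEigenspace (U (halfDim ϑ.1)) (S.comp ϑ) (χ ϑ)) →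
              (∀ ϑ, orderOf (χ ϑ) = 2 → LinearIndependent ℂ (ψ ϑ) ∧
                Submodule.span ℂ (Set.range (ψ ϑ)) =
                  heckeEigenspace (U (halfDim ϑ.1)) (S.comp ϑ) (χ ϑ)) →
              let Ψ : ({ϑ : sympOrbits A // orderOf (χ ϑ) = 2} → ZMod 2) → HilbertP p d :=
                fun η => 𝒰.symm (PiTensorProduct.tprod ℂ fun ϑ =>
                  if h : orderOf (χ ϑ) = 2 then ψ ϑ (η ⟨ϑ, h⟩) else φ ϑ)
              LinearIndependent ℂ Ψ ∧
                Submodule.span ℂ (Set.range Ψ) = heckeEigenspace (U d) A (S.prodChar χ)) := by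
  refine ⟨exists_isQuantization hp, fun U hU d A hA => ?_⟩
  obtain ⟨D⟩ := nonempty_eigenFrame hA
  refine ⟨fun ϑ hϑ => one_orbit hp (hU d) hA hϑ, D.nonempty_sympDecomposition, fun S => ?_⟩
  -- Each component `A_ϑ` again has simple spectrum and the single orbit `ϑ`, so the one-orbit case
  -- applies to it.
  choose χ₂ h₂ h1 hsym hnon using fun ϑ : sympOrbits A =>
    one_orbit hp (hU (halfDim ϑ.1)) (S.eigenvaluesP_comp D ϑ).1 (S.sympOrbits_comp D ϑ)
  refine ⟨fun ϑ => ⟨χ₂ ϑ, (h₂ ϑ _).2 rfl, fun χ hχ => (h₂ ϑ χ).1 hχ⟩, S.prodChar_bijective,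
    S.exists_isTensorIntertwiner D (hU d), fun χ => ?_⟩
  -- The dimension does not depend on the intertwiner, so any one computes it.
  obtain ⟨𝒰₀, h𝒰₀⟩ := S.exists_isTensorIntertwiner D (hU d)
  have hfin := h𝒰₀.finrank_heckeEigenspace hp D hU χ
  have hone : ∀ ϑ, orderOf (χ ϑ) ≠ 2 →
      Module.finrank ℂ (heckeEigenspace (U (halfDim ϑ.1)) (S.comp ϑ) (χ ϑ)) = 1 :=
    fun ϑ h => h1 ϑ (χ ϑ) fun he => h ((h₂ ϑ _).2 he)
  refine ⟨fun h => ?_, fun h => ?_, fun h => ⟨?_, ?_⟩⟩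
  · rw [hfin]
    exact Finset.prod_eq_one fun ϑ _ => hone ϑ (h ϑ)
  · obtain ⟨ϑ, h3, h4⟩ := h
    rw [hfin]
    refine Finset.prod_eq_zero (Finset.mem_univ ϑ) ?_
    rw [(h₂ ϑ _).1 h3]
    exact hsym ϑ h4
  · have h5 : ∀ ϑ, Module.finrank ℂ (heckeEigenspace (U (halfDim ϑ.1)) (S.comp ϑ) (χ ϑ)) =
        if orderOf (χ ϑ) = 2 then 2 else 1 := by
      intro ϑ
      split_ifs with h3
      · have h6 := hnon ϑ (h ϑ h3)
        rwa [← (h₂ ϑ _).1 h3] at h6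
      · exact hone ϑ h3
    rw [hfin, Finset.prod_congr rfl fun ϑ _ => h5 ϑ, Finset.prod_ite, Finset.prod_const,
      Finset.prod_const_one, mul_one, Fintype.card_subtype]
  · intro 𝒰 h𝒰 φ ψ hφ hψ
    -- The type of functions from the proposition `orderOf (χ ϑ) = 2` to `ZMod 2` has two elements
    -- where `χ ϑ` is quadratic and one elsewhere. It indexes the bases of all factors uniformly,
    -- and `e` identifies families of such indices with the labels `η`.
    let e : ({ϑ : sympOrbits A // orderOf (χ ϑ) = 2} → ZMod 2) ≃
        ((ϑ : sympOrbits A) → orderOf (χ ϑ) = 2 → ZMod 2) :=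
      { toFun := fun η ϑ h => η ⟨ϑ, h⟩
        invFun := fun f ϑ => f ϑ.1 ϑ.2
        left_inv := fun _ => rfl
        right_inv := fun _ => rfl }
    obtain ⟨hli, hsp⟩ := h𝒰.heckeEigenspace_eq hp D hU χ
      (v := fun ϑ (η : orderOf (χ ϑ) = 2 → ZMod 2) =>
        if h : orderOf (χ ϑ) = 2 then ψ ϑ (η h) else φ ϑ) fun ϑ => by
      by_cases h3 : orderOf (χ ϑ) = 2
      · simp only [dif_pos h3]
        have hb : Function.Bijective fun η : orderOf (χ ϑ) = 2 → ZMod 2 => η h3 :=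
          ⟨fun η η' hη => funext fun _ => hη, fun a => ⟨fun _ => a, rfl⟩⟩
        refine ⟨(hψ ϑ h3).1.comp _ hb.1, ?_⟩
        rw [← (hψ ϑ h3).2, ← hb.2.range_comp]
        rfl
      · simp only [dif_neg h3]
        have : IsEmpty (orderOf (χ ϑ) = 2) := ⟨h3⟩
        obtain ⟨h0, hmem⟩ := hφ ϑ h3
        refine ⟨LinearIndependent.of_subsingleton default h0, ?_⟩
        rw [Set.range_const]
        refine Submodule.eq_of_le_of_finrank_eq ?_ ?_
        · rwa [Submodule.span_singleton_le_iff_mem]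
        · rw [finrank_span_singleton h0, hone ϑ h3]
    refine ⟨hli.comp e e.injective, ?_⟩
    rw [← hsp, ← e.surjective.range_comp]
    rfl
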